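/- Let $N\ge 1$. Conventions: $C^*(\ldots|\ldots)$ is the universal unital $C^*$-algebra with the given generators and relations. The free real sphere is given by $C(S^{N-1}_{\mathbb R,+})=C^*(x_1,\ldots,x_N\,|\,x_i=x_i^*,\ \sum_ix_i^2=1)$; $S^{N-1}_{\mathbb R,*}$ and $S^{N-1}_{\mathbb R,\infty}$ are obtained by adding the relations $x_ix_jx_k=x_kx_jx_i$, respectively $x_i^2x_j=x_jx_i^2$, and $S^{N-1}_{\mathbb R}$ is the usual sphere with its coordinate functions. Let $\mathbb Z_2^{*N}=\langle g_1,\ldots,g_N\,|\,g_i^2=1\rangle$, let $\mathbb Z_2^{\circ N}$ be its quotient by the relations $g_ig_jg_k=g_kg_jg_i$, and let $\mathbb Z_2^N$ be the usual product group, with its standard generators. For each of these groups $\Gamma$, the noncommutative cube $\widehat\Gamma$ is given by $C(\widehat\Gamma)=C^*(\Gamma)$ (full group $C^*$-algebra), with coordinates $x_i=g_i/\sqrt N$, and the associated sphere $S^{N-1}_\Gamma$ is obtained from $S^{N-1}_{\mathbb R,+}$ by imposing $x_{i_1}\cdots x_{i_k}=x_{j_1}\cdots x_{j_k}$ whenever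 $g_{i_1}\cdots g_{i_k}=g_{j_1}\cdots g_{j_k}$ in $\Gamma$ and each index appears the same number of times in $(i_1,\ldots,i_k)$ and in $(j_1,\ldots,j_k)$. The free orthogonal quantum group $O_N^+$ is given by $C(O_N^+)=C^*(u_{ij}\,|\,u_{ij}=u_{ij}^*,\ u=(u_{ij})\text{ orthogonal})$. For noncommutative spaces with coordinates, $X\subset Y$ means that there is a unital $*$-homomorphism $C(Y)\to C(X)$ mapping coordinates to coordinates, and spaces contained in each other are identified. A quantum subgroup $G\subset O_N^+$ is a closed subspace (that is, $C(G)$ is generated by its coordinates $u_{ij}$, and $G\subset O_N^+$ in the above sense) such that $u_{ij}\mapsto\sum_ku_{ik}\otimes u_{kj}$, $u_{ij}\mapsto\delta_{ij}$, $u_{ij}\mapsto u_{ji}$ define unital $*$-homomorphisms $C(G)\to C(G)\otimes C(G)$, $C(G)\to\mathbb C$, $C(G)\to C(G)^{opp}$ (with $\otimes$ the minimal tensor product). It acts affinely on $X\subset S^{N-1}_{\mathbb R,+}$ if there is a unital $*$-homomorphism $C(X)\to C(G)\otimes C(X)$ with $x_i\mapsto\sum_ju_{ij}\otimes x_j$.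 For $X$ algebraic (given inside $S^{N-1}_{\mathbb R,+}$ by polynomial relations between the coordinates) and non-degenerate (the coordinates $x_1,\ldots,x_N$ are linearly independent in $C(X)$), the quantum isometry group $G^+(X)$ is the greatest quantum subgroup of $O_N^+$ acting affinely on $X$. Let $O_N$ be the usual orthogonal group, and consider the following subspaces of $O_N^+$: - $O_N^*$: $abc=cba$ for all $a,b,c\in\{u_{ij}\}$; - $\bar O_N$: $ab=-ba$ for distinct entries $a,b$ on the same row or column of $u$, and $ab=ba$ for the other pairs of entries; - $H_N^+$: $ab=0$ for distinct entries $a,b$ on the same row or column of $u$; - $H_N^*$: the relations of $H_N^+$ and of $O_N^*$; - $H_N^{[\infty]}$: $abc=0$ for any entries $a,b,c$ of $u$ such that $a,c$ are distinct and on the same row or column. **Theorem.** 1. The spheres associated to $\mathbb Z_2^N,\mathbb Z_2^{\circ N},\mathbb Z_2^{*N}$ are $S^{N-1}_{\mathbb R},S^{N-1}_{\mathbb R,*},S^{N-1}_{\mathbb R,\infty}$. We have $S^{N-1}_{\mathbb R}\subset S^{N-1}_{\mathbb R,*}\subset S^{N-1}_{\mathbb R,\infty}$ and $\widehat{\mathbb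 Z_2^N}\subset\widehat{\mathbb Z_2^{\circ N}}\subset\widehat{\mathbb Z_2^{*N}}$, and each of these cubes is contained in the sphere associated to the same group. 2. The cubes $\widehat{\mathbb Z_2^N},\widehat{\mathbb Z_2^{\circ N}},\widehat{\mathbb Z_2^{*N}}$ are algebraic and non-degenerate, and have as quantum isometry groups $\bar O_N,H_N^*,H_N^+$. The spheres $S^{N-1}_{\mathbb R},S^{N-1}_{\mathbb R,*}$ are algebraic and non-degenerate, and have as quantum isometry groups $O_N,O_N^*$. If $N\ne2$, then $S^{N-1}_{\mathbb R,\infty}$ is algebraic and non-degenerate, and has as quantum isometry group $H_N^{[\infty]}$. 3. We have $O_N\subset O_N^*$, $H_N^*\subset H_N^+$, $H_N^*\subset O_N^*$ and $H_N^{[\infty]}\subset H_N^+$. 4. The correspondence $X\mapsto G^+(X)$ is not functorial with respect to inclusions. If $N\ge2$, then there is no inclusion, in either direction, between $\bar O_N$ and $O_N$, nor between $\bar O_N$ and $H_N^*$, and we have $O_N^*\not\subset H_N^{[\infty]}$. If $N\ge3$, then also $H_N^{[\infty]}\not\subset O_N^*$. -/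

import Mathlib

open scoped TensorProduct ENNReal

noncomputable section

namespace QIso

/-! ### C*-algebras presented by a class of tuples -/

/-- The value of a `*`-polynomial in the letters `ι` (the second copy of `ι` standing for the
adjoints of the letters) on a tuple of elements of a C*-algebra. -/
def starEval {ι D : Type} [CStarAlgebra D] (f : ι → D) : FreeAlgebra ℂ (ι ⊕ ι) →ₐ[ℂ] D :=
  FreeAlgebra.lift ℂ (Sum.elim f (fun i => star (f i)))

/-- Data for a universal C*-algebra: a class of tuples of elements of C*-algebras ("solutions"),
with a bound on the norm of each letter that is uniform over all solutions. -/
structure Presentation (ι : Type) where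
  Sol : ∀ (D : Type) [CStarAlgebra D], (ι → D) → Prop
  bound : ι → ℝ
  norm_le : ∀ (D : Type) [CStarAlgebra D] [Nontrivial D] (f : ι → D), Sol D f →
    ∀ i, ‖f i‖ ≤ bound i

namespace Presentation

variable {ι : Type} (P : Presentation ι)

/-- The C*-seminorms `a ↦ ‖a(f)‖` on `*`-polynomials, `f` running through the solutions. -/
def Idx : Type :=
  {p : FreeAlgebra ℂ (ι ⊕ ι) → ℝ //
    ∃ (D : Type) (_ : CStarAlgebra D) (_ : Nontrivial D) (f : ι → D),
      P.Sol D f ∧ ∀ a, p a = ‖starEval f a‖}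

/-- A C*-algebra realizing the given seminorm. -/
def Comp (p : P.Idx) : Type := p.2.choose

instance (p : P.Idx) : CStarAlgebra (P.Comp p) := p.2.choose_spec.choose

instance (p : P.Idx) : Nontrivial (P.Comp p) := p.2.choose_spec.choose_spec.choose

/-- A solution realizing the given seminorm. -/
def compGen (p : P.Idx) : ι → P.Comp p := p.2.choose_spec.choose_spec.choose_spec.choose

theorem compGen_sol (p : P.Idx) : P.Sol (P.Comp p) (P.compGen p) :=
  p.2.choose_spec.choose_spec.choose_spec.choose_spec.1

theorem compGen_norm (p : P.Idx) (a : FreeAlgebra ℂ (ι ⊕ ι)) :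
    p.1 a = ‖starEval (P.compGen p) a‖ :=
  p.2.choose_spec.choose_spec.choose_spec.choose_spec.2 a

/-- The bounded product of all the realizations. -/
abbrev Prod : Type := lp P.Comp ∞

instance : CStarAlgebra P.Prod where

/-- The tuple in the bounded product whose components are all the solutions. -/
def prodGen (i : ι) : P.Prod :=
  ⟨fun p => P.compGen p i, memℓp_infty ⟨P.bound i, by
    rintro _ ⟨p, rfl⟩
    exact P.norm_le _ _ (P.compGen_sol p) i⟩⟩

/-- The C*-subalgebra of the bounded product generated by the universal tuple. -/
def sub : StarSubalgebra ℂ P.Prod :=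
  (StarAlgebra.adjoin ℂ (Set.range P.prodGen)).topologicalClosure

instance : IsClosed (P.sub : Set P.Prod) := StarSubalgebra.isClosed_topologicalClosure _

/-- The universal C*-algebra of the presentation: the C*-algebra generated by a tuple, with
the norm of a `*`-polynomial being the supremum of its norms over all solutions. -/
def Alg : Type := P.sub

instance : CStarAlgebra P.Alg := inferInstanceAs (CStarAlgebra P.sub)

/-- The universal tuple. -/
def gen (i : ι) : P.Alg :=
  ⟨P.prodGen i, StarSubalgebra.le_topologicalClosure _
    (StarAlgebra.subset_adjoin ℂ _ (Set.mem_range_self i))⟩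

/-- The inclusion of the universal C*-algebra in the bounded product. -/
def incl : P.Alg →⋆ₐ[ℂ] P.Prod := P.sub.subtype

theorem incl_gen (i : ι) : P.incl (P.gen i) = P.prodGen i := rfl

theorem incl_isometry : Isometry P.incl := isometry_subtype_coe

theorem gen_generates : (StarAlgebra.adjoin ℂ (Set.range P.gen)).topologicalClosure = ⊤ := by
  have hmap : P.incl '' (StarAlgebra.adjoin ℂ (Set.range P.gen) : Set P.Alg) =
      (StarAlgebra.adjoin ℂ (Set.range P.prodGen) : Set P.Prod) := by
    have h := StarAlgHom.map_adjoin P.incl (Set.range P.gen)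
    have h2 : P.incl '' Set.range P.gen = Set.range P.prodGen := (Set.range_comp _ _).symm
    rw [h2] at h
    rw [← h]
    rfl
  rw [StarSubalgebra.eq_top_iff]
  intro x
  have hx : P.incl x ∈ closure ((StarAlgebra.adjoin ℂ (Set.range P.prodGen) :
      StarSubalgebra ℂ P.Prod) : Set P.Prod) := x.2
  rw [← hmap] at hx
  have hx' : x ∈ P.incl ⁻¹' closure (P.incl ''
      (StarAlgebra.adjoin ℂ (Set.range P.gen) : Set P.Alg)) := hx
  rwa [← P.incl_isometry.isEmbedding.isInducing.closure_eq_preimage_closure_image] at hx'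

end Presentation

/-! ### The minimal (spatial) tensor product -/

section Tensor

variable {H K : Type} [NormedAddCommGroup H] [InnerProductSpace ℂ H]
  [NormedAddCommGroup K] [InnerProductSpace ℂ K]

theorem norm_sum_tmul {n : ℕ} (h : Fin n → H) (f : Fin n → K) (hf : Orthonormal ℂ f) :
    ‖∑ i, h i ⊗ₜ[ℂ] f i‖ ^ 2 = ∑ i, ‖h i‖ ^ 2 := by
  rw [← inner_self_eq_norm_sq (𝕜 := ℂ), sum_inner]
  simp only [inner_sum, TensorProduct.inner_tmul, orthonormal_iff_ite.mp hf]
  simp [inner_self_eq_norm_sq_to_K, ← Complex.ofReal_pow]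

theorem norm_rTensor_le (T : H →L[ℂ] H) (x : H ⊗[ℂ] K) :
    ‖(T : H →ₗ[ℂ] H).rTensor K x‖ ≤ ‖T‖ * ‖x‖ := by
  obtain ⟨F, hF, hx⟩ := TensorProduct.exists_finite_submodule_right_of_setFinite {x}
    (Set.finite_singleton x)
  obtain ⟨y, rfl⟩ := Set.singleton_subset_iff.mp hx
  let e := stdOrthonormalBasis ℂ F
  obtain ⟨c, rfl⟩ := TensorProduct.eq_repr_basis_right e.toBasis y
  have ho : Orthonormal ℂ (fun i => (e i : K)) := e.orthonormal.comp_linearIsometry F.subtypeₗᵢ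
  have key : ∀ h : Fin (Module.finrank ℂ F) → H, ‖∑ i, T (h i) ⊗ₜ[ℂ] (e i : K)‖ ≤
      ‖T‖ * ‖∑ i, h i ⊗ₜ[ℂ] (e i : K)‖ := by
    intro h
    refine le_of_sq_le_sq ?_ (by positivity)
    rw [mul_pow, norm_sum_tmul _ _ ho, norm_sum_tmul _ _ ho, Finset.mul_sum]
    refine Finset.sum_le_sum fun i _ => ?_
    rw [← mul_pow]
    gcongr
    exact T.le_opNorm _
  have := key c
  rw [Finsupp.sum_fintype _ _ (by simp)]
  simpa [map_sum] using this

theorem norm_lTensor_le (S : K →L[ℂ] K) (x : H ⊗[ℂ] K) :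
    ‖(S : K →ₗ[ℂ] K).lTensor H x‖ ≤ ‖S‖ * ‖x‖ := by
  have h := norm_rTensor_le (K := H) S (TensorProduct.comm ℂ H K x)
  rw [TensorProduct.norm_comm] at h
  have e := LinearMap.rTensor_comm (N := H) (S : K →ₗ[ℂ] K) x
  rwa [e, TensorProduct.norm_comm] at h

variable (H K) in
/-- The Hilbert space tensor product of `H` and `K`, the completion of `H ⊗[ℂ] K`. -/
def HilbertTensor : Type := UniformSpace.Completion (H ⊗[ℂ] K)

instance : NormedAddCommGroup (HilbertTensor H K) :=
  inferInstanceAs (NormedAddCommGroup (UniformSpace.Completion (H ⊗[ℂ] K)))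

instance : InnerProductSpace ℂ (HilbertTensor H K) :=
  inferInstanceAs (InnerProductSpace ℂ (UniformSpace.Completion (H ⊗[ℂ] K)))

instance : CompleteSpace (HilbertTensor H K) :=
  inferInstanceAs (CompleteSpace (UniformSpace.Completion (H ⊗[ℂ] K)))

variable (K) in
/-- The operator `T ⊗ 1` on the Hilbert space tensor product. -/
def ampLeft (T : H →L[ℂ] H) : HilbertTensor H K →L[ℂ] HilbertTensor H K :=
  (((T : H →ₗ[ℂ] H).rTensor K).mkContinuous ‖T‖ (norm_rTensor_le T)).completion

variable (H) in
/-- The operator `1 ⊗ S` on the Hilbert space tensor product. -/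
def ampRight (S : K →L[ℂ] K) : HilbertTensor H K →L[ℂ] HilbertTensor H K :=
  (((S : K →ₗ[ℂ] K).lTensor H).mkContinuous ‖S‖ (norm_lTensor_le S)).completion

theorem norm_ampLeft_le (T : H →L[ℂ] H) : ‖ampLeft K T‖ ≤ ‖T‖ := by
  refine ContinuousLinearMap.opNorm_le_bound _ (norm_nonneg _) fun x => ?_
  refine UniformSpace.Completion.induction_on (α := H ⊗[ℂ] K)
    (p := fun x => ‖ampLeft K T x‖ ≤ ‖T‖ * ‖(show HilbertTensor H K from x)‖) x ?_ fun y => ?_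
  · exact isClosed_le (ampLeft K T).continuous.norm (continuous_const.mul continuous_norm)
  · change ‖(((T : H →ₗ[ℂ] H).rTensor K).mkContinuous ‖T‖ (norm_rTensor_le T)).completion
      (y : UniformSpace.Completion (H ⊗[ℂ] K))‖ ≤
        ‖T‖ * ‖(y : UniformSpace.Completion (H ⊗[ℂ] K))‖
    rw [ContinuousLinearMap.completion_apply_coe, UniformSpace.Completion.norm_coe,
      UniformSpace.Completion.norm_coe]
    exact norm_rTensor_le T y

theorem norm_ampRight_le (S : K →L[ℂ] K) : ‖ampRight H S‖ ≤ ‖S‖ := by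
  refine ContinuousLinearMap.opNorm_le_bound _ (norm_nonneg _) fun x => ?_
  refine UniformSpace.Completion.induction_on (α := H ⊗[ℂ] K)
    (p := fun x => ‖ampRight H S x‖ ≤ ‖S‖ * ‖(show HilbertTensor H K from x)‖) x ?_ fun y => ?_
  · exact isClosed_le (ampRight H S).continuous.norm (continuous_const.mul continuous_norm)
  · change ‖(((S : K →ₗ[ℂ] K).lTensor H).mkContinuous ‖S‖ (norm_lTensor_le S)).completion
      (y : UniformSpace.Completion (H ⊗[ℂ] K))‖ ≤
        ‖S‖ * ‖(y : UniformSpace.Completion (H ⊗[ℂ] K))‖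
    rw [ContinuousLinearMap.completion_apply_coe, UniformSpace.Completion.norm_coe,
      UniformSpace.Completion.norm_coe]
    exact norm_lTensor_le S y

/-- The elementary tensor `h ⊗ k` in the Hilbert space tensor product. -/
def hilbertTmul (h : H) (k : K) : HilbertTensor H K :=
  ((h ⊗ₜ[ℂ] k : H ⊗[ℂ] K) : UniformSpace.Completion (H ⊗[ℂ] K))

theorem ampLeft_hilbertTmul (T : H →L[ℂ] H) (h : H) (k : K) :
    ampLeft K T (hilbertTmul h k) = hilbertTmul (T h) k :=
  ContinuousLinearMap.completion_apply_coe _ _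

theorem ampRight_hilbertTmul (S : K →L[ℂ] K) (h : H) (k : K) :
    ampRight H S (hilbertTmul h k) = hilbertTmul h (S k) :=
  ContinuousLinearMap.completion_apply_coe _ _

theorem inner_hilbertTmul (h h' : H) (k k' : K) :
    inner ℂ (hilbertTmul h k) (hilbertTmul h' k') = inner ℂ h h' * inner ℂ k k' :=
  (UniformSpace.Completion.inner_coe _ _).trans (TensorProduct.inner_tmul _ _ _ _ _)

end Tensor

/-- Spatial representations of a pair of C*-algebras: the elements `a ⊗ 1` and `1 ⊗ b`, for
representations `π`, `ρ` of the two algebras on Hilbert spaces `H`, `K`, viewed (via an isometric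
embedding `j`) as operators on `H ⊗ K`. -/
def spatialPresentation (A B : Type) [CStarAlgebra A] [CStarAlgebra B] :
    Presentation (A ⊕ B) where
  Sol D _ f := ∃ (H K : Type) (_ : NormedAddCommGroup H) (_ : InnerProductSpace ℂ H)
    (_ : CompleteSpace H) (_ : NormedAddCommGroup K) (_ : InnerProductSpace ℂ K)
    (_ : CompleteSpace K) (π : A →⋆ₐ[ℂ] (H →L[ℂ] H)) (ρ : B →⋆ₐ[ℂ] (K →L[ℂ] K))
    (j : D →⋆ₐ[ℂ] (HilbertTensor H K →L[ℂ] HilbertTensor H K)),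
      (∀ d, ‖j d‖ = ‖d‖) ∧ (∀ a, j (f (Sum.inl a)) = ampLeft K (π a)) ∧
        ∀ b, j (f (Sum.inr b)) = ampRight H (ρ b)
  bound := Sum.elim (fun a => ‖a‖) (fun b => ‖b‖)
  norm_le := by
    rintro D _ _ f ⟨H, K, _, _, _, _, _, _, π, ρ, j, hj, hl, hr⟩ (a | b)
    · rw [← hj, hl]
      exact (norm_ampLeft_le _).trans (NonUnitalStarAlgHom.norm_apply_le π a)
    · rw [← hj, hr]
      exact (norm_ampRight_le _).trans (NonUnitalStarAlgHom.norm_apply_le ρ b)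

/-- The minimal tensor product of two C*-algebras, the C*-algebra generated by the
elements `a ⊗ b` in the spatial norm. -/
abbrev MinTensor (A B : Type) [CStarAlgebra A] [CStarAlgebra B] : Type :=
  (spatialPresentation A B).Alg

/-- The elementary tensor `a ⊗ b = (a ⊗ 1)(1 ⊗ b)`. -/
def minTmul {A B : Type} [CStarAlgebra A] [CStarAlgebra B] (a : A) (b : B) : MinTensor A B :=
  (spatialPresentation A B).gen (Sum.inl a) * (spatialPresentation A B).gen (Sum.inr b)

/-! ### Noncommutative compact spaces with coordinates -/

/-- A noncommutative compact space with self-adjoint coordinates: a unital C*-algebra `C(X)`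
generated by a family of self-adjoint elements. -/
structure NCSpace (ι : Type) where
  C : Type
  [cstar : CStarAlgebra C]
  coord : ι → C
  selfAdjoint : ∀ i, IsSelfAdjoint (coord i)
  generates : (StarAlgebra.adjoin ℂ (Set.range coord)).topologicalClosure = ⊤

attribute [instance] NCSpace.cstar

/-- Inclusion of noncommutative spaces: `X ⊂ Y` when there is a morphism `C(Y) → C(X)` mapping
coordinates to coordinates (it is then onto, and unique). -/
instance {ι : Type} : Preorder (NCSpace ι) where
  le X Y := ∃ φ : Y.C →⋆ₐ[ℂ] X.C, ∀ i, φ (Y.coord i) = X.coord i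
  le_refl X := ⟨StarAlgHom.id ℂ X.C, fun _ => rfl⟩
  le_trans _ _ _ := fun ⟨φ, hφ⟩ ⟨ψ, hψ⟩ => ⟨φ.comp ψ, fun i => by simp [hψ, hφ]⟩

/-- Two noncommutative spaces with coordinates are identified when each contains the other,
that is, when their C*-algebras are isomorphic through coordinates to coordinates. -/
def SameSpace {ι : Type} (X Y : NCSpace ι) : Prop := X ≤ Y ∧ Y ≤ X

/-- Self-adjoint tuples killed by a set of noncommutative polynomials. -/
def polyPresentation {ι : Type} (R : Set (FreeAlgebra ℂ ι))
    (hR : ∀ (D : Type) [CStarAlgebra D] [Nontrivial D] (f : ι → D), (∀ i, IsSelfAdjoint (f i)) →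
      (∀ r ∈ R, FreeAlgebra.lift ℂ f r = 0) → ∀ i, ‖f i‖ ≤ 1) : Presentation ι where
  Sol _ _ f := (∀ i, IsSelfAdjoint (f i)) ∧ ∀ r ∈ R, FreeAlgebra.lift ℂ f r = 0
  bound _ := 1
  norm_le _ _ _ f h := hR _ f h.1 h.2

/-- The noncommutative space whose C*-algebra is the universal one generated by self-adjoint
elements subject to a set of polynomial relations. -/
def polySpace {ι : Type} (R : Set (FreeAlgebra ℂ ι))
    (hR : ∀ (D : Type) [CStarAlgebra D] [Nontrivial D] (f : ι → D), (∀ i, IsSelfAdjoint (f i)) →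
      (∀ r ∈ R, FreeAlgebra.lift ℂ f r = 0) → ∀ i, ‖f i‖ ≤ 1) : NCSpace ι where
  C := (polyPresentation R hR).Alg
  coord := (polyPresentation R hR).gen
  selfAdjoint i := Subtype.ext <| lp.ext <| funext fun p =>
    ((polyPresentation R hR).compGen_sol p).1 i
  generates := (polyPresentation R hR).gen_generates

theorem norm_le_one_of_sum_sq {D ι : Type} [CStarAlgebra D] [Nontrivial D] [Fintype ι]
    (f : ι → D) (hf : ∀ i, IsSelfAdjoint (f i)) (h : ∑ i, f i * f i = 1) (i : ι) :
    ‖f i‖ ≤ 1 := by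
  let _ := CStarAlgebra.spectralOrder D
  let _ := CStarAlgebra.spectralOrderedRing D
  have hn : ∀ j, 0 ≤ f j * f j := fun j => by
    have := star_mul_self_nonneg (f j)
    rwa [(hf j).star_eq] at this
  have hle : f i * f i ≤ 1 := by
    rw [← h]
    exact Finset.single_le_sum (f := fun j => f j * f j) (fun j _ => hn j) (Finset.mem_univ i)
  have h1 := CStarAlgebra.norm_le_norm_of_nonneg_of_le (hn i) hle
  rw [CStarRing.norm_one] at h1
  have h2 : ‖f i * f i‖ = ‖f i‖ * ‖f i‖ := by
    have := CStarRing.norm_star_mul_self (x := f i)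
    rwa [(hf i).star_eq] at this
  rw [h2] at h1
  nlinarith [norm_nonneg (f i)]

/-! ### Noncommutative spheres -/

/-- The letter `x_i`. -/
abbrev letter {ι : Type} (i : ι) : FreeAlgebra ℂ ι := FreeAlgebra.ι ℂ i

/-- The polynomial `x_1² + ... + x_N² - 1`. -/
def spherePoly (N : ℕ) : FreeAlgebra ℂ (Fin N) := ∑ i, letter i * letter i - 1

/-- The algebraic subspace of the free sphere given by a set of polynomial relations. -/
def sphereSub (N : ℕ) (R : Set (FreeAlgebra ℂ (Fin N))) : NCSpace (Fin N) :=
  polySpace (insert (spherePoly N) R) fun _ _ _ f hf h =>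
    norm_le_one_of_sum_sq f hf <| by
      have := h _ (Set.mem_insert _ _)
      simpa [spherePoly, sub_eq_zero] using this

/-- The free real sphere. -/
def freeSphere (N : ℕ) : NCSpace (Fin N) := sphereSub N ∅

/-- The half-liberated real sphere: `x_i x_j x_k = x_k x_j x_i`. -/
def halfSphere (N : ℕ) : NCSpace (Fin N) :=
  sphereSub N {r | ∃ i j k, r = letter i * letter j * letter k - letter k * letter j * letter i}

/-- The sphere with central squares of coordinates: `x_i² x_j = x_j x_i²`. -/
def sphereInfty (N : ℕ) : NCSpace (Fin N) :=
  sphereSub N {r | ∃ i j, r = letter i * letter i * letter j - letter j * letter i * letter i}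

/-- The classical sphere, with the algebra of continuous functions on the unit sphere of `ℝ^N`. -/
def classicalSphere (N : ℕ) : NCSpace (Fin N) where
  C := C(Metric.sphere (0 : EuclideanSpace ℝ (Fin N)) 1, ℂ)
  coord i := ⟨fun x => ((x.1 i : ℝ) : ℂ), by fun_prop⟩
  selfAdjoint i := by ext x; simp
  generates := by
    apply ContinuousMap.starSubalgebra_topologicalClosure_eq_top_of_separatesPoints
    intro x y hxy
    have : ∃ i, x.1 i ≠ y.1 i := by
      by_contra! h
      exact hxy (Subtype.ext (PiLp.ext h))
    obtain ⟨i, hi⟩ := this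
    refine ⟨_, ⟨_, StarAlgebra.subset_adjoin ℂ _ (Set.mem_range_self i), rfl⟩, ?_⟩
    simpa using hi

/-! ### Noncommutative cubes -/

/-- A reflection group: a group generated by `N` given elements of square one. -/
structure ReflectionGroup (N : ℕ) where
  Γ : Type
  [group : Group Γ]
  g : Fin N → Γ
  sq : ∀ i, g i * g i = 1
  generates : Subgroup.closure (Set.range g) = ⊤

attribute [instance] ReflectionGroup.group

/-- Unitary representations of a group. -/
def groupPresentation (Γ : Type) [Group Γ] : Presentation Γ where
  Sol _ _ f := f 1 = 1 ∧ (∀ g h, f (g * h) = f g * f h) ∧ ∀ g, star (f g) = f g⁻¹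
  bound _ := 1
  norm_le _ _ _ f h g := by
    have h1 : star (f g) * f g = 1 := by rw [h.2.2, ← h.2.1]; simp [h.1]
    have h2 := CStarRing.norm_star_mul_self (x := f g)
    rw [h1, CStarRing.norm_one] at h2
    nlinarith [norm_nonneg (f g)]

/-- The full group C*-algebra. -/
abbrev GroupCStar (Γ : Type) [Group Γ] : Type := (groupPresentation Γ).Alg

/-- A group element, viewed in the full group C*-algebra. -/
abbrev groupElt {Γ : Type} [Group Γ] (g : Γ) : GroupCStar Γ := (groupPresentation Γ).gen g

section GroupElt

variable {Γ : Type} [Group Γ]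

theorem groupElt_one : groupElt (1 : Γ) = 1 :=
  Subtype.ext <| lp.ext <| funext fun p => ((groupPresentation Γ).compGen_sol p).1

theorem groupElt_mul (g h : Γ) : groupElt (g * h) = groupElt g * groupElt h :=
  Subtype.ext <| lp.ext <| funext fun p => ((groupPresentation Γ).compGen_sol p).2.1 g h

theorem star_groupElt (g : Γ) : star (groupElt g) = groupElt g⁻¹ :=
  Subtype.ext <| lp.ext <| funext fun p => ((groupPresentation Γ).compGen_sol p).2.2 g

end GroupElt

/-- The noncommutative cube dual to a reflection group, with algebra the full group C*-algebra
and coordinates `x_i = g_i / √N`. -/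
def cube {N : ℕ} (G : ReflectionGroup N) : NCSpace (Fin N) where
  C := GroupCStar G.Γ
  coord i := ((1 / √(N : ℝ) : ℝ) : ℂ) • groupElt (G.g i)
  selfAdjoint i := by
    have : (G.g i)⁻¹ = G.g i := inv_eq_of_mul_eq_one_left (G.sq i)
    simp [IsSelfAdjoint, star_smul, star_groupElt, this]
  generates := by
    set S := StarAlgebra.adjoin ℂ
      (Set.range fun i => ((1 / √(N : ℝ) : ℝ) : ℂ) • groupElt (G.g i)) with hS
    have hgen : ∀ i, groupElt (G.g i) ∈ S := fun i => by
      have h0 : ((1 / √(N : ℝ) : ℝ) : ℂ) ≠ 0 := by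
        have : (0 : ℝ) < N := by exact_mod_cast i.pos
        exact_mod_cast (by positivity : (1 / √(N : ℝ) : ℝ) ≠ 0)
      have h1 := S.smul_mem (StarAlgebra.subset_adjoin ℂ _ (Set.mem_range_self i))
        (((1 / √(N : ℝ) : ℝ) : ℂ)⁻¹)
      rwa [smul_smul, inv_mul_cancel₀ h0, one_smul] at h1
    have hall : ∀ g : G.Γ, groupElt g ∈ S := fun g => by
      have hg : g ∈ Subgroup.closure (Set.range G.g) := by rw [G.generates]; trivial
      induction hg using Subgroup.closure_induction with
      | mem x hx => obtain ⟨i, rfl⟩ := hx; exact hgen i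
      | one => rw [groupElt_one]; exact one_mem S
      | mul x y _ _ hx hy => rw [groupElt_mul]; exact mul_mem hx hy
      | inv x _ hx => rw [← star_groupElt]; exact star_mem hx
    rw [eq_top_iff, ← (groupPresentation G.Γ).gen_generates]
    refine StarSubalgebra.topologicalClosure_mono (StarAlgebra.adjoin_le ?_)
    rintro _ ⟨g, rfl⟩
    exact hall g

/-- The group `ℤ₂^N`, with its standard generators. -/
def cubeGroup (N : ℕ) : ReflectionGroup N where
  Γ := Fin N → Multiplicative (ZMod 2)
  g i := Pi.mulSingle i (Multiplicative.ofAdd 1)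
  sq i := by
    rw [← Pi.mulSingle_mul, ← ofAdd_add]
    have : (1 + 1 : ZMod 2) = 0 := by decide
    simp [this]
  generates := by
    rw [eq_top_iff]
    intro x _
    rw [← Finset.univ_prod_mulSingle x]
    refine Subgroup.prod_mem _ fun i _ => ?_
    have h : ∀ z : Multiplicative (ZMod 2), z = 1 ∨ z = Multiplicative.ofAdd 1 := by decide
    rcases h (x i) with h | h
    · rw [h, Pi.mulSingle_one]; exact one_mem _
    · rw [h]; exact Subgroup.subset_closure (Set.mem_range_self i)

/-- The reflection group presented by the relations `g_i² = 1` and further relations `R`. -/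
def presentedReflectionGroup (N : ℕ) (R : Set (FreeGroup (Fin N))) : ReflectionGroup N where
  Γ := PresentedGroup ({r | ∃ i, r = FreeGroup.of i * FreeGroup.of i} ∪ R)
  g := PresentedGroup.of
  sq i := (QuotientGroup.eq_one_iff _).mpr
    (Subgroup.subset_normalClosure (Or.inl ⟨i, rfl⟩))
  generates := PresentedGroup.closure_range_of _

/-- The half-liberated group `ℤ₂^{∘N}`, given by the relations `g_i² = 1` and
`g_i g_j g_k = g_k g_j g_i`. -/
def halfGroup (N : ℕ) : ReflectionGroup N :=
  presentedReflectionGroup N {r | ∃ i j k, r = FreeGroup.of i * FreeGroup.of j * FreeGroup.of k *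
    (FreeGroup.of k * FreeGroup.of j * FreeGroup.of i)⁻¹}

/-- The free product `ℤ₂^{*N}`, given by the relations `g_i² = 1`. -/
def freeGroup (N : ℕ) : ReflectionGroup N := presentedReflectionGroup N ∅

/-- The sphere associated to a reflection group: the coordinates are subject to the relations
`x_{i_1} ... x_{i_k} = x_{j_1} ... x_{j_k}`, for all the relations
`g_{i_1} ... g_{i_k} = g_{j_1} ... g_{j_k}` of the group that are normalized, in the sense that
each letter appears the same number of times on both sides. -/
def associatedSphere {N : ℕ} (G : ReflectionGroup N) : NCSpace (Fin N) :=
  sphereSub N {r | ∃ v w : List (Fin N), v.Perm w ∧ (v.map G.g).prod = (w.map G.g).prod ∧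
    r = (v.map letter).prod - (w.map letter).prod}

/-! ### Orthogonal quantum groups -/

/-- The relations expressing that the square matrix of letters is orthogonal. -/
def orthRel (N : ℕ) : Set (FreeAlgebra ℂ (Fin N × Fin N)) :=
  {r | ∃ i j, r = ∑ k, letter (i, k) * letter (j, k) - if i = j then 1 else 0} ∪
    {r | ∃ i j, r = ∑ k, letter (k, i) * letter (k, j) - if i = j then 1 else 0}

/-- The universal orthogonal matrix of self-adjoint elements subject to polynomial relations. -/
def orthSub (N : ℕ) (R : Set (FreeAlgebra ℂ (Fin N × Fin N))) : NCSpace (Fin N × Fin N) :=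
  polySpace (orthRel N ∪ R) fun _ _ _ f hf h i =>
    norm_le_one_of_sum_sq (fun k => f (i.1, k)) (fun k => hf _) (by
      have := h _ (Or.inl (Or.inl ⟨i.1, i.1, rfl⟩))
      simpa [sub_eq_zero] using this) i.2

/-- Two positions in a square matrix lie on the same row or on the same column. -/
def SameLine {N : ℕ} (a b : Fin N × Fin N) : Prop := a.1 = b.1 ∨ a.2 = b.2

/-- The free orthogonal quantum group `O_N^+`. -/
def freeOrth (N : ℕ) : NCSpace (Fin N × Fin N) := orthSub N ∅

instance (N : ℕ) : CompactSpace (Matrix.orthogonalGroup (Fin N) ℝ) := by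
  refine isCompact_iff_compactSpace.mp (?_ :
    IsCompact (Matrix.orthogonalGroup (Fin N) ℝ : Set (Matrix (Fin N) (Fin N) ℝ)))
  have hc : IsClosed ((Matrix.orthogonalGroup (Fin N) ℝ : Set (Matrix (Fin N) (Fin N) ℝ))) := by
    have : ((Matrix.orthogonalGroup (Fin N) ℝ : Set (Matrix (Fin N) (Fin N) ℝ))) =
        {A | A * star A = 1} := by
      ext A
      exact Matrix.mem_unitaryGroup_iff
    rw [this]
    exact isClosed_eq (by fun_prop) continuous_const
  refine IsCompact.of_isClosed_subset (s := Set.pi Set.univ fun _ : Fin N =>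
    Set.pi Set.univ fun _ : Fin N => Set.Icc (-1 : ℝ) 1)
    (isCompact_univ_pi fun _ => isCompact_univ_pi fun _ => isCompact_Icc) hc ?_
  intro A hA i _ j _
  have := entry_norm_bound_of_unitary (𝕜 := ℝ) hA i j
  rwa [Real.norm_eq_abs, abs_le] at this

/-- The orthogonal group `O_N`, with the algebra of continuous functions on it. -/
def classicalOrth (N : ℕ) : NCSpace (Fin N × Fin N) where
  C := C(Matrix.orthogonalGroup (Fin N) ℝ, ℂ)
  coord a := ⟨fun U => ((U.1 a.1 a.2 : ℝ) : ℂ), Complex.continuous_ofReal.comp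
    ((continuous_apply_apply a.1 a.2).comp continuous_subtype_val)⟩
  selfAdjoint a := by ext U; simp
  generates := by
    apply ContinuousMap.starSubalgebra_topologicalClosure_eq_top_of_separatesPoints
    intro x y hxy
    have : ∃ i j, x.1 i j ≠ y.1 i j := by
      by_contra! h
      exact hxy (Subtype.ext (Matrix.ext h))
    obtain ⟨i, j, hij⟩ := this
    refine ⟨_, ⟨_, StarAlgebra.subset_adjoin ℂ _ (Set.mem_range_self (i, j)), rfl⟩, ?_⟩
    simpa using hij

/-- The relations `abc = cba` between the entries of a square matrix. -/
def halfRel (N : ℕ) : Set (FreeAlgebra ℂ (Fin N × Fin N)) :=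
  {r | ∃ a b c, r = letter a * letter b * letter c - letter c * letter b * letter a}

/-- The half-liberated orthogonal quantum group `O_N^*`. -/
def halfOrth (N : ℕ) : NCSpace (Fin N × Fin N) := orthSub N (halfRel N)

/-- The twisted orthogonal quantum group `Ō_N`: distinct entries on the same row or column
anticommute, and entries not on the same row or column commute. -/
def twistedOrth (N : ℕ) : NCSpace (Fin N × Fin N) :=
  orthSub N ({r | ∃ a b, a ≠ b ∧ SameLine a b ∧ r = letter a * letter b + letter b * letter a} ∪
    {r | ∃ a b, ¬ SameLine a b ∧ r = letter a * letter b - letter b * letter a})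

/-- The relations `ab = 0`, for distinct entries on the same row or column. -/
def cubicRel (N : ℕ) : Set (FreeAlgebra ℂ (Fin N × Fin N)) :=
  {r | ∃ a b, a ≠ b ∧ SameLine a b ∧ r = letter a * letter b}

/-- The free hyperoctahedral quantum group `H_N^+`. -/
def freeHyper (N : ℕ) : NCSpace (Fin N × Fin N) := orthSub N (cubicRel N)

/-- The half-liberated hyperoctahedral quantum group `H_N^*`. -/
def halfHyper (N : ℕ) : NCSpace (Fin N × Fin N) := orthSub N (cubicRel N ∪ halfRel N)

/-- The quantum group `H_N^{[∞]}`, given by the relations `abc = 0`, for any entries with `a ≠ c`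
on the same row or column. -/
def hyperInfty (N : ℕ) : NCSpace (Fin N × Fin N) :=
  orthSub N {r | ∃ a b c, a ≠ c ∧ SameLine a c ∧ r = letter a * letter b * letter c}

/-- `G` is a closed quantum subgroup of `O_N^+`: a closed subspace for which the comultiplication
`u_ij ↦ ∑_k u_ik ⊗ u_kj`, the counit `u_ij ↦ δ_ij` and the antipode `u_ij ↦ u_ji` (with values
in the opposite algebra) exist. -/
def IsQuantumSubgroup {N : ℕ} (G : NCSpace (Fin N × Fin N)) : Prop :=
  G ≤ freeOrth N ∧
    (∃ Δ : G.C →⋆ₐ[ℂ] MinTensor G.C G.C,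
      ∀ i j, Δ (G.coord (i, j)) = ∑ k, minTmul (G.coord (i, k)) (G.coord (k, j))) ∧
    (∃ ε : G.C →⋆ₐ[ℂ] ℂ, ∀ i j, ε (G.coord (i, j)) = if i = j then 1 else 0) ∧
    ∃ S : G.C →⋆ₐ[ℂ] G.Cᵐᵒᵖ, ∀ i j, S (G.coord (i, j)) = MulOpposite.op (G.coord (j, i))

/-- `G` acts affinely on `X`: there is a morphism `Φ : C(X) → C(G) ⊗ C(X)` such that
`Φ(x_i) = ∑_j u_ij ⊗ x_j` (the coaction axioms are automatic, being clear on coordinates). -/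
def ActsOn {N : ℕ} (G : NCSpace (Fin N × Fin N)) (X : NCSpace (Fin N)) : Prop :=
  ∃ Φ : X.C →⋆ₐ[ℂ] MinTensor G.C X.C,
    ∀ i, Φ (X.coord i) = ∑ j, minTmul (G.coord (i, j)) (X.coord j)

/-- `G` is the quantum isometry group of `X`, that is, `X` is an algebraic and non-degenerate
subspace of the free sphere, and `G` is the greatest quantum subgroup of `O_N^+` acting affinely
on `X`. -/
structure IsQuantumIsometryGroup {N : ℕ} (X : NCSpace (Fin N)) (G : NCSpace (Fin N × Fin N)) :
    Prop where
  algebraic : ∃ R, SameSpace X (sphereSub N R)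
  nondegenerate : LinearIndependent ℂ X.coord
  isGreatest : IsGreatest {G' | IsQuantumSubgroup G' ∧ ActsOn G' X} G

end QIso

end

open QIso

noncomputable section

namespace QIso

/-! ### Universal properties -/

section StarEval

variable {ι D E : Type} [CStarAlgebra D] [CStarAlgebra E]

/-! Every space involved is universal for an explicit set of relations between self-adjoint
coordinates (`IsUniversal`). So $X\subset Y$ holds as soon as the coordinates of $X$ satisfy the
relations of $Y$. The positive statements then become algebra. A family of relations on matrices
defines a quantum group when it survives products of matrices with commuting entries, holds for the
identity, and survives transposition into the opposite algebra (`IsGroupRel`). The resulting $G$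
acts on $X$ when the relations of $u$ and $x$ force those of $X$ on $\sum_k u_{ik}x_k$.

Maximality is the harder half. If $G$ acts on $X$, a relation between words in the $x_i$ becomes an
equation $\sum_w a_w\otimes w=0$ in $C(G)\otimes C(X)$, where the $a_w$ are polynomials in the
$u_{ij}$. By `sum_smul_eq_zero_of_sum_minTmul`, any linear combination of the $a_w$ compatible with
the linear relations between the words $w$ vanishes. Enough must therefore be known about linear
relations between words of length 2 and 3. A relation in $C(X)$ holds in $C(X')$ for every
$X'\subset X$, so two kinds of subspaces suffice. Permutation representations of the reflection
groups control words in a cube whose consecutive letters differ. Points of the classical sphere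
control words containing a square, which a cube cannot see because $x_i^2=1/N$ there.

Slicing yields only symmetrized identities, such as $[u_{ia},u_{jb}]+[u_{ib},u_{ja}]=0$. The
antipode turns them into the same identities with one sign changed, and comparing the two isolates
$[u_{ia},u_{jb}]=0$. For $S^{N-1}_{\mathbb R,\infty}$ the identities give
$u_{ia}u_{ib}=-u_{ja}u_{jb}$ for all $i\ne j$ and $a\ne b$. With three rows available this forces
$u_{ia}u_{ib}=0$; with two it does not, hence $N\ne2$.

The associated spheres are found by solving word problems. In $\mathbb Z_2^{\circ N}$ a normalized
relation preserves the multisets of letters in odd and in even position, and half-commutation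
realizes all such rearrangements. In $\mathbb Z_2^{*N}$ two equal words have the same reduced form,
and central squares absorb the cancelled pairs.

The missing inclusions are detected by explicit matrices: a real $2\times2$ block, a block with
Pauli matrix entries, and diagonal matrices of anticommuting reflections. -/

@[simp] theorem starEval_inl (f : ι → D) (i : ι) :
    starEval f (FreeAlgebra.ι ℂ (Sum.inl i)) = f i := by simp [starEval]

@[simp] theorem starEval_inr (f : ι → D) (i : ι) :
    starEval f (FreeAlgebra.ι ℂ (Sum.inr i)) = star (f i) := by simp [starEval]

theorem map_starEval (φ : D →⋆ₐ[ℂ] E) (f : ι → D) (a : FreeAlgebra ℂ (ι ⊕ ι)) :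
    φ (starEval f a) = starEval (fun i => φ (f i)) a := by
  have : (φ : D →ₐ[ℂ] E).comp (starEval f) = starEval (fun i => φ (f i)) := by
    refine FreeAlgebra.hom_ext (funext ?_)
    rintro (i | i)
    · simp
    · simpa using map_star φ (f i)
  exact DFunLike.congr_fun this a

theorem exists_starEval_eq_star (a : FreeAlgebra ℂ (ι ⊕ ι)) :
    ∃ b, ∀ (D : Type) [CStarAlgebra D] (f : ι → D), starEval f b = star (starEval f a) := by
  induction a using FreeAlgebra.induction with
  | grade0 r => exact ⟨algebraMap ℂ _ (star r), fun D _ f => by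
      rw [AlgHom.commutes, AlgHom.commutes, algebraMap_star_comm]⟩
  | grade1 i =>
    rcases i with i | i
    · exact ⟨FreeAlgebra.ι ℂ (Sum.inr i), fun D _ f => by simp⟩
    · exact ⟨FreeAlgebra.ι ℂ (Sum.inl i), fun D _ f => by simp⟩
  | mul a b ha hb =>
    obtain ⟨a', ha⟩ := ha
    obtain ⟨b', hb⟩ := hb
    exact ⟨b' * a', fun D _ f => by simp [ha, hb]⟩
  | add a b ha hb =>
    obtain ⟨a', ha⟩ := ha
    obtain ⟨b', hb⟩ := hb
    exact ⟨a' + b', fun D _ f => by simp [ha, hb]⟩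

end StarEval

/-- The graph of a map between generators of C*-algebras is the graph of a morphism, provided
that the norms of `*`-polynomials do not increase. -/
theorem exists_starAlgHom_of_norm_le {ι A B : Type} [CStarAlgebra A] [CStarAlgebra B]
    (g : ι → A) (f : ι → B)
    (hg : (StarAlgebra.adjoin ℂ (Set.range g)).topologicalClosure = ⊤)
    (h : ∀ a, ‖starEval f a‖ ≤ ‖starEval g a‖) :
    ∃ φ : A →⋆ₐ[ℂ] B, ∀ i, φ (g i) = f i := by
  let S₀ : StarSubalgebra ℂ (A × B) := StarAlgebra.adjoin ℂ (Set.range fun i => (g i, f i))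
  let S : StarSubalgebra ℂ (A × B) := S₀.topologicalClosure
  have hS₀ : ∀ x ∈ S₀, ∃ a, x = (starEval g a, starEval f a) := by
    intro x hx
    induction hx using StarAlgebra.adjoin_induction with
    | mem x hx => obtain ⟨i, rfl⟩ := hx; exact ⟨FreeAlgebra.ι ℂ (Sum.inl i), by simp⟩
    | algebraMap r => exact ⟨algebraMap ℂ _ r, by simp [AlgHom.commutes, Prod.algebraMap_apply]⟩
    | add x y _ _ hx hy =>
      obtain ⟨a, rfl⟩ := hx
      obtain ⟨b, rfl⟩ := hy
      exact ⟨a + b, by simp⟩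
    | mul x y _ _ hx hy =>
      obtain ⟨a, rfl⟩ := hx
      obtain ⟨b, rfl⟩ := hy
      exact ⟨a * b, by simp⟩
    | star x _ hx =>
      obtain ⟨a, rfl⟩ := hx
      obtain ⟨b, hb⟩ := exists_starEval_eq_star a
      exact ⟨b, by rw [hb, hb]; rfl⟩
  -- By hypothesis the first component dominates the sup norm on the closed graph `S`. The first
  -- projection is thus isometric with closed range, hence bijective onto `A`, and the morphism is
  -- its inverse followed by the second projection.
  have hnorm : ∀ x ∈ S, ‖x‖ = ‖x.1‖ := by
    intro x hx
    refine closure_minimal (s := (S₀ : Set (A × B))) (t := {x | ‖x‖ = ‖x.1‖}) ?_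
      (isClosed_eq continuous_norm continuous_fst.norm) hx
    intro y hy
    obtain ⟨a, rfl⟩ := hS₀ y hy
    simp [Prod.norm_def, h a]
  let p : S →⋆ₐ[ℂ] A := (StarAlgHom.fst ℂ A B).comp S.subtype
  let q : S →⋆ₐ[ℂ] B := (StarAlgHom.snd ℂ A B).comp S.subtype
  have hp : Isometry p := by
    refine AddMonoidHomClass.isometry_of_norm p fun x => ?_
    exact (hnorm x.1 x.2).symm
  have hclosed : IsClosed (S : Set (A × B)) := StarSubalgebra.isClosed_topologicalClosure _
  have : CompleteSpace S := hclosed.completeSpace_coe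
  have hrange : IsClosed (Set.range p) := hp.isClosedEmbedding.isClosed_range
  have hrange' : IsClosed (p.range : Set A) := by
    exact hrange
  have hsurj : Function.Surjective p := by
    have hle : StarAlgebra.adjoin ℂ (Set.range g) ≤ p.range := by
      refine StarAlgebra.adjoin_le ?_
      rintro _ ⟨i, rfl⟩
      exact ⟨⟨(g i, f i), StarSubalgebra.le_topologicalClosure _
        (StarAlgebra.subset_adjoin ℂ _ ⟨i, rfl⟩)⟩, rfl⟩
    have hle2 : (StarAlgebra.adjoin ℂ (Set.range g)).topologicalClosure ≤ p.range :=
      StarSubalgebra.topologicalClosure_minimal hle hrange'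
    rw [hg] at hle2
    intro x
    exact hle2 (show x ∈ (⊤ : StarSubalgebra ℂ A) from trivial)
  let e := StarAlgEquiv.ofBijective p ⟨hp.injective, hsurj⟩
  refine ⟨q.comp (e.symm : A →⋆ₐ[ℂ] S), fun i => ?_⟩
  have : e.symm (g i) = ⟨(g i, f i), StarSubalgebra.le_topologicalClosure _
        (StarAlgebra.subset_adjoin ℂ _ ⟨i, rfl⟩)⟩ := by
    rw [StarAlgEquiv.symm_apply_eq]
    rfl
  change q (e.symm (g i)) = f i
  rw [this]
  rfl

/-- The morphism to a zero algebra. -/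
def zeroHom (A B : Type) [CStarAlgebra A] [CStarAlgebra B] [Subsingleton B] : A →⋆ₐ[ℂ] B where
  toFun _ := 0
  map_one' := Subsingleton.elim _ _
  map_mul' _ _ := Subsingleton.elim _ _
  map_zero' := rfl
  map_add' _ _ := Subsingleton.elim _ _
  commutes' _ := Subsingleton.elim _ _
  map_star' _ := Subsingleton.elim _ _

namespace Presentation

variable {ι : Type} (P : Presentation ι)

/-- The component of the universal C*-algebra at a solution. -/
def component (p : P.Idx) : P.Alg →⋆ₐ[ℂ] P.Comp p where
  toFun x := (P.incl x : ∀ p, P.Comp p) p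
  map_one' := by rw [map_one]; rfl
  map_mul' x y := by rw [map_mul]; rfl
  map_zero' := by rw [map_zero]; rfl
  map_add' x y := by rw [map_add]; rfl
  commutes' r := by rw [Algebra.algebraMap_eq_smul_one, map_smul, map_one,
    Algebra.algebraMap_eq_smul_one]; rfl
  map_star' x := by rw [map_star]; rfl

@[simp] theorem component_gen (p : P.Idx) (i : ι) : P.component p (P.gen i) = P.compGen p i := rfl

variable {P} in
theorem ext_component {x y : P.Alg} (h : ∀ p, P.component p x = P.component p y) : x = y :=
  Subtype.ext <| lp.ext <| funext h

variable {P} in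
-- The component attached to the seminorm of `f` is some chosen realization, not necessarily `D`
-- itself. It has the same norms of `*`-polynomials, which is all that
-- `exists_starAlgHom_of_norm_le` needs. The zero algebra is treated apart because the index set
-- admits only nontrivial algebras.
theorem exists_hom {D : Type} [CStarAlgebra D] {f : ι → D} (hf : P.Sol D f) :
    ∃ φ : P.Alg →⋆ₐ[ℂ] D, ∀ i, φ (P.gen i) = f i := by
  rcases subsingleton_or_nontrivial D with hD | hD
  · exact ⟨zeroHom _ _, fun i => Subsingleton.elim _ _⟩
  · let p : P.Idx := ⟨fun a => ‖starEval f a‖, D, inferInstance, hD, f, hf, fun _ => rfl⟩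
    refine exists_starAlgHom_of_norm_le _ _ P.gen_generates fun a => ?_
    have h1 : ‖starEval f a‖ = ‖starEval (P.compGen p) a‖ := P.compGen_norm p a
    have h2 := map_starEval (P.component p) P.gen a
    simp only [component_gen] at h2
    rw [h1, ← h2]
    exact NonUnitalStarAlgHom.norm_apply_le (P.component p) _

end Presentation

/-! ### Spaces given by polynomial relations -/

theorem map_lift {ι D E : Type} [CStarAlgebra D] [CStarAlgebra E] (φ : D →⋆ₐ[ℂ] E) (f : ι → D)
    (r : FreeAlgebra ℂ ι) :
    φ (FreeAlgebra.lift ℂ f r) = FreeAlgebra.lift ℂ (fun i => φ (f i)) r := by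
  have : (φ : D →ₐ[ℂ] E).comp (FreeAlgebra.lift ℂ f) = FreeAlgebra.lift ℂ (fun i => φ (f i)) := by
    refine FreeAlgebra.hom_ext (funext fun i => ?_)
    simp
  exact DFunLike.congr_fun this r

section PolySpace

variable {ι : Type} {R : Set (FreeAlgebra ℂ ι)}
  {hR : ∀ (D : Type) [CStarAlgebra D] [Nontrivial D] (f : ι → D), (∀ i, IsSelfAdjoint (f i)) →
      (∀ r ∈ R, FreeAlgebra.lift ℂ f r = 0) → ∀ i, ‖f i‖ ≤ 1}

theorem polySpace_rel {r : FreeAlgebra ℂ ι} (hr : r ∈ R) :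
    FreeAlgebra.lift ℂ (polySpace R hR).coord r = 0 := by
  refine Presentation.ext_component fun p => ?_
  refine Eq.trans ?_ (map_zero ((polyPresentation R hR).component p)).symm
  exact (map_lift ((polyPresentation R hR).component p) _ r).trans
    (((polyPresentation R hR).compGen_sol p).2 r hr)

theorem polySpace_hom {D : Type} [CStarAlgebra D] {f : ι → D} (hsa : ∀ i, IsSelfAdjoint (f i))
    (hf : ∀ r ∈ R, FreeAlgebra.lift ℂ f r = 0) :
    ∃ φ : (polySpace R hR).C →⋆ₐ[ℂ] D, ∀ i, φ ((polySpace R hR).coord i) = f i :=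
  Presentation.exists_hom (P := polyPresentation R hR) ⟨hsa, hf⟩

end PolySpace

/-! ### Representations separate the points of a C*-algebra -/

open scoped ComplexStarModule ComplexOrder in
/-- The complex functional with the same values on self-adjoint elements as a real one. -/
def complexify {A : Type} [CStarAlgebra A] (f : A →ₗ[ℝ] ℝ) : A →ₗ[ℂ] ℂ where
  toFun x := f (ℜ x) + f (ℑ x) * Complex.I
  map_add' x y := by
    simp only [map_add, AddSubgroup.coe_add, Complex.ofReal_add]
    ring
  map_smul' c x := by
    rw [realPart_smul, imaginaryPart_smul]
    simp only [AddSubgroup.coe_sub, AddSubgroup.coe_add, selfAdjoint.val_smul, map_sub, map_add,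
      map_smul, smul_eq_mul, RingHom.id_apply, Complex.ofReal_sub, Complex.ofReal_add,
      Complex.ofReal_mul]
    conv_rhs => rw [← Complex.re_add_im c]
    linear_combination (-(c.im : ℂ) * f (ℑ x)) * Complex.I_sq

open scoped ComplexStarModule ComplexOrder in
-- GNS construction. Since $-a^*a$ lies outside the closed cone of positive elements, Hahn–Banach
-- gives a real functional `f` that is nonnegative on the cone and has $f(a^*a)>0$. Its
-- complexification is positive, and in its GNS representation `a` sends the vector of $1$ to a
-- vector of squared norm $f(a^*a)$.
theorem exists_rep_ne_zero {A : Type} [CStarAlgebra A] {a : A} (ha : a ≠ 0) :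
    ∃ (H : Type) (_ : NormedAddCommGroup H) (_ : InnerProductSpace ℂ H) (_ : CompleteSpace H)
      (π : A →⋆ₐ[ℂ] (H →L[ℂ] H)), π a ≠ 0 := by
  let _ := CStarAlgebra.spectralOrder A
  let _ := CStarAlgebra.spectralOrderedRing A
  have hb : -(star a * a) ∉ ProperCone.positive ℝ A := by
    rw [ProperCone.mem_positive, neg_nonneg]
    intro h
    have := le_antisymm h (star_mul_self_nonneg a)
    exact ha (CStarRing.star_mul_self_eq_zero_iff a |>.mp this)
  obtain ⟨f, hf, hfb⟩ := ProperCone.hyperplane_separation_point _ hb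
  have hval : ∀ x : A, IsSelfAdjoint x → complexify (f : A →ₗ[ℝ] ℝ) x = (f x : ℂ) := by
    intro x hx
    simp [complexify, hx.coe_realPart, hx.imaginaryPart]
  let F : A →ₚ[ℂ] ℂ := PositiveLinearMap.mk₀ (complexify (f : A →ₗ[ℝ] ℝ)) fun x hx => by
    rw [hval x hx.isSelfAdjoint]
    exact_mod_cast hf x hx
  refine ⟨F.GNS, inferInstance, inferInstance, inferInstance, F.gnsStarAlgHom, fun h => ?_⟩
  have h1 : F.gnsStarAlgHom a (F.toPreGNS 1 : F.PreGNS) = 0 := by rw [h]; rfl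
  have h2 : F.gnsStarAlgHom a (F.toPreGNS 1 : F.PreGNS) = ((F.toPreGNS a : F.PreGNS) : F.GNS) := by
    simp [PositiveLinearMap.gnsStarAlgHom]
  rw [h2] at h1
  have h3 : ‖F.toPreGNS a‖ = 0 := by
    rw [← UniformSpace.Completion.norm_coe, h1, norm_zero]
  have h4 := F.preGNS_norm_sq (F.toPreGNS a)
  rw [h3] at h4
  have h5 : F (star a * a) = (f (star a * a) : ℂ) := hval _ (IsSelfAdjoint.star_mul_self a)
  rw [F.ofPreGNS_toPreGNS, h5] at h4
  have h6 : f (star a * a) = 0 := by exact_mod_cast (by simpa using h4.symm : (f (star a * a) : ℂ) = 0)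
  rw [map_neg, h6] at hfb
  simp at hfb

/-! ### Operators on Hilbert space tensor products -/

section Tensor

variable {H K : Type} [NormedAddCommGroup H] [InnerProductSpace ℂ H]
  [NormedAddCommGroup K] [InnerProductSpace ℂ K]

theorem hilbertTensor_induction {p : HilbertTensor H K → Prop} (hc : IsClosed {x | p x})
    (h0 : p 0) (hadd : ∀ x y, p x → p y → p (x + y)) (ht : ∀ h k, p (hilbertTmul h k)) (x) :
    p x := by
  refine UniformSpace.Completion.induction_on (α := H ⊗[ℂ] K) (p := p) x hc fun y => ?_
  induction y using TensorProduct.induction_on with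
  | zero => exact h0
  | tmul h k => exact ht h k
  | add y z hy hz =>
    rw [UniformSpace.Completion.coe_add]
    exact hadd _ _ hy hz

theorem hilbertTensor_clm_ext {S T : HilbertTensor H K →L[ℂ] HilbertTensor H K}
    (h : ∀ a b, S (hilbertTmul a b) = T (hilbertTmul a b)) : S = T := by
  ext x
  refine hilbertTensor_induction (p := fun x => S x = T x) (isClosed_eq S.continuous T.continuous)
    (by simp) (fun x y hx hy => by simp [hx, hy]) h x

theorem hilbertTensor_inner_ext {S T : HilbertTensor H K →L[ℂ] HilbertTensor H K}
    (h : ∀ a b a' b', inner ℂ (S (hilbertTmul a b)) (hilbertTmul a' b') =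
      inner ℂ (hilbertTmul a b) (T (hilbertTmul a' b'))) (x y : HilbertTensor H K) :
    inner ℂ (S x) y = inner ℂ x (T y) := by
  refine hilbertTensor_induction (p := fun x => inner ℂ (S x) y = inner ℂ x (T y))
    (isClosed_eq (by fun_prop) (by fun_prop)) (by simp)
    (fun x y hx hy => by simp [hx, hy]) (fun a b => ?_) x
  refine hilbertTensor_induction (p := fun y => inner ℂ (S (hilbertTmul a b)) y =
      inner ℂ (hilbertTmul a b) (T y))
    (isClosed_eq (by fun_prop) (by fun_prop)) (by simp)
    (fun x y hx hy => by simp [hx, hy]) (h a b) y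

theorem hilbertTmul_add_left (h h' : H) (k : K) :
    hilbertTmul (h + h') k = hilbertTmul h k + hilbertTmul h' k := by
  rw [hilbertTmul, TensorProduct.add_tmul, UniformSpace.Completion.coe_add]; rfl

theorem hilbertTmul_add_right (h : H) (k k' : K) :
    hilbertTmul h (k + k') = hilbertTmul h k + hilbertTmul h k' := by
  rw [hilbertTmul, TensorProduct.tmul_add, UniformSpace.Completion.coe_add]; rfl

theorem hilbertTmul_smul_left (c : ℂ) (h : H) (k : K) :
    hilbertTmul (c • h) k = c • hilbertTmul h k := by
  rw [hilbertTmul, ← TensorProduct.smul_tmul', UniformSpace.Completion.coe_smul]; rfl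

theorem hilbertTmul_smul_right (c : ℂ) (h : H) (k : K) :
    hilbertTmul h (c • k) = c • hilbertTmul h k := by
  rw [hilbertTmul, TensorProduct.tmul_smul, UniformSpace.Completion.coe_smul]; rfl

variable [CompleteSpace H] [CompleteSpace K]

variable (H K) in
/-- The representation `T ↦ T ⊗ 1`. -/
def ampLeftHom : (H →L[ℂ] H) →⋆ₐ[ℂ] (HilbertTensor H K →L[ℂ] HilbertTensor H K) where
  toFun := ampLeft K
  map_one' := hilbertTensor_clm_ext fun a b => by simp [ampLeft_hilbertTmul]
  map_mul' S T := hilbertTensor_clm_ext fun a b => by simp [ampLeft_hilbertTmul]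
  map_zero' := hilbertTensor_clm_ext fun a b => by
    simpa [ampLeft_hilbertTmul] using hilbertTmul_smul_left 0 (0 : H) b
  map_add' S T := hilbertTensor_clm_ext fun a b => by
    simp [ampLeft_hilbertTmul, hilbertTmul_add_left]
  commutes' r := hilbertTensor_clm_ext fun a b => by
    simp [ampLeft_hilbertTmul, hilbertTmul_smul_left, Algebra.algebraMap_eq_smul_one]
  map_star' T := by
    rw [ContinuousLinearMap.star_eq_adjoint, ContinuousLinearMap.star_eq_adjoint]
    refine (ContinuousLinearMap.eq_adjoint_iff _ _).mpr (hilbertTensor_inner_ext ?_)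
    intro a b a' b'
    simp [ampLeft_hilbertTmul, inner_hilbertTmul, ContinuousLinearMap.adjoint_inner_left]

variable (H K) in
/-- The representation `S ↦ 1 ⊗ S`. -/
def ampRightHom : (K →L[ℂ] K) →⋆ₐ[ℂ] (HilbertTensor H K →L[ℂ] HilbertTensor H K) where
  toFun := ampRight H
  map_one' := hilbertTensor_clm_ext fun a b => by simp [ampRight_hilbertTmul]
  map_mul' S T := hilbertTensor_clm_ext fun a b => by simp [ampRight_hilbertTmul]
  map_zero' := hilbertTensor_clm_ext fun a b => by
    simpa [ampRight_hilbertTmul] using hilbertTmul_smul_right 0 a (0 : K)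
  map_add' S T := hilbertTensor_clm_ext fun a b => by
    simp [ampRight_hilbertTmul, hilbertTmul_add_right]
  commutes' r := hilbertTensor_clm_ext fun a b => by
    simp [ampRight_hilbertTmul, hilbertTmul_smul_right, Algebra.algebraMap_eq_smul_one]
  map_star' T := by
    rw [ContinuousLinearMap.star_eq_adjoint, ContinuousLinearMap.star_eq_adjoint]
    refine (ContinuousLinearMap.eq_adjoint_iff _ _).mpr (hilbertTensor_inner_ext ?_)
    intro a b a' b'
    simp [ampRight_hilbertTmul, inner_hilbertTmul, ContinuousLinearMap.adjoint_inner_left]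

theorem ampLeftHom_apply (T : H →L[ℂ] H) : ampLeftHom H K T = ampLeft K T := rfl

theorem ampRightHom_apply (T : K →L[ℂ] K) : ampRightHom H K T = ampRight H T := rfl

theorem commute_amp (S : H →L[ℂ] H) (T : K →L[ℂ] K) :
    Commute (ampLeftHom H K S) (ampRightHom H K T) :=
  hilbertTensor_clm_ext fun a b => by
    simp [ampLeftHom_apply, ampRightHom_apply, ampRight_hilbertTmul, ampLeft_hilbertTmul]

end Tensor

/-! ### The minimal tensor product -/

section MinTensor

variable {A B : Type} [CStarAlgebra A] [CStarAlgebra B]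

/-- Two elements of the minimal tensor product are equal when their images in all spatial
representations are equal. -/
theorem minTensor_ext {x y : MinTensor A B}
    (h : ∀ (H K : Type) [NormedAddCommGroup H] [InnerProductSpace ℂ H] [CompleteSpace H]
      [NormedAddCommGroup K] [InnerProductSpace ℂ K] [CompleteSpace K]
      (π : A →⋆ₐ[ℂ] (H →L[ℂ] H)) (ρ : B →⋆ₐ[ℂ] (K →L[ℂ] K))
      (θ : MinTensor A B →⋆ₐ[ℂ] (HilbertTensor H K →L[ℂ] HilbertTensor H K)),
      (∀ a, θ ((spatialPresentation A B).gen (Sum.inl a)) = ampLeftHom H K (π a)) →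
      (∀ b, θ ((spatialPresentation A B).gen (Sum.inr b)) = ampRightHom H K (ρ b)) →
      θ x = θ y) : x = y := by
  refine Presentation.ext_component fun p => ?_
  obtain ⟨H, K, _, _, _, _, _, _, π, ρ, j, hj, hl, hr⟩ := (spatialPresentation A B).compGen_sol p
  have hinj : Function.Injective j := (AddMonoidHomClass.isometry_of_norm j hj).injective
  exact hinj (h H K π ρ (j.comp ((spatialPresentation A B).component p)) hl hr)

theorem exists_spatial_hom {H K : Type} [NormedAddCommGroup H] [InnerProductSpace ℂ H]
    [CompleteSpace H] [NormedAddCommGroup K] [InnerProductSpace ℂ K] [CompleteSpace K]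
    (π : A →⋆ₐ[ℂ] (H →L[ℂ] H)) (ρ : B →⋆ₐ[ℂ] (K →L[ℂ] K)) :
    ∃ θ : MinTensor A B →⋆ₐ[ℂ] (HilbertTensor H K →L[ℂ] HilbertTensor H K),
      (∀ a, θ ((spatialPresentation A B).gen (Sum.inl a)) = ampLeftHom H K (π a)) ∧
      (∀ b, θ ((spatialPresentation A B).gen (Sum.inr b)) = ampRightHom H K (ρ b)) := by
  obtain ⟨θ, hθ⟩ := Presentation.exists_hom (P := spatialPresentation A B)
    (D := HilbertTensor H K →L[ℂ] HilbertTensor H K)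
    (f := Sum.elim (fun a => ampLeftHom H K (π a)) (fun b => ampRightHom H K (ρ b)))
    ⟨H, K, inferInstance, inferInstance, inferInstance, inferInstance, inferInstance,
      inferInstance, π, ρ, StarAlgHom.id ℂ _, fun _ => rfl, fun _ => rfl, fun _ => rfl⟩
  exact ⟨θ, fun a => hθ (Sum.inl a), fun b => hθ (Sum.inr b)⟩

variable (A B) in
/-- The embedding `a ↦ a ⊗ 1`. -/
def tensorInl : A →⋆ₐ[ℂ] MinTensor A B where
  toFun a := (spatialPresentation A B).gen (Sum.inl a)
  map_one' := minTensor_ext fun H K _ _ _ _ _ _ π ρ θ hl hr => by rw [hl]; simp only [map_one]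
  map_mul' x y := minTensor_ext fun H K _ _ _ _ _ _ π ρ θ hl hr => by
    simp only [hl, map_mul]
  map_zero' := minTensor_ext fun H K _ _ _ _ _ _ π ρ θ hl hr => by rw [hl]; simp only [map_zero]
  map_add' x y := minTensor_ext fun H K _ _ _ _ _ _ π ρ θ hl hr => by
    simp only [hl, map_add]
  commutes' r := minTensor_ext fun H K _ _ _ _ _ _ π ρ θ hl hr => by
    simp only [hl, AlgHomClass.commutes]
  map_star' x := minTensor_ext fun H K _ _ _ _ _ _ π ρ θ hl hr => by
    simp only [hl, map_star]

variable (A B) in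
/-- The embedding `b ↦ 1 ⊗ b`. -/
def tensorInr : B →⋆ₐ[ℂ] MinTensor A B where
  toFun b := (spatialPresentation A B).gen (Sum.inr b)
  map_one' := minTensor_ext fun H K _ _ _ _ _ _ π ρ θ hl hr => by rw [hr]; simp only [map_one]
  map_mul' x y := minTensor_ext fun H K _ _ _ _ _ _ π ρ θ hl hr => by
    simp only [hr, map_mul]
  map_zero' := minTensor_ext fun H K _ _ _ _ _ _ π ρ θ hl hr => by rw [hr]; simp only [map_zero]
  map_add' x y := minTensor_ext fun H K _ _ _ _ _ _ π ρ θ hl hr => by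
    simp only [hr, map_add]
  commutes' r := minTensor_ext fun H K _ _ _ _ _ _ π ρ θ hl hr => by
    simp only [hr, AlgHomClass.commutes]
  map_star' x := minTensor_ext fun H K _ _ _ _ _ _ π ρ θ hl hr => by
    simp only [hr, map_star]

theorem minTmul_eq (a : A) (b : B) : minTmul a b = tensorInl A B a * tensorInr A B b := rfl

theorem commute_tensor (a : A) (b : B) : Commute (tensorInl A B a) (tensorInr A B b) :=
  minTensor_ext fun H K _ _ _ _ _ _ π ρ θ hl hr => by
    rw [map_mul, map_mul]
    exact (congrArg₂ _ (hl a) (hr b)).trans ((commute_amp _ _).eq.trans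
      (congrArg₂ _ (hr b) (hl a)).symm)

theorem minTmul_mul (a a' : A) (b b' : B) :
    minTmul a b * minTmul a' b' = minTmul (a * a') (b * b') := by
  simp only [minTmul_eq, map_mul]
  rw [mul_assoc, ← mul_assoc (tensorInr A B b), (commute_tensor a' b).symm.eq]
  simp only [mul_assoc]

theorem minTmul_sub (a a' : A) (b : B) :
    minTmul (a - a') b = minTmul a b - minTmul a' b := by
  simp [minTmul_eq, sub_mul]

/-- Linear combinations of the left legs of a vanishing tensor that are compatible with
the linear relations between its right legs vanish. -/
theorem sum_smul_eq_zero_of_sum_minTmul {κ : Type} [Fintype κ] {a : κ → A} {b : κ → B}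
    (h : ∑ k, minTmul (a k) (b k) = 0) (l : κ → ℂ)
    (hl : ∀ c : κ → ℂ, ∑ k, c k • b k = 0 → ∑ k, l k * c k = 0) :
    ∑ k, l k • a k = 0 := by
  by_contra hne
  obtain ⟨H, _, _, _, π, hπ⟩ := exists_rep_ne_zero hne
  obtain ⟨v, hv⟩ : ∃ v, π (∑ k, l k • a k) v ≠ 0 := by
    by_contra! h0
    exact hπ (ContinuousLinearMap.ext h0)
  -- The slice is taken by the vector functional $\langle w,\pi(\cdot)v\rangle$. The scalars
  -- $c_k=\langle w,\pi(a_k)v\rangle$ satisfy $\sum_k c_kb_k=0$, so `hl` gives $\langle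
  -- w,w\rangle=\sum_k l_kc_k=0$, a contradiction.
  set w := π (∑ k, l k • a k) v with hw
  have hb : ∑ k, (inner ℂ w (π (a k) v)) • b k = 0 := by
    by_contra hne'
    obtain ⟨K, _, _, _, ρ, hρ⟩ := exists_rep_ne_zero hne'
    obtain ⟨x, hx⟩ : ∃ x, ρ (∑ k, (inner ℂ w (π (a k) v)) • b k) x ≠ 0 := by
      by_contra! h0
      exact hρ (ContinuousLinearMap.ext h0)
    set y := ρ (∑ k, (inner ℂ w (π (a k) v)) • b k) x with hy
    -- If $\sum_k c_kb_k$ were nonzero, some $\rho$ would send a vector `x` to $y\neq0$ by it.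
    -- Applying the vanishing tensor to $v\otimes x$ and pairing with $w\otimes y$ gives $\langle
    -- y,y\rangle=0$.
    obtain ⟨θ, hθl, hθr⟩ := exists_spatial_hom π ρ
    have h1 : ∀ k, θ (minTmul (a k) (b k)) (hilbertTmul v x) =
        hilbertTmul (π (a k) v) (ρ (b k) x) := fun k => by
      rw [minTmul, map_mul, hθl, hθr, ampLeftHom_apply, ampRightHom_apply,
        mul_apply_eq_comp, ampRight_hilbertTmul, ampLeft_hilbertTmul]
    have h2 : ∑ k, hilbertTmul (π (a k) v) (ρ (b k) x) = 0 := by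
      have := congrArg (fun T => θ T (hilbertTmul v x)) h
      simpa [map_sum, sum_apply, h1] using this
    have h3 := congrArg (fun z => inner ℂ (hilbertTmul w y) z) h2
    simp only [inner_sum, inner_hilbertTmul, inner_zero_right] at h3
    have h4 : inner ℂ y y = (0 : ℂ) := by
      rw [← h3]
      have h5 : inner ℂ y y = inner ℂ y (ρ (∑ k, (inner ℂ w (π (a k) v)) • b k) x) := rfl
      rw [h5]
      simp only [map_sum, map_smul, sum_apply, smul_apply,
        inner_sum, inner_smul_right]
    exact hx (inner_self_eq_zero.mp h4)
  have h5 := hl _ hb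
  have h6 : inner ℂ w w = (0 : ℂ) := by
    rw [← h5]
    have h7 : inner ℂ w w = inner ℂ w (π (∑ k, l k • a k) v) := rfl
    rw [h7]
    simp only [map_sum, map_smul, sum_apply, smul_apply,
        inner_sum, inner_smul_right]
  exact hv (inner_self_eq_zero.mp h6)

end MinTensor

/-! ### Universal property of algebras of continuous functions -/

theorem norm_le_of_forall_character {S : Type} [CStarAlgebra S] (hS : ∀ x y : S, x * y = y * x)
    (x : S) (M : ℝ) (hM : 0 ≤ M) (h : ∀ χ : S →⋆ₐ[ℂ] ℂ, ‖χ x‖ ≤ M) : ‖x‖ ≤ M := by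
  let _ : CommCStarAlgebra S := { (inferInstance : CStarAlgebra S) with mul_comm := hS }
  have h1 := (gelfandTransform_isometry S).norm_map_of_map_zero (map_zero _) x
  rw [← h1, ContinuousMap.norm_le _ hM]
  intro φ
  exact h { WeakDual.CharacterSpace.toAlgHom φ with map_star' := fun a => map_star φ a }

/-- The elements `f i` generate a commutative C*-algebra, whose norm is the supremum over
characters. A character takes real values on the `f i`, and these satisfy every polynomial relation
of `f`. By `hpt` they are the coordinates of a point, so the value of the character on a
`*`-polynomial is bounded by the sup norm over `X`. -/
theorem exists_hom_of_commute {X ι : Type} [TopologicalSpace X] [CompactSpace X]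
    {c : ι → C(X, ℂ)} (hc : (StarAlgebra.adjoin ℂ (Set.range c)).topologicalClosure = ⊤)
    {D : Type} [CStarAlgebra D] {f : ι → D} (hsa : ∀ i, IsSelfAdjoint (f i))
    (hf : ∀ i j, f i * f j = f j * f i)
    (hpt : ∀ t : ι → ℝ, (∀ r : FreeAlgebra ℂ ι, FreeAlgebra.lift ℂ f r = 0 →
      FreeAlgebra.lift ℂ (fun i => (t i : ℂ)) r = 0) → ∃ x : X, ∀ i, c i x = t i) :
    ∃ φ : C(X, ℂ) →⋆ₐ[ℂ] D, ∀ i, φ (c i) = f i := by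
  let S : StarSubalgebra ℂ D := (StarAlgebra.adjoin ℂ (Set.range f)).topologicalClosure
  have hclosed : IsClosed (S : Set D) := StarSubalgebra.isClosed_topologicalClosure _
  have hcomm : ∀ x y : S, x * y = y * x := by
    have h1 : ∀ x ∈ StarAlgebra.adjoin ℂ (Set.range f), ∀ y ∈ StarAlgebra.adjoin ℂ (Set.range f),
        x * y = y * x := by
      have hmul := StarAlgebra.isMulCommutative_adjoin ℂ (s := Set.range f)
        (by rintro _ ⟨i, rfl⟩ _ ⟨j, rfl⟩; exact hf i j)
        (by rintro _ ⟨i, rfl⟩ _ ⟨j, rfl⟩; rw [(hsa j).star_eq]; exact hf i j)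
      intro x hx y hy
      exact congrArg Subtype.val (hmul.is_comm.comm ⟨x, hx⟩ ⟨y, hy⟩)
    have h2 : ∀ x ∈ S, ∀ y ∈ StarAlgebra.adjoin ℂ (Set.range f), x * y = y * x := fun x hx y hy =>
      closure_minimal (t := {x | x * y = y * x}) (fun z hz => h1 z hz y hy)
        (isClosed_eq (by fun_prop) (by fun_prop)) hx
    have h3 : ∀ x ∈ S, ∀ y ∈ S, x * y = y * x := fun x hx y hy =>
      closure_minimal (t := {y | x * y = y * x}) (fun z hz => h2 x hx z hz)
        (isClosed_eq (by fun_prop) (by fun_prop)) hy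
    exact fun x y => Subtype.ext (h3 x x.2 y y.2)
  let f' : ι → S := fun i => ⟨f i, StarSubalgebra.le_topologicalClosure _
    (StarAlgebra.subset_adjoin ℂ _ (Set.mem_range_self i))⟩
  refine exists_starAlgHom_of_norm_le c f hc fun a => ?_
  have h1 : starEval f a = S.subtype (starEval f' a) := (map_starEval S.subtype f' a).symm
  have h2 : ‖starEval f a‖ = ‖starEval f' a‖ := by rw [h1]; rfl
  rw [h2]
  refine norm_le_of_forall_character hcomm _ _ (norm_nonneg _) fun χ => ?_
  have hreal : ∀ i, ((χ (f' i)).re : ℂ) = χ (f' i) := fun i => by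
    have : IsSelfAdjoint (f' i) := Subtype.ext (hsa i)
    exact Complex.conj_eq_iff_re.mp (this.map χ).star_eq
  obtain ⟨x, hx⟩ := hpt (fun i => (χ (f' i)).re) fun r hr => by
    simp only [hreal]
    rw [← map_lift]
    have : FreeAlgebra.lift ℂ f' r = 0 := by
      refine Subtype.ext ?_
      have := map_lift S.subtype f' r
      exact this.trans hr
    rw [this, map_zero]
  rw [map_starEval]
  let ev : C(X, ℂ) →⋆ₐ[ℂ] ℂ := ContinuousMap.evalStarAlgHom ℂ ℂ x
  have h3 : (fun i => χ (f' i)) = fun i => ev (c i) := funext fun i => by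
    rw [← hreal]; exact (hx i).symm
  rw [h3, ← map_starEval ev]
  exact ContinuousMap.norm_coe_le_norm _ x

theorem classicalSphere_hom {N : ℕ} {D : Type} [CStarAlgebra D] {f : Fin N → D}
    (hsa : ∀ i, IsSelfAdjoint (f i)) (hf : ∀ i j, f i * f j = f j * f i)
    (h1 : ∑ i, f i * f i = 1) :
    ∃ φ : (classicalSphere N).C →⋆ₐ[ℂ] D, ∀ i, φ ((classicalSphere N).coord i) = f i := by
  refine exists_hom_of_commute (classicalSphere N).generates hsa hf fun t ht => ?_
  have h2 : ∑ i, t i * t i = 1 := by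
    have := ht (spherePoly N) (by simp [spherePoly, h1])
    simp only [spherePoly, map_sub, map_sum, map_mul, FreeAlgebra.lift_ι_apply, map_one,
      sub_eq_zero] at this
    exact_mod_cast this
  refine ⟨⟨WithLp.toLp 2 t, ?_⟩, fun i => rfl⟩
  rw [mem_sphere_zero_iff_norm, EuclideanSpace.norm_eq]
  simp [sq, h2]

theorem classicalOrth_hom {N : ℕ} {D : Type} [CStarAlgebra D] {f : Fin N × Fin N → D}
    (hsa : ∀ i, IsSelfAdjoint (f i)) (hf : ∀ i j, f i * f j = f j * f i)
    (h1 : ∀ i j, ∑ k, f (i, k) * f (j, k) = if i = j then 1 else 0) :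
    ∃ φ : (classicalOrth N).C →⋆ₐ[ℂ] D, ∀ i, φ ((classicalOrth N).coord i) = f i := by
  refine exists_hom_of_commute (classicalOrth N).generates hsa hf fun t ht => ?_
  have h2 : ∀ i j, ∑ k, t (i, k) * t (j, k) = if i = j then 1 else 0 := fun i j => by
    have := ht (∑ k, letter (i, k) * letter (j, k) - if i = j then 1 else 0) (by
      have := h1 i j
      split_ifs at this ⊢ <;> simp [this])
    have h3 : ∑ k, (t (i, k) : ℂ) * t (j, k) = if i = j then 1 else 0 := by
      split_ifs at this ⊢ <;> simpa [sub_eq_zero] using this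
    split_ifs at h3 ⊢ <;> exact_mod_cast h3
  refine ⟨⟨Matrix.of fun i j => t (i, j), ?_⟩, fun i => rfl⟩
  rw [Matrix.mem_orthogonalGroup_iff]
  ext i j
  simp [Matrix.mul_apply, h2, Matrix.one_apply]

/-! ### Relations between coordinates -/

section Relations

variable {ι D : Type} {N : ℕ} [Ring D]

/-- The entries of the tuple commute. -/
def CommRel (f : ι → D) : Prop := ∀ i j, f i * f j = f j * f i

/-- The entries of the tuple half-commute. -/
def HalfRel (f : ι → D) : Prop := ∀ i j k, f i * f j * f k = f k * f j * f i

/-- The squares of the entries commute with the entries. -/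
def SqCentral (f : ι → D) : Prop := ∀ i j, f i * f i * f j = f j * f i * f i

/-- The squares of the entries sum up to `1`. -/
def SumSq [Fintype ι] (f : ι → D) : Prop := ∑ i, f i * f i = 1

/-- The squares of the entries are `1 / N`. -/
def CubeSq [Algebra ℂ D] (f : Fin N → D) : Prop := ∀ i, f i * f i = algebraMap ℂ D (1 / N)

/-- The matrix formed by the entries is orthogonal. -/
def Orth (f : Fin N × Fin N → D) : Prop :=
  (∀ i j, ∑ k, f (i, k) * f (j, k) = if i = j then 1 else 0) ∧
    ∀ i j, ∑ k, f (k, i) * f (k, j) = if i = j then 1 else 0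

/-- Distinct entries on the same line anticommute, and the other pairs of entries commute. -/
def TwistedRel (f : Fin N × Fin N → D) : Prop :=
  (∀ a b, a ≠ b → SameLine a b → f a * f b = -(f b * f a)) ∧
    ∀ a b, ¬ SameLine a b → f a * f b = f b * f a

/-- The product of distinct entries on the same line vanishes. -/
def CubicRel (f : Fin N × Fin N → D) : Prop := ∀ a b, a ≠ b → SameLine a b → f a * f b = 0

/-- The products `abc` with `a`, `c` distinct on the same line vanish. -/
def InftyRel (f : Fin N × Fin N → D) : Prop :=
  ∀ a b c, a ≠ c → SameLine a c → f a * f b * f c = 0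

end Relations

/-- `C(X)` is the universal C*-algebra generated by self-adjoint elements satisfying `Q`. -/
structure IsUniversal {ι : Type} (X : NCSpace ι)
    (Q : ∀ (D : Type) [Ring D] [Algebra ℂ D], (ι → D) → Prop) : Prop where
  coord : Q X.C X.coord
  hom : ∀ {D : Type} [CStarAlgebra D] {f : ι → D}, (∀ i, IsSelfAdjoint (f i)) → Q D f →
    ∃ φ : X.C →⋆ₐ[ℂ] D, ∀ i, φ (X.coord i) = f i

theorem IsUniversal.le {ι : Type} {X Y : NCSpace ι}
    {Q : ∀ (D : Type) [Ring D] [Algebra ℂ D], (ι → D) → Prop} (hY : IsUniversal Y Q)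
    (h : Q X.C X.coord) : X ≤ Y := hY.hom X.selfAdjoint h

theorem lift_spherePoly {N : ℕ} {D : Type} [CStarAlgebra D] (f : Fin N → D) :
    FreeAlgebra.lift ℂ f (spherePoly N) = 0 ↔ SumSq f := by
  simp [spherePoly, SumSq, sub_eq_zero]

theorem isUniversal_sphereSub {N : ℕ} {R : Set (FreeAlgebra ℂ (Fin N))}
    {Q : ∀ (D : Type) [Ring D] [Algebra ℂ D], (Fin N → D) → Prop}
    (h : ∀ (D : Type) [CStarAlgebra D] (f : Fin N → D),
      Q D f ↔ ∀ r ∈ R, FreeAlgebra.lift ℂ f r = 0) :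
    IsUniversal (sphereSub N R) fun D _ _ f => SumSq f ∧ Q D f where
  coord := by
    refine ⟨?_, (h _ _).mpr fun r hr => polySpace_rel (Or.inr hr)⟩
    exact (lift_spherePoly _).mp (polySpace_rel (Or.inl rfl))
  hom := by
    intro D _ f hsa hf
    refine polySpace_hom hsa ?_
    rintro r (rfl | hr)
    · exact (lift_spherePoly f).mpr hf.1
    · exact (h D f).mp hf.2 r hr

theorem isUniversal_orthSub {N : ℕ} {R : Set (FreeAlgebra ℂ (Fin N × Fin N))}
    {Q : ∀ (D : Type) [Ring D] [Algebra ℂ D], (Fin N × Fin N → D) → Prop}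
    (h : ∀ (D : Type) [CStarAlgebra D] (f : Fin N × Fin N → D),
      Q D f ↔ ∀ r ∈ R, FreeAlgebra.lift ℂ f r = 0) :
    IsUniversal (orthSub N R) fun D _ _ f => Orth f ∧ Q D f := by
  have key : ∀ (D : Type) [CStarAlgebra D] (f : Fin N × Fin N → D),
      Orth f ↔ ∀ r ∈ orthRel N, FreeAlgebra.lift ℂ f r = 0 := by
    intro D _ f
    have h1 : ∀ (g : Fin N → FreeAlgebra ℂ (Fin N × Fin N)) (i j : Fin N),
        FreeAlgebra.lift ℂ f (∑ k, g k - if i = j then 1 else 0) = 0 ↔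
          ∑ k, FreeAlgebra.lift ℂ f (g k) = if i = j then 1 else 0 := by
      intro g i j
      rw [map_sub, map_sum, sub_eq_zero, apply_ite (FreeAlgebra.lift ℂ f), map_one, map_zero]
    constructor
    · rintro ⟨hr, hc⟩ r (⟨i, j, rfl⟩ | ⟨i, j, rfl⟩)
      · rw [h1]; simpa using hr i j
      · rw [h1]; simpa using hc i j
    · intro hf
      refine ⟨fun i j => ?_, fun i j => ?_⟩
      · have := hf _ (Or.inl ⟨i, j, rfl⟩)
        rw [h1] at this; simpa using this
      · have := hf _ (Or.inr ⟨i, j, rfl⟩)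
        rw [h1] at this; simpa using this
  refine ⟨⟨(key _ _).mpr fun r hr => polySpace_rel (Or.inl hr),
    (h _ _).mpr fun r hr => polySpace_rel (Or.inr hr)⟩, ?_⟩
  intro D _ f hsa hf
  refine polySpace_hom hsa ?_
  rintro r (hr | hr)
  · exact (key D f).mp hf.1 r hr
  · exact (h D f).mp hf.2 r hr

section Universal

variable (N : ℕ)

theorem isUniversal_classicalSphere :
    IsUniversal (classicalSphere N) fun _ _ _ f => SumSq f ∧ CommRel f where
  coord := by
    refine ⟨?_, fun i j => ?_⟩
    · change ∑ i, (classicalSphere N).coord i * (classicalSphere N).coord i = 1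
      refine ContinuousMap.ext fun x => ?_
      have hx := x.2
      rw [mem_sphere_zero_iff_norm, EuclideanSpace.norm_eq, Real.sqrt_eq_one] at hx
      have h2 : (∑ i, (classicalSphere N).coord i * (classicalSphere N).coord i :
          C(Metric.sphere (0 : EuclideanSpace ℝ (Fin N)) 1, ℂ)) x =
          ∑ i, ((x.1 i : ℝ) : ℂ) * ((x.1 i : ℝ) : ℂ) := by
        exact ContinuousMap.sum_apply _ _ x
      refine h2.trans ?_
      simp only [Real.norm_eq_abs, sq_abs] at hx
      simp only [← sq]
      exact (by exact_mod_cast hx : ∑ i, ((x.1 i : ℝ) : ℂ) ^ 2 = 1)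
    · refine ContinuousMap.ext fun x => ?_
      exact mul_comm _ _
  hom := fun hsa hf => classicalSphere_hom hsa hf.2 hf.1

theorem isUniversal_halfSphere :
    IsUniversal (halfSphere N) fun _ _ _ f => SumSq f ∧ HalfRel f :=
  isUniversal_sphereSub (Q := fun _ _ _ f => HalfRel f) fun D _ f => by
    constructor
    · rintro h r ⟨i, j, k, rfl⟩
      simpa [sub_eq_zero] using h i j k
    · intro h i j k
      simpa [sub_eq_zero] using h _ ⟨i, j, k, rfl⟩

theorem isUniversal_sphereInfty :
    IsUniversal (sphereInfty N) fun _ _ _ f => SumSq f ∧ SqCentral f :=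
  isUniversal_sphereSub (Q := fun _ _ _ f => SqCentral f) fun D _ f => by
    constructor
    · rintro h r ⟨i, j, rfl⟩
      simpa [sub_eq_zero] using h i j
    · intro h i j
      simpa [sub_eq_zero] using h _ ⟨i, j, rfl⟩

theorem isUniversal_classicalOrth :
    IsUniversal (classicalOrth N) fun _ _ _ f => Orth f ∧ CommRel f where
  coord := by
    refine ⟨⟨fun i j => ?_, fun i j => ?_⟩, fun i j => ?_⟩
    · refine ContinuousMap.ext fun U => ?_
      have hU := congrFun (congrFun (Matrix.mem_orthogonalGroup_iff _ _ |>.mp U.2) i) j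
      refine (ContinuousMap.sum_apply _ _ U).trans ?_
      simp only [Matrix.mul_apply, Matrix.one_apply] at hU
      have h3 : ∑ k, ((U.1 i k : ℝ) : ℂ) * ((U.1 j k : ℝ) : ℂ) =
          ((if i = j then (1 : ℝ) else 0 : ℝ) : ℂ) := by
        rw [← hU]; push_cast; rfl
      refine Eq.trans h3 ?_
      split_ifs <;> simp <;> rfl
    · refine ContinuousMap.ext fun U => ?_
      have hU := congrFun (congrFun (Matrix.mem_orthogonalGroup_iff' _ _ |>.mp U.2) i) j
      refine (ContinuousMap.sum_apply _ _ U).trans ?_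
      simp only [Matrix.mul_apply, Matrix.one_apply] at hU
      have h3 : ∑ k, ((U.1 k i : ℝ) : ℂ) * ((U.1 k j : ℝ) : ℂ) =
          ((if i = j then (1 : ℝ) else 0 : ℝ) : ℂ) := by
        rw [← hU]; push_cast; rfl
      refine Eq.trans h3 ?_
      split_ifs <;> simp <;> rfl
    · exact ContinuousMap.ext fun x => mul_comm _ _
  hom := fun hsa hf => classicalOrth_hom hsa hf.2 hf.1.1

theorem isUniversal_freeOrth : IsUniversal (freeOrth N) fun _ _ _ f => Orth f ∧ True :=
  isUniversal_orthSub (Q := fun _ _ _ _ => True) fun D _ f => by simp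

theorem lift_halfRel {D : Type} [CStarAlgebra D] (f : Fin N × Fin N → D) :
    HalfRel f ↔ ∀ r ∈ halfRel N, FreeAlgebra.lift ℂ f r = 0 := by
  constructor
  · rintro h r ⟨i, j, k, rfl⟩
    simpa [sub_eq_zero] using h i j k
  · intro h i j k
    simpa [sub_eq_zero] using h _ ⟨i, j, k, rfl⟩

theorem lift_cubicRel {D : Type} [CStarAlgebra D] (f : Fin N × Fin N → D) :
    CubicRel f ↔ ∀ r ∈ cubicRel N, FreeAlgebra.lift ℂ f r = 0 := by
  constructor
  · rintro h r ⟨a, b, hab, hl, rfl⟩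
    simpa using h a b hab hl
  · intro h a b hab hl
    simpa using h _ ⟨a, b, hab, hl, rfl⟩

theorem isUniversal_halfOrth : IsUniversal (halfOrth N) fun _ _ _ f => Orth f ∧ HalfRel f :=
  isUniversal_orthSub (Q := fun _ _ _ f => HalfRel f) fun _ _ f => lift_halfRel N f

theorem isUniversal_freeHyper : IsUniversal (freeHyper N) fun _ _ _ f => Orth f ∧ CubicRel f :=
  isUniversal_orthSub (Q := fun _ _ _ f => CubicRel f) fun _ _ f => lift_cubicRel N f

theorem isUniversal_halfHyper :
    IsUniversal (halfHyper N) fun _ _ _ f => Orth f ∧ CubicRel f ∧ HalfRel f :=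
  isUniversal_orthSub (Q := fun _ _ _ f => CubicRel f ∧ HalfRel f) fun _ _ f => by
    rw [lift_cubicRel, lift_halfRel]
    exact ⟨fun h r hr => hr.elim (h.1 r) (h.2 r),
      fun h => ⟨fun r hr => h r (Or.inl hr), fun r hr => h r (Or.inr hr)⟩⟩

theorem isUniversal_twistedOrth :
    IsUniversal (twistedOrth N) fun _ _ _ f => Orth f ∧ TwistedRel f :=
  isUniversal_orthSub (Q := fun _ _ _ f => TwistedRel f) fun _ _ f => by
    constructor
    · rintro h r (⟨a, b, hab, hl, rfl⟩ | ⟨a, b, hl, rfl⟩)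
      · simpa [add_eq_zero_iff_eq_neg] using h.1 a b hab hl
      · simpa [sub_eq_zero] using h.2 a b hl
    · refine fun h => ⟨fun a b hab hl => ?_, fun a b hl => ?_⟩
      · simpa [add_eq_zero_iff_eq_neg] using h _ (Or.inl ⟨a, b, hab, hl, rfl⟩)
      · simpa [sub_eq_zero] using h _ (Or.inr ⟨a, b, hl, rfl⟩)

theorem isUniversal_hyperInfty :
    IsUniversal (hyperInfty N) fun _ _ _ f => Orth f ∧ InftyRel f :=
  isUniversal_orthSub (Q := fun _ _ _ f => InftyRel f) fun _ _ f => by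
    constructor
    · rintro h r ⟨a, b, c, hac, hl, rfl⟩
      simpa using h a b c hac hl
    · intro h a b c hac hl
      simpa using h _ ⟨a, b, c, hac, hl, rfl⟩

/-! ### Universal property of the cubes -/

variable {N}

theorem cube_hom (G : ReflectionGroup N) {D : Type} [CStarAlgebra D] (ψ : G.Γ →* unitary D) :
    ∃ φ : (cube G).C →⋆ₐ[ℂ] D, ∀ i, φ ((cube G).coord i) =
      ((1 / √(N : ℝ) : ℝ) : ℂ) • (ψ (G.g i) : D) := by
  obtain ⟨φ, hφ⟩ := Presentation.exists_hom (P := groupPresentation G.Γ)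
    (f := fun γ => (ψ γ : D)) ⟨by simp, fun g h => by simp, fun g => by
      change star (ψ g : D) = (ψ g⁻¹ : D)
      rw [map_inv, ← Unitary.star_eq_inv, Unitary.coe_star]⟩
  refine ⟨φ, fun i => ?_⟩
  refine (map_smul φ ((1 / √(N : ℝ) : ℝ) : ℂ) (groupElt (G.g i))).trans ?_
  rw [hφ]

theorem sqrt_natCast_mul (N : ℕ) :
    ((1 / √(N : ℝ) : ℝ) : ℂ) * ((1 / √(N : ℝ) : ℝ) : ℂ) = 1 / N := by
  have h : (1 / √(N : ℝ)) * (1 / √(N : ℝ)) = 1 / (N : ℝ) := by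
    rw [div_mul_div_comm, one_mul, Real.mul_self_sqrt (Nat.cast_nonneg N)]
  rw [← Complex.ofReal_mul, h]
  simp

theorem smul_groupElt_mul {Γ : Type} [Group Γ] (c : ℂ) (g h : Γ) :
    (c • groupElt g) * (c • groupElt h) = (c * c) • groupElt (g * h) := by
  rw [smul_mul_smul_comm, ← groupElt_mul]

theorem smul_groupElt_mul_mul {Γ : Type} [Group Γ] (c : ℂ) (g h k : Γ) :
    (c • groupElt g) * (c • groupElt h) * (c • groupElt k) =
      (c * c * c) • groupElt (g * h * k) := by
  rw [smul_groupElt_mul, smul_mul_smul_comm, ← groupElt_mul]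

theorem groupElt_mul_self (G : ReflectionGroup N) (i : Fin N) :
    groupElt (G.g i) * groupElt (G.g i) = 1 := by
  rw [← groupElt_mul, G.sq, groupElt_one]

theorem cube_cubeSq (G : ReflectionGroup N) : CubeSq (cube G).coord := fun i => by
  change (((1 / √(N : ℝ) : ℝ) : ℂ) • groupElt (G.g i)) *
    (((1 / √(N : ℝ) : ℝ) : ℂ) • groupElt (G.g i)) = algebraMap ℂ _ _
  rw [smul_mul_smul_comm, groupElt_mul_self, sqrt_natCast_mul, Algebra.algebraMap_eq_smul_one]

/-- The reflections associated to the coordinates of a subspace of a cube. -/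
theorem exists_reflections {D : Type} [CStarAlgebra D] {f : Fin N → D}
    (hsa : ∀ i, IsSelfAdjoint (f i)) (hf : CubeSq f) :
    ∃ s : Fin N → unitary D, (∀ i, s i * s i = 1) ∧
      (∀ i, ((1 / √(N : ℝ) : ℝ) : ℂ) • (s i : D) = f i) ∧
      ∀ i, (s i : D) = ((√(N : ℝ) : ℝ) : ℂ) • f i := by
  have hne : ∀ i : Fin N, ((√(N : ℝ) : ℝ) : ℂ) ≠ 0 := fun i => by
    have : (0 : ℝ) < N := by exact_mod_cast i.pos
    exact_mod_cast (by positivity : √(N : ℝ) ≠ 0)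
  have hmul : ∀ i, (((√(N : ℝ) : ℝ) : ℂ) • f i) * (((√(N : ℝ) : ℝ) : ℂ) • f i) = 1 := fun i => by
    have hN : ((N : ℕ) : ℂ) ≠ 0 := by exact_mod_cast i.pos.ne'
    rw [smul_mul_smul_comm, hf i, ← Complex.ofReal_mul, Real.mul_self_sqrt (Nat.cast_nonneg N),
      Algebra.algebraMap_eq_smul_one, smul_smul]
    simp [hN]
  have hstar : ∀ i, star (((√(N : ℝ) : ℝ) : ℂ) • f i) = ((√(N : ℝ) : ℝ) : ℂ) • f i := fun i => by
    rw [star_smul, (hsa i).star_eq]; simp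
  refine ⟨fun i => ⟨((√(N : ℝ) : ℝ) : ℂ) • f i, ?_⟩, fun i => Subtype.ext (hmul i), fun i => ?_,
    fun i => rfl⟩
  · rw [Unitary.mem_iff, hstar, hmul]
    exact ⟨rfl, rfl⟩
  · change _ • (_ • f i) = f i
    rw [smul_smul]
    have := hne i
    push_cast
    rw [one_div, inv_mul_cancel₀ this, one_smul]

theorem halfGroup_rel (i j k : Fin N) :
    (halfGroup N).g i * (halfGroup N).g j * (halfGroup N).g k =
      (halfGroup N).g k * (halfGroup N).g j * (halfGroup N).g i := by
  rw [← mul_inv_eq_one]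
  exact (QuotientGroup.eq_one_iff _).mpr
    (Subgroup.subset_normalClosure (Or.inr ⟨i, j, k, rfl⟩))

theorem halfGroup_lift {H : Type} [Group H] (s : Fin N → H) (h1 : ∀ i, s i * s i = 1)
    (h2 : ∀ i j k, s i * s j * s k = s k * s j * s i) :
    ∃ ψ : (halfGroup N).Γ →* H, ∀ i, ψ ((halfGroup N).g i) = s i := by
  have hrel : ∀ r ∈ {r | ∃ i : Fin N, r = FreeGroup.of i * FreeGroup.of i} ∪
      {r | ∃ i j k, r = FreeGroup.of i * FreeGroup.of j * FreeGroup.of k *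
        (FreeGroup.of k * FreeGroup.of j * FreeGroup.of i)⁻¹},
      FreeGroup.lift s r = 1 := by
    rintro r (⟨i, rfl⟩ | ⟨i, j, k, rfl⟩)
    · simp [h1]
    · rw [map_mul, map_inv, mul_inv_eq_one]
      simp [h2 i j k]
  exact ⟨PresentedGroup.toGroup hrel, fun i => PresentedGroup.toGroup.of hrel⟩

theorem freeGroup_lift {H : Type} [Group H] (s : Fin N → H) (h1 : ∀ i, s i * s i = 1) :
    ∃ ψ : (freeGroup N).Γ →* H, ∀ i, ψ ((freeGroup N).g i) = s i := by
  have hrel : ∀ r ∈ {r | ∃ i : Fin N, r = FreeGroup.of i * FreeGroup.of i} ∪ ∅,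
      FreeGroup.lift s r = 1 := by
    rintro r (⟨i, rfl⟩ | h)
    · simp [h1]
    · exact h.elim
  exact ⟨PresentedGroup.toGroup hrel, fun i => PresentedGroup.toGroup.of hrel⟩

/-- The product group is the coproduct of its factors among families of morphisms with commuting
ranges. -/
theorem cubeGroup_lift {H : Type} [Group H] (s : Fin N → H) (h1 : ∀ i, s i * s i = 1)
    (h2 : ∀ i j, s i * s j = s j * s i) :
    ∃ ψ : (cubeGroup N).Γ →* H, ∀ i, ψ ((cubeGroup N).g i) = s i := by
  let χ : Fin N → Multiplicative (ZMod 2) →* H := fun i =>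
    { toFun := fun z => if z = 1 then 1 else s i
      map_one' := by simp
      map_mul' := by
        have h : ∀ z : Multiplicative (ZMod 2), z = 1 ∨ z = Multiplicative.ofAdd 1 := by decide
        have h3 : (Multiplicative.ofAdd (1 : ZMod 2)) ≠ 1 := by decide
        have h4 : (Multiplicative.ofAdd (1 : ZMod 2)) * Multiplicative.ofAdd 1 = 1 := by decide
        intro x y
        rcases h x with rfl | rfl <;> rcases h y with rfl | rfl <;> simp [h3, h4, h1] }
  have hcomm : Pairwise fun i j => ∀ x y, Commute (χ i x) (χ j y) := by
    intro i j _ x y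
    change (if x = 1 then 1 else s i) * (if y = 1 then 1 else s j) =
      (if y = 1 then 1 else s j) * (if x = 1 then 1 else s i)
    split_ifs <;> simp [h2 i j]
  refine ⟨MonoidHom.noncommPiCoprod χ hcomm, fun i => ?_⟩
  refine (MonoidHom.noncommPiCoprod_mulSingle (ϕ := χ) (hcomm := hcomm) i _).trans ?_
  have h3 : (Multiplicative.ofAdd (1 : ZMod 2)) ≠ 1 := by decide
  change (if Multiplicative.ofAdd (1 : ZMod 2) = 1 then (1 : H) else s i) = s i
  exact if_neg h3

theorem isUniversal_cube_freeGroup :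
    IsUniversal (cube (freeGroup N)) fun _ _ _ f => CubeSq f where
  coord := cube_cubeSq _
  hom := by
    intro D _ f hsa hf
    obtain ⟨s, hs, hsf, -⟩ := exists_reflections hsa hf
    obtain ⟨ψ, hψ⟩ := freeGroup_lift s hs
    obtain ⟨φ, hφ⟩ := cube_hom (freeGroup N) ψ
    exact ⟨φ, fun i => by rw [hφ, hψ, hsf]⟩

theorem isUniversal_cube_halfGroup :
    IsUniversal (cube (halfGroup N)) fun _ _ _ f => CubeSq f ∧ HalfRel f where
  coord := by
    refine ⟨cube_cubeSq _, fun i j k => ?_⟩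
    refine (smul_groupElt_mul_mul _ _ _ _).trans (Eq.trans ?_ (smul_groupElt_mul_mul _ _ _ _).symm)
    rw [halfGroup_rel]
  hom := by
    intro D _ f hsa hf
    obtain ⟨s, hs, hsf, hfs⟩ := exists_reflections hsa hf.1
    obtain ⟨ψ, hψ⟩ := halfGroup_lift s hs fun i j k => Subtype.ext (by
      simp only [Submonoid.coe_mul, hfs, smul_mul_smul_comm]
      rw [hf.2])
    obtain ⟨φ, hφ⟩ := cube_hom (halfGroup N) ψ
    exact ⟨φ, fun i => by rw [hφ, hψ, hsf]⟩

theorem cubeGroup_rel (i j : Fin N) :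
    (cubeGroup N).g i * (cubeGroup N).g j = (cubeGroup N).g j * (cubeGroup N).g i :=
  mul_comm (G := Fin N → Multiplicative (ZMod 2)) _ _

theorem isUniversal_cube_cubeGroup :
    IsUniversal (cube (cubeGroup N)) fun _ _ _ f => CubeSq f ∧ CommRel f where
  coord := by
    refine ⟨cube_cubeSq _, fun i j => ?_⟩
    refine (smul_groupElt_mul _ _ _).trans (Eq.trans ?_ (smul_groupElt_mul _ _ _).symm)
    rw [cubeGroup_rel]
  hom := by
    intro D _ f hsa hf
    obtain ⟨s, hs, hsf, hfs⟩ := exists_reflections hsa hf.1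
    obtain ⟨ψ, hψ⟩ := cubeGroup_lift s hs fun i j => Subtype.ext (by
      simp only [Submonoid.coe_mul, hfs, smul_mul_smul_comm]
      rw [hf.2])
    obtain ⟨φ, hφ⟩ := cube_hom (cubeGroup N) ψ
    exact ⟨φ, fun i => by rw [hφ, hψ, hsf]⟩

end Universal

/-! ### Stability of the relations -/

section Map

variable {ι D E : Type} {N : ℕ} [Ring D] [Algebra ℂ D] [Ring E]
  [Algebra ℂ E] (φ : D →ₐ[ℂ] E)

theorem CommRel.map {f : ι → D} (h : CommRel f) : CommRel fun i => φ (f i) := fun i j => by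
  rw [← map_mul, h, map_mul]

theorem HalfRel.map {f : ι → D} (h : HalfRel f) : HalfRel fun i => φ (f i) := fun i j k => by
  simp only [← map_mul]
  rw [h]

theorem SqCentral.map {f : ι → D} (h : SqCentral f) : SqCentral fun i => φ (f i) := fun i j => by
  simp only [← map_mul]
  rw [h]

theorem SumSq.map [Fintype ι] {f : ι → D} (h : SumSq f) : SumSq fun i => φ (f i) := by
  have := congrArg φ h
  simpa [SumSq] using this

theorem Orth.map {f : Fin N × Fin N → D} (h : Orth f) : Orth fun i => φ (f i) := by
  refine ⟨fun i j => ?_, fun i j => ?_⟩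
  · have := congrArg φ (h.1 i j)
    rw [map_sum, apply_ite φ, map_one, map_zero] at this
    simpa using this
  · have := congrArg φ (h.2 i j)
    rw [map_sum, apply_ite φ, map_one, map_zero] at this
    simpa using this

theorem TwistedRel.map {f : Fin N × Fin N → D} (h : TwistedRel f) :
    TwistedRel fun i => φ (f i) := by
  refine ⟨fun a b hab hl => ?_, fun a b hl => ?_⟩
  · rw [← map_mul, h.1 a b hab hl, map_neg, map_mul]
  · rw [← map_mul, h.2 a b hl, map_mul]

theorem CubicRel.map {f : Fin N × Fin N → D} (h : CubicRel f) : CubicRel fun i => φ (f i) :=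
  fun a b hab hl => by rw [← map_mul, h a b hab hl, map_zero]

theorem InftyRel.map {f : Fin N × Fin N → D} (h : InftyRel f) : InftyRel fun i => φ (f i) :=
  fun a b c hac hl => by rw [← map_mul, ← map_mul, h a b c hac hl, map_zero]

theorem CubeSq.map {f : Fin N → D} (h : CubeSq f) : CubeSq fun i => φ (f i) := fun i => by
  rw [← map_mul, h, AlgHom.commutes]

end Map

/-- The tuple obtained by letting a matrix act on a tuple. -/
def act {T : Type} [Ring T] {N : ℕ} (u : Fin N × Fin N → T) (x : Fin N → T) (i : Fin N) : T :=
  ∑ k, u (i, k) * x k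

/-! ### Relations preserved when a matrix acts on a tuple. -/

section Act

variable {T : Type} [Ring T] {N : ℕ} {u : Fin N × Fin N → T}

theorem act_mul_act {x y : Fin N → T} (hx : ∀ a k, u a * x k = x k * u a) (i j : Fin N) :
    act u x i * act u y j = ∑ k, ∑ l, u (i, k) * u (j, l) * (x k * y l) := by
  simp only [act, Finset.sum_mul, Finset.mul_sum]
  refine Finset.sum_comm.trans (Finset.sum_congr rfl fun k _ => Finset.sum_congr rfl fun l _ => ?_)
  rw [mul_assoc, ← mul_assoc (x k), ← hx (j, l) k]
  simp only [mul_assoc]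

theorem act_mul_act_mul_act {x y z : Fin N → T} (hx : ∀ a k, u a * x k = x k * u a)
    (hy : ∀ a k, u a * y k = y k * u a) (i j m : Fin N) :
    act u x i * act u y j * act u z m =
      ∑ k, ∑ l, ∑ n, u (i, k) * u (j, l) * u (m, n) * (x k * y l * z n) := by
  rw [act_mul_act hx]
  simp only [act, Finset.sum_mul, Finset.mul_sum]
  rw [Finset.sum_comm]
  refine Finset.sum_congr rfl fun k _ => ?_
  rw [Finset.sum_comm]
  refine Finset.sum_congr rfl fun l _ => Finset.sum_congr rfl fun n _ => ?_
  have h : x k * y l * u (m, n) = u (m, n) * (x k * y l) := by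
    rw [mul_assoc, ← hy, ← mul_assoc, ← hx, mul_assoc]
  rw [mul_assoc, ← mul_assoc (x k * y l), h]
  simp only [mul_assoc]

variable {x : Fin N → T}

theorem sumSq_act (hx : ∀ a k, u a * x k = x k * u a)
    (hu : Orth u) (h : SumSq x) : SumSq (act u x) := by
  unfold SumSq
  simp only [act_mul_act hx]
  rw [Finset.sum_comm]
  have h1 : ∀ k, ∑ i, ∑ l, u (i, k) * u (i, l) * (x k * x l) = x k * x k := fun k => by
    rw [Finset.sum_comm]
    simp only [← Finset.sum_mul, hu.2]
    simp
  simp only [h1]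
  exact h

theorem commRel_act (hx : ∀ a k, u a * x k = x k * u a)
    (hu : CommRel u) (h : CommRel x) : CommRel (act u x) := fun i j => by
  rw [act_mul_act hx, act_mul_act hx, Finset.sum_comm]
  refine Finset.sum_congr rfl fun k _ => Finset.sum_congr rfl fun l _ => ?_
  rw [hu, h]

theorem halfRel_act (hx : ∀ a k, u a * x k = x k * u a)
    (hu : HalfRel u) (h : HalfRel x) : HalfRel (act u x) := fun i j m => by
  rw [act_mul_act_mul_act hx hx, act_mul_act_mul_act hx hx]
  conv_lhs => enter [2, k]; rw [Finset.sum_comm]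
  rw [Finset.sum_comm]
  conv_lhs => enter [2, k]; rw [Finset.sum_comm]
  refine Finset.sum_congr rfl fun k _ => Finset.sum_congr rfl fun l _ =>
    Finset.sum_congr rfl fun n _ => ?_
  rw [hu, h]

/-- The cross terms vanish, and the diagonal ones add up to $\frac1N\sum_k u_{ik}^2=\frac1N$. -/
theorem cubeSq_act_of_cubic [Algebra ℂ T] (hx : ∀ a k, u a * x k = x k * u a)
    (hu : Orth u) (hu' : CubicRel u) (h : CubeSq x) :
    CubeSq (act u x) := fun i => by
  rw [act_mul_act hx]
  have h1 : ∀ k, ∑ l, u (i, k) * u (i, l) * (x k * x l) =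
      u (i, k) * u (i, k) * algebraMap ℂ T (1 / N) := fun k => by
    rw [Finset.sum_eq_single k, h]
    · intro l _ hl
      rw [hu' (i, k) (i, l) (by simpa using hl.symm) (Or.inl rfl), zero_mul]
    · simp
  simp only [h1, ← Finset.sum_mul, hu.1]
  simp

theorem add_self_eq_zero_of_algebra [Algebra ℂ T] {a : T} (h : a + a = 0) : a = 0 := by
  have h2 : (2 : ℂ) • a = 0 := by rw [two_smul, h]
  exact (smul_eq_zero_iff_right (by norm_num : (2 : ℂ) ≠ 0)).mp h2

/-- For $k\ne l$ the factor $u_{ik}u_{il}$ is antisymmetric in $k,l$ while $x_kx_l$ is symmetric.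
The off-diagonal sum is therefore its own opposite, hence zero, which is proved by adding it to
itself with $k$ and $l$ exchanged. -/
theorem cubeSq_act_of_twisted [Algebra ℂ T] (hx : ∀ a k, u a * x k = x k * u a)
    (hu : Orth u) (hu' : TwistedRel u) (h : CubeSq x)
    (hc : CommRel x) : CubeSq (act u x) := fun i => by
  rw [act_mul_act hx]
  have h1 : ∑ k, ∑ l, u (i, k) * u (i, l) * (x k * x l) =
      ∑ k, ∑ l, if k = l then u (i, k) * u (i, k) * algebraMap ℂ T (1 / N) else 0 := by
    rw [← sub_eq_zero]
    refine add_self_eq_zero_of_algebra ?_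
    rw [← Finset.sum_sub_distrib]
    simp only [← Finset.sum_sub_distrib]
    conv_lhs => arg 2; rw [Finset.sum_comm]
    simp only [← Finset.sum_add_distrib]
    refine Finset.sum_eq_zero fun k _ => Finset.sum_eq_zero fun l _ => ?_
    by_cases hkl : k = l
    · subst hkl; simp [h k]
    · rw [if_neg hkl, if_neg (Ne.symm hkl), hc l k,
        hu'.1 (i, k) (i, l) (by simpa using hkl) (Or.inl rfl)]
      simp
  rw [h1]
  simp only [Finset.sum_ite_eq, Finset.mem_univ, if_true, ← Finset.sum_mul, hu.1]
  simp

/-- For $i\ne j$ the diagonal terms sum to $\frac1N\sum_k u_{ik}u_{jk}=0$. In the other terms $k\neq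
l$, so $u_{ik}$ and $u_{jl}$ lie on different rows and columns and commute. -/
theorem commRel_act_of_twisted [Algebra ℂ T] (hx : ∀ a k, u a * x k = x k * u a)
    (hu : Orth u) (hu' : TwistedRel u) (h : CubeSq x)
    (hc : CommRel x) : CommRel (act u x) := fun i j => by
  by_cases hij : i = j
  · rw [hij]
  have h1 : ∀ i j, i ≠ j → act u x i * act u x j =
      ∑ k, ∑ l, if k = l then 0 else u (i, k) * u (j, l) * (x k * x l) := by
    intro i j hij
    rw [act_mul_act hx, ← sub_eq_zero]
    simp only [← Finset.sum_sub_distrib]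
    have h2 : ∀ k l, (u (i, k) * u (j, l) * (x k * x l) -
        if k = l then 0 else u (i, k) * u (j, l) * (x k * x l)) =
        if k = l then u (i, k) * u (j, k) * algebraMap ℂ T (1 / N) else 0 := by
      intro k l
      by_cases hkl : k = l
      · subst hkl; simp [h k]
      · simp [hkl]
    simp only [h2, Finset.sum_ite_eq, Finset.mem_univ, if_true, ← Finset.sum_mul, hu.1]
    simp [hij]
  rw [h1 i j hij, h1 j i (Ne.symm hij), Finset.sum_comm]
  refine Finset.sum_congr rfl fun k _ => Finset.sum_congr rfl fun l _ => ?_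
  by_cases hkl : k = l
  · simp [hkl]
  · rw [if_neg hkl, if_neg (Ne.symm hkl), hc l k, hu'.2 (i, l) (j, k)]
    rintro (h3 | h3)
    · exact hij h3
    · exact hkl h3.symm

end Act

/-! ### The relations `abc = 0` -/

section Infty

variable {T : Type} [Ring T] {N : ℕ} {u : Fin N × Fin N → T}

/-- Multiply $u_au_b$ on the right by the sum of the squares of the row of $a$, which is $1$; only
the square of $u_a$ survives. The companion `InftyRel.mul_eq'` inserts the same sum on the left. -/
theorem InftyRel.mul_eq (hu : Orth u) (h : InftyRel u) (a b : Fin N × Fin N) :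
    u a * u b = u a * u b * u a * u a := by
  have h1 : u a * u b * ∑ k, u (a.1, k) * u (a.1, k) = u a * u b := by
    rw [hu.1]; simp
  refine h1.symm.trans ((Finset.mul_sum _ _ _).trans ((Finset.sum_eq_single a.2 ?_ ?_).trans ?_))
  rotate_left 2
  · simp only [Prod.mk.eta]
    rw [← mul_assoc]
  · intro k _ hk
    rw [← mul_assoc, h a b (a.1, k) (fun h2 => hk (by rw [h2])) (Or.inl rfl), zero_mul]
  · simp

theorem InftyRel.mul_eq' (hu : Orth u) (h : InftyRel u) (a b : Fin N × Fin N) :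
    u b * u a = u a * u a * u b * u a := by
  have h1 : (∑ k, u (a.1, k) * u (a.1, k)) * (u b * u a) = u b * u a := by
    rw [hu.1]; simp
  refine h1.symm.trans ((Finset.sum_mul _ _ _).trans ((Finset.sum_eq_single a.2 ?_ ?_).trans ?_))
  rotate_left 2
  · simp only [Prod.mk.eta, mul_assoc]
  · intro k _ hk
    have := h (a.1, k) b a (fun h2 => hk (by rw [← h2])) (Or.inl rfl)
    rw [mul_assoc, ← mul_assoc (u (a.1, k)) (u b), this, mul_zero]
  · simp

theorem InftyRel.cubicRel (hu : Orth u) (h : InftyRel u) : CubicRel u := fun a b hab hl => by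
  have h1 := h b a a (Ne.symm hab) (hl.elim (fun h => Or.inl h.symm) (fun h => Or.inr h.symm))
  rw [h.mul_eq hu, mul_assoc (u a), mul_assoc (u a), h1, mul_zero]

/-- Both sides equal $u_a^2u_bu_a^2$. -/
theorem InftyRel.sqCentral (hu : Orth u) (h : InftyRel u) : SqCentral u := fun a b => by
  have h1 : u a * u a * u b = u a * u a * u b * u a * u a := by
    rw [mul_assoc]
    refine (congrArg (u a * ·) (h.mul_eq hu a b)).trans ?_
    simp only [← mul_assoc]
  rw [h1]
  conv_rhs => rw [h.mul_eq' hu a b]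

/-- Since products of distinct entries on a row vanish, only terms in $u_{ik}^2u_{jn}x_k^2x_n$,
respectively $u_{jn}u_{ik}^2x_nx_k^2$, remain. They agree because the squares are central on both
sides. -/
theorem sqCentral_act {x : Fin N → T} (hx : ∀ a k, u a * x k = x k * u a) (hu : Orth u)
    (hu' : InftyRel u) (h : SqCentral x) : SqCentral (act u x) := fun i j => by
  have hc := hu'.cubicRel hu
  have h0 : ∀ i k l, k ≠ l → u (i, k) * u (i, l) = 0 := fun i k l hkl =>
    hc (i, k) (i, l) (by simpa using hkl) (Or.inl rfl)
  rw [act_mul_act_mul_act hx hx, act_mul_act_mul_act hx hx]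
  have h1 : ∀ k, ∑ l, ∑ n, u (i, k) * u (i, l) * u (j, n) * (x k * x l * x n) =
      ∑ n, u (i, k) * u (i, k) * u (j, n) * (x k * x k * x n) := fun k => by
    rw [Finset.sum_eq_single k]
    · intro l _ hl
      simp [h0 i k l (Ne.symm hl)]
    · simp
  have h2 : ∀ k l, ∑ n, u (j, k) * u (i, l) * u (i, n) * (x k * x l * x n) =
      u (j, k) * u (i, l) * u (i, l) * (x k * x l * x l) := fun k l => by
    rw [Finset.sum_eq_single l]
    · intro n _ hn
      rw [mul_assoc (u (j, k)), h0 i l n (Ne.symm hn)]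
      simp
    · simp
  simp only [h1, h2]
  rw [Finset.sum_comm]
  refine Finset.sum_congr rfl fun k _ => Finset.sum_congr rfl fun l _ => ?_
  rw [hu'.sqCentral hu, h]

end Infty

/-! ### Quantum groups given by relations -/

/-- The product of two matrices. -/
def conv {T : Type} [Ring T] {N : ℕ} (u v : Fin N × Fin N → T) (p : Fin N × Fin N) : T :=
  ∑ k, u (p.1, k) * v (k, p.2)

/-- Relations between the entries of a matrix that define quantum groups. -/
structure IsGroupRel (N : ℕ)
    (Q : ∀ (D : Type) [Ring D] [Algebra ℂ D], (Fin N × Fin N → D) → Prop) : Prop where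
  map : ∀ {D E : Type} [Ring D] [Algebra ℂ D] [Ring E] [Algebra ℂ E] (φ : D →ₐ[ℂ] E)
    {f : Fin N × Fin N → D}, Q D f → Q E fun p => φ (f p)
  conv : ∀ {T : Type} [Ring T] [Algebra ℂ T] {u v : Fin N × Fin N → T},
    (∀ a b, u a * v b = v b * u a) → Q T u → Q T v → Q T (conv u v)
  one : Q ℂ fun p => if p.1 = p.2 then 1 else 0
  op : ∀ {D : Type} [Ring D] [Algebra ℂ D] {f : Fin N × Fin N → D}, Q D f →
    Q Dᵐᵒᵖ fun p => MulOpposite.op (f (p.2, p.1))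

theorem IsGroupRel.and {N : ℕ}
    {P Q : ∀ (D : Type) [Ring D] [Algebra ℂ D], (Fin N × Fin N → D) → Prop}
    (hP : IsGroupRel N P) (hQ : IsGroupRel N Q) : IsGroupRel N fun D _ _ f => P D f ∧ Q D f where
  map φ _ h := ⟨hP.map φ h.1, hQ.map φ h.2⟩
  conv h hu hv := ⟨hP.conv h hu.1 hv.1, hQ.conv h hu.2 hv.2⟩
  one := ⟨hP.one, hQ.one⟩
  op h := ⟨hP.op h.1, hQ.op h.2⟩

theorem SameLine.swap {N : ℕ} {a b : Fin N × Fin N} (h : SameLine a b) :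
    SameLine (a.2, a.1) (b.2, b.1) := h.elim Or.inr Or.inl

theorem SameLine.symm {N : ℕ} {a b : Fin N × Fin N} (h : SameLine a b) : SameLine b a :=
  h.elim (fun h => Or.inl h.symm) (fun h => Or.inr h.symm)

theorem ne_swap {N : ℕ} {a b : Fin N × Fin N} (h : a ≠ b) : (a.2, a.1) ≠ (b.2, b.1) := fun h2 =>
  h (Prod.ext (Prod.mk.inj h2).2 (Prod.mk.inj h2).1)

theorem one_mul_one_of_sameLine {N : ℕ} {a b : Fin N × Fin N} (h : a ≠ b) (hl : SameLine a b) :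
    ((if a.1 = a.2 then 1 else 0 : ℂ)) * (if b.1 = b.2 then 1 else 0) = 0 := by
  by_cases h1 : a.1 = a.2
  · by_cases h2 : b.1 = b.2
    · refine absurd (Prod.ext ?_ ?_) h <;> rcases hl with h3 | h3
      · exact h3
      · rw [h1, h2, h3]
      · rw [← h1, ← h2, h3]
      · exact h3
    · simp [h2]
  · simp [h1]

section GroupRel

variable (N : ℕ)

theorem isGroupRel_orth : IsGroupRel N fun _ _ _ f => Orth f where
  map φ _ h := Orth.map φ h
  conv := by
    intro T _ _ u v h hu hv
    have key : ∀ i j k l, conv u v (i, j) * conv u v (k, l) =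
        ∑ a, ∑ b, u (i, a) * u (k, b) * (v (a, j) * v (b, l)) := fun i j k l =>
      act_mul_act (u := u) (x := fun a => v (a, j)) (y := fun b => v (b, l))
        (fun a b => h a (b, j)) i k
    refine ⟨fun i j => ?_, fun i j => ?_⟩
    · simp only [key]
      rw [Finset.sum_comm]
      have h1 : ∀ a, ∑ k, ∑ b, u (i, a) * u (j, b) * (v (a, k) * v (b, k)) =
          u (i, a) * u (j, a) := fun a => by
        rw [Finset.sum_comm]
        simp only [← Finset.mul_sum, hv.1]
        simp
      simp only [h1, hu.1]
    · simp only [key]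
      rw [Finset.sum_comm]
      have h1 : ∀ a, ∑ k, ∑ b, u (k, a) * u (k, b) * (v (a, i) * v (b, j)) =
          v (a, i) * v (a, j) := fun a => by
        rw [Finset.sum_comm]
        simp only [← Finset.sum_mul, hu.2]
        simp
      simp only [h1, hv.2]
  one := by
    refine ⟨fun i j => ?_, fun i j => ?_⟩
    · simp
    · simp [eq_comm]
  op := by
    intro D _ _ f h
    refine ⟨fun i j => ?_, fun i j => ?_⟩
    · have := congrArg MulOpposite.op (h.2 j i)
      simpa [Finset.op_sum, apply_ite MulOpposite.op, eq_comm] using this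
    · have := congrArg MulOpposite.op (h.1 j i)
      simpa [Finset.op_sum, apply_ite MulOpposite.op, eq_comm] using this

theorem isGroupRel_comm : IsGroupRel N fun _ _ _ f => CommRel f where
  map φ _ h := CommRel.map φ h
  conv := by
    intro T _ _ u v h hu hv p q
    refine (act_mul_act (x := fun a => v (a, p.2)) (y := fun b => v (b, q.2))
      (fun a b => h a (b, p.2)) p.1 q.1).trans (Eq.trans ?_ (act_mul_act
      (x := fun a => v (a, q.2)) (y := fun b => v (b, p.2)) (fun a b => h a (b, q.2)) q.1 p.1).symm)
    rw [Finset.sum_comm]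
    refine Finset.sum_congr rfl fun k _ => Finset.sum_congr rfl fun l _ => ?_
    rw [hu, hv]
  one p q := mul_comm _ _
  op h p q := by
    rw [← MulOpposite.op_mul, h, MulOpposite.op_mul]

theorem conv_mul_conv {T : Type} [Ring T] {u v : Fin N × Fin N → T}
    (h : ∀ a b, u a * v b = v b * u a) (p q : Fin N × Fin N) :
    conv u v p * conv u v q =
      ∑ k, ∑ l, u (p.1, k) * u (q.1, l) * (v (k, p.2) * v (l, q.2)) :=
  act_mul_act (x := fun a => v (a, p.2)) (y := fun b => v (b, q.2)) (fun a b => h a (b, p.2)) _ _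

theorem conv_mul_conv_mul_conv {T : Type} [Ring T] {u v : Fin N × Fin N → T}
    (h : ∀ a b, u a * v b = v b * u a) (p q r : Fin N × Fin N) :
    conv u v p * conv u v q * conv u v r =
      ∑ k, ∑ l, ∑ n, u (p.1, k) * u (q.1, l) * u (r.1, n) *
        (v (k, p.2) * v (l, q.2) * v (n, r.2)) :=
  act_mul_act_mul_act (x := fun a => v (a, p.2)) (y := fun b => v (b, q.2))
    (z := fun b => v (b, r.2)) (fun a b => h a (b, p.2)) (fun a b => h a (b, q.2)) _ _ _

theorem isGroupRel_half : IsGroupRel N fun _ _ _ f => HalfRel f where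
  map φ _ h := HalfRel.map φ h
  conv := by
    intro T _ _ u v h hu hv p q r
    rw [conv_mul_conv_mul_conv N h, conv_mul_conv_mul_conv N h]
    conv_lhs => enter [2, k]; rw [Finset.sum_comm]
    rw [Finset.sum_comm]
    conv_lhs => enter [2, k]; rw [Finset.sum_comm]
    refine Finset.sum_congr rfl fun k _ => Finset.sum_congr rfl fun l _ =>
      Finset.sum_congr rfl fun n _ => ?_
    rw [hu, hv]
  one p q r := by ring
  op h p q r := by
    simp only [← MulOpposite.op_mul]
    rw [← mul_assoc, ← mul_assoc, h]

/-- Each term of the expanded product contains $u_{p_1k}u_{q_1l}$ and $v_{kp_2}v_{lq_2}$. When $p\ne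
q$ share a line, one of these two pairs consists of distinct entries on a line. The same dichotomy
serves for `isGroupRel_infty`, applied to the outer factors. -/
theorem isGroupRel_cubic : IsGroupRel N fun _ _ _ f => CubicRel f where
  map φ _ h := CubicRel.map φ h
  conv := by
    intro T _ _ u v h hu hv p q hpq hl
    rw [conv_mul_conv N h]
    refine Finset.sum_eq_zero fun k _ => Finset.sum_eq_zero fun l _ => ?_
    by_cases hk : (p.1, k) ≠ (q.1, l) ∧ SameLine (p.1, k) (q.1, l)
    · rw [hu _ _ hk.1 hk.2, zero_mul]
    · rw [hv (k, p.2) (l, q.2), mul_zero]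
      · intro h2
        rw [Prod.mk.injEq] at h2
        refine hk ⟨fun h3 => hpq (Prod.ext (Prod.mk.inj h3).1 h2.2), Or.inr h2.1⟩
      · rcases hl with hl | hl
        · by_contra h4
          simp only [SameLine, not_or] at h4
          exact hk ⟨fun h3 => h4.1 (Prod.mk.inj h3).2, Or.inl hl⟩
        · exact Or.inr hl
  one a b hab hl := one_mul_one_of_sameLine hab hl
  op h a b hab hl := by
    rw [← MulOpposite.op_mul, h _ _ (ne_swap hab.symm) hl.symm.swap, MulOpposite.op_zero]

theorem isGroupRel_infty : IsGroupRel N fun _ _ _ f => InftyRel f where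
  map φ _ h := InftyRel.map φ h
  conv := by
    intro T _ _ u v h hu hv p r q hpq hl
    rw [conv_mul_conv_mul_conv N h]
    refine Finset.sum_eq_zero fun k _ => Finset.sum_eq_zero fun m _ =>
      Finset.sum_eq_zero fun l _ => ?_
    by_cases hk : (p.1, k) ≠ (q.1, l) ∧ SameLine (p.1, k) (q.1, l)
    · rw [hu _ _ _ hk.1 hk.2, zero_mul]
    · rw [hv (k, p.2) _ (l, q.2), mul_zero]
      · intro h2
        rw [Prod.mk.injEq] at h2
        refine hk ⟨fun h3 => hpq (Prod.ext (Prod.mk.inj h3).1 h2.2), Or.inr h2.1⟩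
      · rcases hl with hl | hl
        · by_contra h4
          simp only [SameLine, not_or] at h4
          exact hk ⟨fun h3 => h4.1 (Prod.mk.inj h3).2, Or.inl hl⟩
        · exact Or.inr hl
  one a b c hac hl := by
    rw [mul_right_comm, one_mul_one_of_sameLine hac hl, zero_mul]
  op h a b c hac hl := by
    simp only [← MulOpposite.op_mul]
    rw [← mul_assoc, h _ _ _ (ne_swap hac.symm) hl.symm.swap, MulOpposite.op_zero]

/-- A count of signs, term by term. For $p\ne q$ on a line, exactly one of the pairs
$(u_{p_1k},u_{q_1l})$ and $(v_{kp_2},v_{lq_2})$ anticommutes while the other commutes. For $p,q$ on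
no common line, both anticommute if $k=l$ and both commute if $k\ne l$. -/
theorem isGroupRel_twisted : IsGroupRel N fun _ _ _ f => TwistedRel f where
  map φ _ h := TwistedRel.map φ h
  conv := by
    intro T _ _ u v h hu hv
    refine ⟨fun p q hpq hl => ?_, fun p q hl => ?_⟩
    · rw [conv_mul_conv N h, conv_mul_conv N h, Finset.sum_comm]
      simp only [← Finset.sum_neg_distrib]
      refine Finset.sum_congr rfl fun k _ => Finset.sum_congr rfl fun l _ => ?_
      rcases hl with hl | hl
      · have h2 : p.2 ≠ q.2 := fun h2 => hpq (Prod.ext hl h2)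
        by_cases hkl : l = k
        · subst hkl
          rw [hl, hv.1 (l, p.2) (l, q.2) (by simpa using h2) (Or.inl rfl), mul_neg]
        · rw [hu.1 (p.1, l) (q.1, k) (by simp [hkl]) (Or.inl hl), hv.2 (l, p.2) (k, q.2)
            (by simp [SameLine, hkl, h2]), neg_mul]
      · have h2 : p.1 ≠ q.1 := fun h2 => hpq (Prod.ext h2 hl)
        by_cases hkl : l = k
        · subst hkl
          rw [hl, hu.1 (p.1, l) (q.1, l) (by simpa using h2) (Or.inr rfl), neg_mul]
        · rw [hv.1 (l, p.2) (k, q.2) (by simp [hkl]) (Or.inr hl), hu.2 (p.1, l) (q.1, k)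
            (by simp [SameLine, hkl, h2]), mul_neg]
    · simp only [SameLine, not_or] at hl
      rw [conv_mul_conv N h, conv_mul_conv N h, Finset.sum_comm]
      refine Finset.sum_congr rfl fun k _ => Finset.sum_congr rfl fun l _ => ?_
      by_cases hkl : l = k
      · subst hkl
        rw [hu.1 (p.1, l) (q.1, l) (by simp [hl.1]) (Or.inr rfl),
          hv.1 (l, p.2) (l, q.2) (by simp [hl.2]) (Or.inl rfl), neg_mul_neg]
      · rw [hu.2 (p.1, l) (q.1, k) (by simp [SameLine, hkl, hl.1]),
          hv.2 (l, p.2) (k, q.2) (by simp [SameLine, hkl, hl.2])]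
  one := ⟨fun a b hab hl => by
    rw [one_mul_one_of_sameLine hab hl, one_mul_one_of_sameLine hab.symm hl.symm, neg_zero],
    fun a b _ => mul_comm _ _⟩
  op h := by
    refine ⟨fun a b hab hl => ?_, fun a b hl => ?_⟩
    · rw [← MulOpposite.op_mul, h.1 _ _ (ne_swap hab.symm) hl.symm.swap, MulOpposite.op_neg,
        MulOpposite.op_mul]
    · rw [← MulOpposite.op_mul, h.2 _ _ (fun h2 => hl h2.symm.swap), MulOpposite.op_mul]

end GroupRel

theorem isSelfAdjoint_act {T : Type} [CStarAlgebra T] {N : ℕ} {u : Fin N × Fin N → T}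
    {x : Fin N → T} (h : ∀ a k, u a * x k = x k * u a) (hu : ∀ a, IsSelfAdjoint (u a))
    (hx : ∀ k, IsSelfAdjoint (x k)) (i : Fin N) : IsSelfAdjoint (act u x i) := by
  unfold IsSelfAdjoint act
  rw [star_sum]
  refine Finset.sum_congr rfl fun k _ => ?_
  rw [star_mul, (hu _).star_eq, (hx _).star_eq, h]

/-- The three clauses `conv`, `one`, `op` of `IsGroupRel` say that the prescribed images of the
coordinates satisfy the defining relations, so the universal property yields $\Delta$, $\varepsilon$
and $S$. -/
theorem isQuantumSubgroup_of_universal {N : ℕ} {G : NCSpace (Fin N × Fin N)}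
    {Q : ∀ (D : Type) [Ring D] [Algebra ℂ D], (Fin N × Fin N → D) → Prop}
    (hG : IsUniversal G fun D _ _ f => Orth f ∧ Q D f) (hQ : IsGroupRel N Q) :
    IsQuantumSubgroup G := by
  have hr := (isGroupRel_orth N).and hQ
  have key : ∀ (T : Type) [CStarAlgebra T] (α β : G.C →⋆ₐ[ℂ] T),
      (∀ a b, α a * β b = β b * α a) → ∃ Δ : G.C →⋆ₐ[ℂ] T,
        ∀ p, Δ (G.coord p) = conv (fun p => α (G.coord p)) (fun p => β (G.coord p)) p := by
    intro T _ α β h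
    refine hG.hom (fun p => ?_) ?_
    · exact isSelfAdjoint_act (fun a b => h _ _) (fun a => (G.selfAdjoint a).map α)
        (fun k => (G.selfAdjoint (k, p.2)).map β) p.1
    · exact hr.conv (fun a b => h _ _) (hr.map (α : G.C →ₐ[ℂ] T) hG.coord)
        (hr.map (β : G.C →ₐ[ℂ] T) hG.coord)
  refine ⟨(isUniversal_freeOrth N).le ⟨hG.coord.1, trivial⟩, ?_, ?_, ?_⟩
  · obtain ⟨Δ, hΔ⟩ := key (MinTensor G.C G.C) (tensorInl G.C G.C) (tensorInr G.C G.C)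
      (fun a b => (commute_tensor a b).eq)
    exact ⟨Δ, fun i j => hΔ (i, j)⟩
  · have hsa : ∀ p : Fin N × Fin N, IsSelfAdjoint (if p.1 = p.2 then (1 : ℂ) else 0) := fun p => by
      split_ifs <;> simp
    obtain ⟨ε, hε⟩ := hG.hom hsa hr.one
    exact ⟨ε, fun i j => hε (i, j)⟩
  · have hsa : ∀ p : Fin N × Fin N, IsSelfAdjoint (MulOpposite.op (G.coord (p.2, p.1))) :=
      fun p => by
        change star (MulOpposite.op _) = _
        rw [← MulOpposite.op_star, (G.selfAdjoint _).star_eq]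
    obtain ⟨S, hS⟩ := hG.hom (D := G.Cᵐᵒᵖ) hsa (hr.op hG.coord)
    exact ⟨S, fun i j => hS (i, j)⟩

theorem actsOn_of_universal {N : ℕ} {G : NCSpace (Fin N × Fin N)} {X : NCSpace (Fin N)}
    {P : ∀ (D : Type) [Ring D] [Algebra ℂ D], (Fin N × Fin N → D) → Prop}
    {Q : ∀ (D : Type) [Ring D] [Algebra ℂ D], (Fin N → D) → Prop}
    (hG : IsUniversal G fun D _ _ f => Orth f ∧ P D f) (hP : IsGroupRel N P)
    (hX : IsUniversal X Q)
    (hQ : ∀ {D E : Type} [Ring D] [Algebra ℂ D] [Ring E] [Algebra ℂ E] (φ : D →ₐ[ℂ] E)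
      {f : Fin N → D}, Q D f → Q E fun p => φ (f p))
    (h : ∀ {T : Type} [Ring T] [Algebra ℂ T] {u : Fin N × Fin N → T} {x : Fin N → T},
      (∀ a k, u a * x k = x k * u a) → Orth u → P T u → Q T x → Q T (act u x)) :
    ActsOn G X := by
  have key : ∀ (T : Type) [CStarAlgebra T] (α : G.C →⋆ₐ[ℂ] T) (β : X.C →⋆ₐ[ℂ] T),
      (∀ a b, α a * β b = β b * α a) → ∃ Φ : X.C →⋆ₐ[ℂ] T,
        ∀ i, Φ (X.coord i) = act (fun p => α (G.coord p)) (fun p => β (X.coord p)) i := by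
    intro T _ α β hc
    refine hX.hom (fun i => ?_) ?_
    · exact isSelfAdjoint_act (fun a b => hc _ _) (fun a => (G.selfAdjoint a).map α)
        (fun k => (X.selfAdjoint k).map β) i
    · exact h (fun a b => hc _ _) (((isGroupRel_orth N).map (α : G.C →ₐ[ℂ] T) hG.coord.1))
        (hP.map (α : G.C →ₐ[ℂ] T) hG.coord.2) (hQ (β : X.C →ₐ[ℂ] T) hX.coord)
  exact key (MinTensor G.C X.C) (tensorInl G.C X.C) (tensorInr G.C X.C)
    (fun a b => (commute_tensor a b).eq)

section Actions

variable (N : ℕ)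

theorem classicalOrth_actsOn : ActsOn (classicalOrth N) (classicalSphere N) :=
  actsOn_of_universal (isUniversal_classicalOrth N) (isGroupRel_comm N)
    (isUniversal_classicalSphere N) (fun φ _ h => ⟨h.1.map φ, h.2.map φ⟩)
    fun hc hu hP hx => ⟨sumSq_act hc hu hx.1, commRel_act hc hP hx.2⟩

theorem halfOrth_actsOn : ActsOn (halfOrth N) (halfSphere N) :=
  actsOn_of_universal (isUniversal_halfOrth N) (isGroupRel_half N)
    (isUniversal_halfSphere N) (fun φ _ h => ⟨h.1.map φ, h.2.map φ⟩)
    fun hc hu hP hx => ⟨sumSq_act hc hu hx.1, halfRel_act hc hP hx.2⟩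

theorem hyperInfty_actsOn : ActsOn (hyperInfty N) (sphereInfty N) :=
  actsOn_of_universal (isUniversal_hyperInfty N) (isGroupRel_infty N)
    (isUniversal_sphereInfty N) (fun φ _ h => ⟨h.1.map φ, h.2.map φ⟩)
    fun hc hu hP hx => ⟨sumSq_act hc hu hx.1, sqCentral_act hc hu hP hx.2⟩

theorem twistedOrth_actsOn : ActsOn (twistedOrth N) (cube (cubeGroup N)) :=
  actsOn_of_universal (isUniversal_twistedOrth N) (isGroupRel_twisted N)
    isUniversal_cube_cubeGroup (fun φ _ h => ⟨h.1.map φ, h.2.map φ⟩)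
    fun hc hu hP hx => ⟨cubeSq_act_of_twisted hc hu hP hx.1 hx.2,
      commRel_act_of_twisted hc hu hP hx.1 hx.2⟩

theorem halfHyper_actsOn : ActsOn (halfHyper N) (cube (halfGroup N)) :=
  actsOn_of_universal (isUniversal_halfHyper N) ((isGroupRel_cubic N).and (isGroupRel_half N))
    isUniversal_cube_halfGroup (fun φ _ h => ⟨h.1.map φ, h.2.map φ⟩)
    fun hc hu hP hx => ⟨cubeSq_act_of_cubic hc hu hP.1 hx.1, halfRel_act hc hP.2 hx.2⟩

theorem freeHyper_actsOn : ActsOn (freeHyper N) (cube (freeGroup N)) :=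
  actsOn_of_universal (isUniversal_freeHyper N) (isGroupRel_cubic N)
    isUniversal_cube_freeGroup (fun φ _ h => h.map φ)
    fun hc hu hP hx => cubeSq_act_of_cubic hc hu hP hx

end Actions

/-! ### Linear independence of group elements -/

open scoped Matrix.Norms.L2Operator in
/-- The permutation representations of a group extend to its full C*-algebra. -/
theorem sum_ite_eq_zero_of_sum_groupElt {Γ W κ : Type} [Group Γ] [Fintype W] [DecidableEq W]
    [Fintype κ] (ψ : Γ →* Equiv.Perm W) {c : κ → ℂ} {γ : κ → Γ}
    (h : ∑ k, c k • groupElt (γ k) = 0) (s t : W) :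
    ∑ k, (if ψ (γ k) s = t then c k else 0) = 0 := by
  let f : Γ → Matrix W W ℂ := fun g => Matrix.of fun i j => if ψ g j = i then 1 else 0
  have hf : (groupPresentation Γ).Sol (Matrix W W ℂ) f := by
    refine ⟨?_, fun g h => ?_, fun g => ?_⟩
    · ext i j
      simp [f, Matrix.one_apply, eq_comm]
    · ext i j
      simp [f, Matrix.mul_apply]
    · ext i j
      simp only [f, Matrix.star_apply, Matrix.of_apply, map_inv, Equiv.Perm.inv_eq_iff_eq]
      split_ifs with h1 h2 h2
      · simp
      · exact absurd h1.symm h2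
      · exact absurd h2.symm h1
      · simp
  obtain ⟨φ, hφ⟩ := Presentation.exists_hom hf
  have h1 := congrFun (congrFun (congrArg φ h) t) s
  rw [map_sum, map_zero] at h1
  simp only [map_smul, hφ, Matrix.sum_apply, Matrix.smul_apply] at h1
  simpa [f] using h1

/-- The words of length two in the coordinates. -/
def word₂ {D : Type} [Ring D] {N : ℕ} (x : Fin N → D) (p : Fin N × Fin N) : D := x p.1 * x p.2

/-- The words of length three in the coordinates. -/
def word₃ {D : Type} [Ring D] {N : ℕ} (x : Fin N → D) (p : Fin N × Fin N × Fin N) : D :=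
  x p.1 * x p.2.1 * x p.2.2

section Words

variable {N : ℕ}

theorem sum_word₂_eq_zero_of_le {X Y : NCSpace (Fin N)} (hXY : X ≤ Y) {c : Fin N × Fin N → ℂ}
    (h : ∑ p, c p • word₂ Y.coord p = 0) : ∑ p, c p • word₂ X.coord p = 0 := by
  obtain ⟨φ, hφ⟩ := hXY
  have := congrArg φ h
  simpa [map_sum, word₂, hφ] using this

theorem sum_word₃_eq_zero_of_le {X Y : NCSpace (Fin N)} (hXY : X ≤ Y)
    {c : Fin N × Fin N × Fin N → ℂ}
    (h : ∑ p, c p • word₃ Y.coord p = 0) : ∑ p, c p • word₃ X.coord p = 0 := by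
  obtain ⟨φ, hφ⟩ := hXY
  have := congrArg φ h
  simpa [map_sum, word₃, hφ] using this

theorem one_div_sqrt_ne_zero (i : Fin N) : ((1 / √(N : ℝ) : ℝ) : ℂ) ≠ 0 := by
  have : (0 : ℝ) < N := by exact_mod_cast i.pos
  exact_mod_cast (by positivity : (1 / √(N : ℝ) : ℝ) ≠ 0)

/-- This is the $(t,s)$ matrix coefficient of the relation in a permutation representation: the
coefficients of the words carrying `s` to `t` add up to zero. A representation in which only
prescribed words do so isolates their coefficients. -/
theorem cube_sum_word₂ (G : ReflectionGroup N) {W : Type} [Fintype W] [DecidableEq W]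
    (ψ : G.Γ →* Equiv.Perm W) {c : Fin N × Fin N → ℂ}
    (h : ∑ p, c p • word₂ (cube G).coord p = 0) (s t : W) :
    ∑ p : Fin N × Fin N, (if ψ (G.g p.1) (ψ (G.g p.2) s) = t then c p else 0) = 0 := by
  rcases isEmpty_or_nonempty (Fin N) with hN | ⟨⟨i⟩⟩
  · simp
  set r : ℂ := ((1 / √(N : ℝ) : ℝ) : ℂ) with hr
  have h1 : ∑ p : Fin N × Fin N, (c p * (r * r)) • groupElt (G.g p.1 * G.g p.2) = 0 := by
    simp only [mul_smul (c _), ← smul_groupElt_mul]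
    exact h
  have h2 := sum_ite_eq_zero_of_sum_groupElt ψ h1 s t
  have h3 : (∑ p : Fin N × Fin N, (if ψ (G.g p.1) (ψ (G.g p.2) s) = t then c p else 0)) *
      (r * r) = 0 := by
    refine Eq.trans ?_ h2
    rw [Finset.sum_mul]
    refine Finset.sum_congr rfl fun p _ => ?_
    rw [map_mul, Equiv.Perm.mul_apply, ite_mul, zero_mul]
  have hne : r * r ≠ 0 := mul_ne_zero (one_div_sqrt_ne_zero i) (one_div_sqrt_ne_zero i)
  exact (mul_eq_zero.mp h3).resolve_right hne

theorem cube_sum_word₃ (G : ReflectionGroup N) {W : Type} [Fintype W] [DecidableEq W]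
    (ψ : G.Γ →* Equiv.Perm W) {c : Fin N × Fin N × Fin N → ℂ}
    (h : ∑ p, c p • word₃ (cube G).coord p = 0) (s t : W) :
    ∑ p : Fin N × Fin N × Fin N,
      (if ψ (G.g p.1) (ψ (G.g p.2.1) (ψ (G.g p.2.2) s)) = t then c p else 0) = 0 := by
  rcases isEmpty_or_nonempty (Fin N) with hN | ⟨⟨i⟩⟩
  · simp
  set r : ℂ := ((1 / √(N : ℝ) : ℝ) : ℂ) with hr
  have h1 : ∑ p : Fin N × Fin N × Fin N,
      (c p * (r * r * r)) • groupElt (G.g p.1 * G.g p.2.1 * G.g p.2.2) = 0 := by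
    simp only [mul_smul (c _), ← smul_groupElt_mul_mul]
    exact h
  have h2 := sum_ite_eq_zero_of_sum_groupElt ψ h1 s t
  have h3 : (∑ p : Fin N × Fin N × Fin N,
      (if ψ (G.g p.1) (ψ (G.g p.2.1) (ψ (G.g p.2.2) s)) = t then c p else 0)) *
      (r * r * r) = 0 := by
    refine Eq.trans ?_ h2
    rw [Finset.sum_mul]
    refine Finset.sum_congr rfl fun p _ => ?_
    rw [map_mul, map_mul, Equiv.Perm.mul_apply, Equiv.Perm.mul_apply, ite_mul, zero_mul]
  have hne := one_div_sqrt_ne_zero i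
  exact (mul_eq_zero.mp h3).resolve_right (mul_ne_zero (mul_ne_zero hne hne) hne)

/-! ### Permutation models of the reflection groups -/

/-- The reflections `(n, +) ↦ (n + z, -)` and `(n, -) ↦ (n - z, +)`. -/
def zigzag {A : Type} [AddCommGroup A] (z : A) : Equiv.Perm (A × Bool) :=
  Function.Involutive.toPerm (fun w => if w.2 then (w.1 + z, false) else (w.1 - z, true)) (by
    rintro ⟨n, b⟩
    cases b <;> simp)

@[simp] theorem zigzag_true {A : Type} [AddCommGroup A] (z n : A) :
    zigzag z (n, true) = (n + z, false) := rfl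

@[simp] theorem zigzag_false {A : Type} [AddCommGroup A] (z n : A) :
    zigzag z (n, false) = (n - z, true) := rfl

/-- A product of three zigzags translates by $\pm(\theta_i-\theta_j+\theta_k)$, which is symmetric
in $i$ and $k$. -/
theorem exists_zigzag {A : Type} [AddCommGroup A] (θ : Fin N → A) :
    ∃ ψ : (halfGroup N).Γ →* Equiv.Perm (A × Bool),
      ∀ i, ψ ((halfGroup N).g i) = zigzag (θ i) := by
  refine halfGroup_lift _ (fun i => ?_) fun i j k => ?_
  · ext1 ⟨n, b⟩
    cases b <;> simp
  · ext1 ⟨n, b⟩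
    cases b <;> simp <;> abel

/-- Coloring the letters by `Fin 4`, with the relevant ones singled out, makes the conditions on
words independent of `N`, so that they can be decided by enumeration. -/
theorem exists_tag₂ {a b : Fin N} (hab : a ≠ b) :
    ∃ κ : Fin N → Fin 4, (∀ i, κ i = 0 ↔ i = a) ∧ ∀ i, κ i = 1 ↔ i = b := by
  refine ⟨fun i => if i = a then 0 else if i = b then 1 else 2, fun i => ?_, fun i => ?_⟩
  · by_cases h1 : i = a <;> by_cases h2 : i = b <;> simp [h1, h2]
  · by_cases h1 : i = a
    · simp [h1, hab]
    · by_cases h2 : i = b <;> simp [h1, h2, hab.symm]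

theorem exists_tag₃ {a b d : Fin N} (hab : a ≠ b) (had : a ≠ d) (hbd : b ≠ d) :
    ∃ κ : Fin N → Fin 4, (∀ i, κ i = 0 ↔ i = a) ∧ (∀ i, κ i = 1 ↔ i = b) ∧
      ∀ i, κ i = 2 ↔ i = d := by
  refine ⟨fun i => if i = a then 0 else if i = b then 1 else if i = d then 2 else 3,
    fun i => ?_, fun i => ?_, fun i => ?_⟩
  all_goals
    rcases eq_or_ne i a with rfl | h1
    · simp [hab, had]
    · rcases eq_or_ne i b with rfl | h2
      · simp [h1, hbd]
      · rcases eq_or_ne i d with rfl | h3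
        · simp [h1, h2]
        · simp [h1, h2, h3]

theorem cube_halfGroup_word₂ {c : Fin N × Fin N → ℂ}
    (h : ∑ p, c p • word₂ (cube (halfGroup N)).coord p = 0) {a b : Fin N} (hab : a ≠ b) :
    c (a, b) = 0 := by
  obtain ⟨κ, ha, hb⟩ := exists_tag₂ hab
  -- A word $ij$ carries $(0,+)$ to $(\theta_j-\theta_i,+)$. With these weights the difference is
  -- $5$ modulo $16$ only for $ij=ab$.
  let θ : Fin 4 → ZMod 16 := ![-4, 1, 0, 0]
  obtain ⟨ψ, hψ⟩ := exists_zigzag fun i => θ (κ i)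
  have h1 := cube_sum_word₂ _ ψ h (0, true) (5, true)
  have hθ : ∀ x y, 0 + θ y - θ x = 5 ↔ x = 0 ∧ y = 1 := by decide
  have h2 : ∀ p : Fin N × Fin N, (if ψ ((halfGroup N).g p.1) (ψ ((halfGroup N).g p.2) (0, true)) =
      (5, true) then c p else 0) = if p = (a, b) then c p else 0 := fun p => by
    simp only [hψ, zigzag_true, zigzag_false, Prod.ext_iff, and_true, hθ, ha, hb]
  simpa only [h2, Finset.sum_ite_eq', Finset.mem_univ, if_true] using h1

theorem cube_halfGroup_word₃ {c : Fin N × Fin N × Fin N → ℂ}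
    (h : ∑ p, c p • word₃ (cube (halfGroup N)).coord p = 0) {a b d : Fin N} (hab : a ≠ b)
    (hbd : b ≠ d) : c (a, b, d) + c (d, b, a) = 0 := by
  by_cases had : a = d
  · subst had
    obtain ⟨κ, ha, hb⟩ := exists_tag₂ hab
    let θ : Fin 4 → ZMod 16 := ![1, -4, 0, 0]
    obtain ⟨ψ, hψ⟩ := exists_zigzag fun i => θ (κ i)
    have h1 := cube_sum_word₃ _ ψ h (0, true) (6, false)
    have hθ : ∀ x y z, 0 + θ z - θ y + θ x = 6 ↔ x = 0 ∧ y = 1 ∧ z = 0 := by decide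
    have h2 : ∀ p : Fin N × Fin N × Fin N, (if ψ ((halfGroup N).g p.1) (ψ ((halfGroup N).g p.2.1)
        (ψ ((halfGroup N).g p.2.2) (0, true))) = (6, false) then c p else 0) =
        if p = (a, b, a) then c p else 0 := fun p => by
      simp only [hψ, zigzag_true, zigzag_false, Prod.ext_iff, and_true, hθ, ha, hb]
    have h3 : c (a, b, a) = 0 := by
      simpa only [h2, Finset.sum_ite_eq', Finset.mem_univ, if_true] using h1
    rw [h3, add_zero]
  · obtain ⟨κ, ha, hb, hd⟩ := exists_tag₃ hab had hbd
    -- The alternating sum $\theta_i-\theta_j+\theta_k$ equals $21=1+16+4$ modulo $64$ only for the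
    -- words $abd$ and $dba$, which coincide in the group.
    let θ : Fin 4 → ZMod 64 := ![1, -16, 4, 0]
    obtain ⟨ψ, hψ⟩ := exists_zigzag fun i => θ (κ i)
    have h1 := cube_sum_word₃ _ ψ h (0, true) (21, false)
    have hθ : ∀ x y z, 0 + θ z - θ y + θ x = 21 ↔
        (x = 0 ∧ y = 1 ∧ z = 2) ∨ (x = 2 ∧ y = 1 ∧ z = 0) := by decide
    have h2 : ∀ p : Fin N × Fin N × Fin N, (if ψ ((halfGroup N).g p.1) (ψ ((halfGroup N).g p.2.1)
        (ψ ((halfGroup N).g p.2.2) (0, true))) = (21, false) then c p else 0) =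
        (if p = (a, b, d) then c p else 0) + if p = (d, b, a) then c p else 0 := fun p => by
      simp only [hψ, zigzag_true, zigzag_false, Prod.ext_iff, and_true, hθ, ha, hb, hd]
      by_cases h5 : p.1 = a ∧ p.2.1 = b ∧ p.2.2 = d
      · have h6 : ¬ (p.1 = d ∧ p.2.1 = b ∧ p.2.2 = a) := fun h6 => had (h5.1.symm.trans h6.1)
        rw [if_pos (Or.inl h5), if_pos h5, if_neg h6, add_zero]
      · simp only [h5, false_or, if_false, zero_add]
    simpa only [h2, Finset.sum_add_distrib, Finset.sum_ite_eq', Finset.mem_univ, if_true] using h1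

/-- Involutions of the path $0,1,2,3$: the rightmost letter moves $0$ to $1$, the middle one $1$ to
$2$, the leftmost $2$ to $3$, and no other word of length three carries $0$ to $3$. When the outer
letters coincide, one involution performs both outer moves. -/
theorem cube_freeGroup_word₃ {c : Fin N × Fin N × Fin N → ℂ}
    (h : ∑ p, c p • word₃ (cube (freeGroup N)).coord p = 0) {a b d : Fin N} (hab : a ≠ b)
    (hbd : b ≠ d) : c (a, b, d) = 0 := by
  have key : ∀ (κ : Fin N → Fin 4) (e : Fin 4 → Equiv.Perm (Fin 4)), (∀ x, e x * e x = 1) →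
      (∀ i j k, e (κ i) (e (κ j) (e (κ k) 0)) = 3 ↔ i = a ∧ j = b ∧ k = d) →
      c (a, b, d) = 0 := by
    intro κ e he he'
    obtain ⟨ψ, hψ⟩ := freeGroup_lift (fun i => e (κ i)) fun i => he _
    have h1 := cube_sum_word₃ _ ψ h 0 3
    have h2 : ∀ p : Fin N × Fin N × Fin N, (if ψ ((freeGroup N).g p.1) (ψ ((freeGroup N).g p.2.1)
        (ψ ((freeGroup N).g p.2.2) 0)) = 3 then c p else 0) =
        if p = (a, b, d) then c p else 0 := fun p => by
      simp only [hψ, he', Prod.ext_iff]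
    simpa only [h2, Finset.sum_ite_eq', Finset.mem_univ, if_true] using h1
  by_cases had : a = d
  · subst had
    obtain ⟨κ, ha, hb⟩ := exists_tag₂ hab
    refine key κ ![Equiv.swap 0 1 * Equiv.swap 2 3, Equiv.swap 1 2, 1, 1] (by decide) ?_
    have he : ∀ x y z : Fin 4, (![Equiv.swap 0 1 * Equiv.swap 2 3, Equiv.swap 1 2, 1, 1] :
        Fin 4 → Equiv.Perm (Fin 4)) x ((![Equiv.swap 0 1 * Equiv.swap 2 3, Equiv.swap 1 2, 1, 1] :
        Fin 4 → Equiv.Perm (Fin 4)) y ((![Equiv.swap 0 1 * Equiv.swap 2 3, Equiv.swap 1 2, 1, 1] :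
        Fin 4 → Equiv.Perm (Fin 4)) z 0)) = 3 ↔ x = 0 ∧ y = 1 ∧ z = 0 := by decide
    intro i j k
    rw [he, ha, hb, ha]
  · obtain ⟨κ, ha, hb, hd⟩ := exists_tag₃ hab had hbd
    refine key κ ![Equiv.swap 2 3, Equiv.swap 1 2, Equiv.swap 0 1, 1] (by decide) ?_
    have he : ∀ x y z : Fin 4, (![Equiv.swap 2 3, Equiv.swap 1 2, Equiv.swap 0 1, 1] :
        Fin 4 → Equiv.Perm (Fin 4)) x ((![Equiv.swap 2 3, Equiv.swap 1 2, Equiv.swap 0 1, 1] :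
        Fin 4 → Equiv.Perm (Fin 4)) y ((![Equiv.swap 2 3, Equiv.swap 1 2, Equiv.swap 0 1, 1] :
        Fin 4 → Equiv.Perm (Fin 4)) z 0)) = 3 ↔ x = 0 ∧ y = 1 ∧ z = 2 := by decide
    intro i j k
    rw [he, ha, hb, hd]

theorem cube_cubeGroup_word₂ {c : Fin N × Fin N → ℂ}
    (h : ∑ p, c p • word₂ (cube (cubeGroup N)).coord p = 0) {a b : Fin N} (hab : a ≠ b) :
    c (a, b) + c (b, a) = 0 := by
  let e : Fin N → Equiv.Perm (ZMod 2 × ZMod 2) := fun i =>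
    Equiv.addRight (if i = a then 1 else 0, if i = b then 1 else 0)
  have h0 : ∀ z : ZMod 2, z + z = 0 := by decide
  obtain ⟨ψ, hψ⟩ := cubeGroup_lift e (fun i => by
    ext1 ⟨x, y⟩
    simp [e, add_assoc, h0]) (fun i j => by
    ext1 ⟨x, y⟩
    simp [e, add_right_comm])
  have h1 := cube_sum_word₂ _ ψ h 0 (1, 1)
  have h2 : ∀ i j, e i (e j 0) = (1, 1) ↔ (i = a ∧ j = b) ∨ (i = b ∧ j = a) := by
    intro i j
    simp only [e, Equiv.coe_addRight]
    split_ifs <;> simp_all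
  have h3 : ∀ p : Fin N × Fin N, (if ψ ((cubeGroup N).g p.1) (ψ ((cubeGroup N).g p.2) 0) =
      (1, 1) then c p else 0) = (if p = (a, b) then c p else 0) +
        if p = (b, a) then c p else 0 := fun p => by
    simp only [hψ, h2, Prod.ext_iff]
    by_cases h5 : p.1 = a ∧ p.2 = b
    · have h6 : ¬ (p.1 = b ∧ p.2 = a) := fun h6 => hab (h5.1.symm.trans h6.1)
      rw [if_pos (Or.inl h5), if_pos h5, if_neg h6, add_zero]
    · simp only [h5, false_or, if_false, zero_add]
  simpa only [h3, Finset.sum_add_distrib, Finset.sum_ite_eq', Finset.mem_univ, if_true] using h1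

theorem cube_cubeGroup_linearIndependent :
    LinearIndependent ℂ (cube (cubeGroup N)).coord := by
  rw [Fintype.linearIndependent_iff]
  intro c h a
  let e : Fin N → Equiv.Perm (ZMod 2) := fun i => Equiv.addRight (if i = a then 1 else 0)
  have h0 : ∀ z : ZMod 2, z + z = 0 := by decide
  obtain ⟨ψ, hψ⟩ := cubeGroup_lift e (fun i => by
    ext1 x
    simp [e, add_assoc, h0]) (fun i j => by
    ext1 x
    simp [e, add_right_comm])
  set r : ℂ := ((1 / √(N : ℝ) : ℝ) : ℂ) with hr
  have h1 : ∑ i, (c i * r) • groupElt ((cubeGroup N).g i) = 0 := by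
    simp only [mul_smul]
    exact h
  have h2 := sum_ite_eq_zero_of_sum_groupElt ψ h1 0 1
  have h3 : ∀ i, (if ψ ((cubeGroup N).g i) 0 = 1 then c i * r else 0) =
      if i = a then c i * r else 0 := fun i => by
    simp only [hψ, e, Equiv.coe_addRight]
    split_ifs <;> simp_all
  simp only [h3, Finset.sum_ite_eq', Finset.mem_univ, if_true] at h2
  exact (mul_eq_zero.mp h2).resolve_right (one_div_sqrt_ne_zero a)

/-! ### Evaluation at the points of the classical sphere -/

theorem exists_classicalSphere_eval {t : Fin N → ℝ} (ht : ∑ i, t i * t i = 1) :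
    ∃ φ : (classicalSphere N).C →⋆ₐ[ℂ] ℂ, ∀ i, φ ((classicalSphere N).coord i) = t i := by
  refine (isUniversal_classicalSphere N).hom (fun i => ?_) ⟨?_, fun i j => mul_comm _ _⟩
  · simp [IsSelfAdjoint]
  · change ∑ i, (t i : ℂ) * t i = 1
    exact_mod_cast ht

/-- Evaluation at the point with coordinates $\alpha$ at $a$, $\beta$ at $b$ and $0$ elsewhere. -/
theorem classicalSphere_word₃_eval {c : Fin N × Fin N × Fin N → ℂ}
    (h : ∑ p, c p • word₃ (classicalSphere N).coord p = 0) {a b : Fin N} (hab : a ≠ b)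
    {α β : ℝ} (hαβ : α * α + β * β = 1) :
    c (a, a, a) * (α * α * α) + (c (a, a, b) + c (a, b, a) + c (b, a, a)) * (α * α * β) +
      (c (a, b, b) + c (b, a, b) + c (b, b, a)) * (α * β * β) + c (b, b, b) * (β * β * β) = 0 := by
  let t : Fin N → ℝ := fun i => if i = a then α else if i = b then β else 0
  have key : ∀ {R : Type} [Ring R] [Algebra ℝ R] (F : Fin N → R),
      ∑ i, algebraMap ℝ R (t i) * F i = algebraMap ℝ R α * F a + algebraMap ℝ R β * F b := by
    intro R _ _ F
    rw [← Finset.sum_subset (Finset.subset_univ {a, b}), Finset.sum_pair hab]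
    · simp [t, hab.symm]
    · intro i _ hi
      simp only [Finset.mem_insert, Finset.mem_singleton, not_or] at hi
      simp [t, hi.1, hi.2]
  have ht : ∑ i, t i * t i = 1 := by
    rw [← hαβ]
    refine (key t).trans ?_
    simp [t, hab.symm]
  obtain ⟨φ, hφ⟩ := exists_classicalSphere_eval ht
  have h1 := congrArg φ h
  simp only [map_sum, map_smul, word₃, map_mul, hφ, map_zero, smul_eq_mul] at h1
  rw [Fintype.sum_prod_type] at h1
  simp only [Fintype.sum_prod_type] at h1
  have h2 : ∀ i j k, c (i, j, k) * ((t i : ℂ) * t j * t k) =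
      (t i : ℂ) * (t j * (t k * c (i, j, k))) := fun i j k => by ring
  have key' : ∀ F : Fin N → ℂ, ∑ i, (t i : ℂ) * F i = α * F a + β * F b := fun F => key F
  simp only [h2, ← Finset.mul_sum, key'] at h1
  linear_combination h1

/-- The points $(r,r)$ and $(-r,r)$ of the circle in the $a,b$ plane, with $r^2=1/2$, are compared.
In the sum of the two evaluations the terms odd in $\alpha$ cancel and the coefficient of $\beta^3$
is known to vanish. What remains is the coefficient of $\alpha^2\beta$, from which `hc` removes the
word $aba$. -/
theorem classicalSphere_word₃ {c : Fin N × Fin N × Fin N → ℂ}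
    (h : ∑ p, c p • word₃ (classicalSphere N).coord p = 0)
    (hc : ∀ a b, a ≠ b → c (a, b, a) = 0) (a b : Fin N) : c (a, a, b) + c (b, a, a) = 0 := by
  by_cases hab : a = b
  · subst hab
    by_cases hN : ∃ b, a ≠ b
    · obtain ⟨b, hb⟩ := hN
      have := classicalSphere_word₃_eval h hb (α := 1) (β := 0) (by norm_num)
      simp at this
      rw [this, add_zero]
    · push Not at hN
      have ht : ∑ i, (fun _ : Fin N => (1 : ℝ)) i * (fun _ : Fin N => (1 : ℝ)) i = 1 := by
        rw [Finset.sum_eq_single a (fun b _ hb => absurd (hN b).symm hb) (by simp)]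
        simp
      obtain ⟨φ, hφ⟩ := exists_classicalSphere_eval ht
      have h1 := congrArg φ h
      simp only [map_sum, map_smul, word₃, map_mul, hφ, map_zero, smul_eq_mul] at h1
      rw [Finset.sum_eq_single (a, a, a) (fun b _ hb => absurd (by
        rw [Prod.ext_iff, Prod.ext_iff]
        exact ⟨(hN _).symm, (hN _).symm, (hN _).symm⟩) hb) (by simp)] at h1
      simp at h1
      rw [h1, add_zero]
  · have h0 := classicalSphere_word₃_eval h (Ne.symm hab) (α := 1) (β := 0) (by norm_num)
    simp at h0
    set r : ℝ := √(1 / 2) with hr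
    have hr2 : r * r = 1 / 2 := Real.mul_self_sqrt (by norm_num)
    have h1 := classicalSphere_word₃_eval h hab (α := r) (β := r) (by rw [hr2]; norm_num)
    have h2 := classicalSphere_word₃_eval h hab (α := -r) (β := r) (by
      rw [neg_mul_neg, hr2]; norm_num)
    rw [h0, hc a b hab] at h1 h2
    have hr0 : (r : ℂ) ≠ 0 := by
      have : r ≠ 0 := by
        intro h
        rw [h] at hr2
        norm_num at hr2
      exact_mod_cast this
    have h3 : (c (a, a, b) + c (b, a, a)) * (2 * (r * r * r : ℂ)) = 0 := by
      push_cast at h1 h2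
      linear_combination h1 + h2
    exact (mul_eq_zero.mp h3).resolve_right (by simp [hr0])

theorem classicalSphere_word₂ {c : Fin N × Fin N → ℂ}
    (h : ∑ p, c p • word₂ (classicalSphere N).coord p = 0) (a : Fin N) : c (a, a) = 0 := by
  let t : Fin N → ℝ := fun i => if i = a then 1 else 0
  have ht : ∑ i, t i * t i = 1 := by simp [t]
  obtain ⟨φ, hφ⟩ := exists_classicalSphere_eval ht
  have h1 := congrArg φ h
  simp only [map_sum, map_smul, word₂, map_mul, hφ, map_zero, smul_eq_mul] at h1
  rw [Finset.sum_eq_single (a, a)] at h1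
  · simpa [t] using h1
  · rintro ⟨i, j⟩ _ hij
    by_cases hi : i = a
    · have hj : j ≠ a := fun hj => hij (by rw [hi, hj])
      simp [t, hj]
    · simp [t, hi]
  · simp

end Words

/-! ### Inclusions of spheres and cubes -/

section Inclusions

variable (N : ℕ)

theorem CommRel.halfRel {ι D : Type} [Ring D] {f : ι → D} (h : CommRel f) : HalfRel f :=
  fun i j k => by
    rw [h i j, mul_assoc, h i k, ← mul_assoc, h j k]

theorem HalfRel.sqCentral {ι D : Type} [Ring D] {f : ι → D} (h : HalfRel f) : SqCentral f :=
  fun i j => h i i j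

theorem CubeSq.sumSq {N : ℕ} {D : Type} [Ring D] [Algebra ℂ D] {f : Fin N → D} (hN : 1 ≤ N)
    (h : CubeSq f) : SumSq f := by
  unfold SumSq
  have hN' : (N : ℂ) ≠ 0 := by exact_mod_cast (by omega : N ≠ 0)
  simp only [h _, Finset.sum_const, Finset.card_univ, Fintype.card_fin, ← map_nsmul]
  rw [nsmul_eq_mul, mul_one_div_cancel hN', map_one]

theorem CubeSq.sqCentral {N : ℕ} {D : Type} [Ring D] [Algebra ℂ D] {f : Fin N → D}
    (h : CubeSq f) : SqCentral f := fun i j => by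
  rw [h i, mul_assoc, h i, Algebra.commutes]

theorem classicalSphere_le_halfSphere : classicalSphere N ≤ halfSphere N :=
  (isUniversal_halfSphere N).le
    ⟨(isUniversal_classicalSphere N).coord.1, (isUniversal_classicalSphere N).coord.2.halfRel⟩

theorem halfSphere_le_sphereInfty : halfSphere N ≤ sphereInfty N :=
  (isUniversal_sphereInfty N).le
    ⟨(isUniversal_halfSphere N).coord.1, (isUniversal_halfSphere N).coord.2.sqCentral⟩

theorem cube_cubeGroup_le_halfGroup : cube (cubeGroup N) ≤ cube (halfGroup N) :=
  isUniversal_cube_halfGroup.le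
    ⟨isUniversal_cube_cubeGroup.coord.1, isUniversal_cube_cubeGroup.coord.2.halfRel⟩

theorem cube_halfGroup_le_freeGroup : cube (halfGroup N) ≤ cube (freeGroup N) :=
  isUniversal_cube_freeGroup.le isUniversal_cube_halfGroup.coord.1

variable {N}

theorem cube_cubeGroup_le_classicalSphere (hN : 1 ≤ N) : cube (cubeGroup N) ≤ classicalSphere N :=
  (isUniversal_classicalSphere N).le
    ⟨isUniversal_cube_cubeGroup.coord.1.sumSq hN, isUniversal_cube_cubeGroup.coord.2⟩

theorem cube_halfGroup_le_halfSphere (hN : 1 ≤ N) : cube (halfGroup N) ≤ halfSphere N :=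
  (isUniversal_halfSphere N).le
    ⟨isUniversal_cube_halfGroup.coord.1.sumSq hN, isUniversal_cube_halfGroup.coord.2⟩

theorem cube_freeGroup_le_sphereInfty (hN : 1 ≤ N) : cube (freeGroup N) ≤ sphereInfty N :=
  (isUniversal_sphereInfty N).le
    ⟨isUniversal_cube_freeGroup.coord.sumSq hN, isUniversal_cube_freeGroup.coord.sqCentral⟩

theorem linearIndependent_of_le {X Y : NCSpace (Fin N)} (h : X ≤ Y)
    (hX : LinearIndependent ℂ X.coord) : LinearIndependent ℂ Y.coord := by
  obtain ⟨φ, hφ⟩ := h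
  refine LinearIndependent.of_comp (φ : Y.C →ₐ[ℂ] X.C).toLinearMap ?_
  have : ⇑(φ : Y.C →ₐ[ℂ] X.C).toLinearMap ∘ Y.coord = X.coord := funext hφ
  rwa [this]

end Inclusions

/-! ### Words of length three in the spheres -/

section SphereWords

variable {N : ℕ}

/-- A relation on the sphere restricts to both subspaces. The half-liberated cube treats the words
with $a\ne b\ne d$, the classical sphere those containing a square. -/
theorem halfSphere_word₃ (hN : 1 ≤ N) {c : Fin N × Fin N × Fin N → ℂ}
    (h : ∑ p, c p • word₃ (halfSphere N).coord p = 0) (a b d : Fin N) :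
    c (a, b, d) + c (d, b, a) = 0 := by
  have h1 := fun {a b d : Fin N} => cube_halfGroup_word₃ (a := a) (b := b) (d := d)
    (sum_word₃_eq_zero_of_le (cube_halfGroup_le_halfSphere hN) h)
  have h2 := classicalSphere_word₃ (sum_word₃_eq_zero_of_le (classicalSphere_le_halfSphere N) h)
    fun a b hab => by
      have := h1 hab hab.symm
      rw [← two_mul] at this
      exact (mul_eq_zero.mp this).resolve_left two_ne_zero
  by_cases hab : a = b
  · subst hab; exact h2 a d
  by_cases hbd : b = d
  · subst hbd; rw [add_comm]; exact h2 b a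
  exact h1 hab hbd

theorem sphereInfty_word₃ (hN : 1 ≤ N) {c : Fin N × Fin N × Fin N → ℂ}
    (h : ∑ p, c p • word₃ (sphereInfty N).coord p = 0) :
    (∀ a b d, a ≠ b → b ≠ d → c (a, b, d) = 0) ∧ ∀ a b, c (a, a, b) + c (b, a, a) = 0 := by
  have h1 : ∀ a b d, a ≠ b → b ≠ d → c (a, b, d) = 0 := fun a b d => cube_freeGroup_word₃
    (sum_word₃_eq_zero_of_le (cube_freeGroup_le_sphereInfty hN) h)
  exact ⟨h1, classicalSphere_word₃ (sum_word₃_eq_zero_of_le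
    ((classicalSphere_le_halfSphere N).trans (halfSphere_le_sphereInfty N)) h)
    fun a b hab => h1 a b a hab hab.symm⟩

theorem classicalSphere_word₂' (hN : 1 ≤ N) {c : Fin N × Fin N → ℂ}
    (h : ∑ p, c p • word₂ (classicalSphere N).coord p = 0) (a b : Fin N) :
    c (a, b) + c (b, a) = 0 := by
  by_cases hab : a = b
  · subst hab
    rw [classicalSphere_word₂ h, add_zero]
  · exact cube_cubeGroup_word₂
      (sum_word₂_eq_zero_of_le (cube_cubeGroup_le_classicalSphere hN) h) hab

theorem cube_freeGroup_word₂ {c : Fin N × Fin N → ℂ}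
    (h : ∑ p, c p • word₂ (cube (freeGroup N)).coord p = 0) {a b : Fin N} (hab : a ≠ b) :
    c (a, b) = 0 :=
  cube_halfGroup_word₂ (sum_word₂_eq_zero_of_le (cube_halfGroup_le_freeGroup N) h) hab

end SphereWords

/-! ### Relations satisfied by the quantum groups that act -/

section Slices

variable {A B κ : Type} [CStarAlgebra A] [CStarAlgebra B] [Fintype κ] {a : κ → A} {b : κ → B}

theorem eq_zero_of_sum_minTmul (h : ∑ k, minTmul (a k) (b k) = 0) (k₀ : κ)
    (hl : ∀ c : κ → ℂ, ∑ k, c k • b k = 0 → c k₀ = 0) : a k₀ = 0 := by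
  classical
  have := sum_smul_eq_zero_of_sum_minTmul h (Pi.single k₀ 1) (fun c hc => by
    simpa [Pi.single_apply] using hl c hc)
  simpa [Pi.single_apply] using this

theorem add_eq_zero_of_sum_minTmul (h : ∑ k, minTmul (a k) (b k) = 0) (k₀ k₁ : κ)
    (hl : ∀ c : κ → ℂ, ∑ k, c k • b k = 0 → c k₀ + c k₁ = 0) : a k₀ + a k₁ = 0 := by
  classical
  have := sum_smul_eq_zero_of_sum_minTmul h (Pi.single k₀ 1 + Pi.single k₁ 1) (fun c hc => by
    simpa [Pi.single_apply, add_mul, Finset.sum_add_distrib] using hl c hc)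
  simpa [Pi.single_apply, add_smul, Finset.sum_add_distrib] using this

end Slices

/-! ### Equations obtained by applying a coaction to relations. -/

section Coaction

variable {N : ℕ} {G : NCSpace (Fin N × Fin N)} {X : NCSpace (Fin N)}
  {Φ : X.C →⋆ₐ[ℂ] MinTensor G.C X.C}

theorem coaction_mul (hΦ : ∀ i, Φ (X.coord i) = ∑ j, minTmul (G.coord (i, j)) (X.coord j))
    (i j : Fin N) : Φ (X.coord i * X.coord j) =
      ∑ p : Fin N × Fin N, minTmul (G.coord (i, p.1) * G.coord (j, p.2)) (word₂ X.coord p) := by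
  rw [map_mul, hΦ, hΦ, Finset.sum_mul_sum, Fintype.sum_prod_type]
  simp only [minTmul_mul, word₂]

theorem coaction_mul_mul (hΦ : ∀ i, Φ (X.coord i) = ∑ j, minTmul (G.coord (i, j)) (X.coord j))
    (i j k : Fin N) : Φ (X.coord i * X.coord j * X.coord k) =
      ∑ p : Fin N × Fin N × Fin N,
        minTmul (G.coord (i, p.1) * G.coord (j, p.2.1) * G.coord (k, p.2.2))
          (word₃ X.coord p) := by
  rw [map_mul, map_mul, hΦ, hΦ, hΦ, Finset.sum_mul_sum, Finset.sum_mul]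
  rw [Fintype.sum_prod_type]
  refine Finset.sum_congr rfl fun a _ => ?_
  rw [Fintype.sum_prod_type, Finset.sum_mul_sum]
  simp only [minTmul_mul, word₃]

theorem sum_word₂_of_mul_eq
    (hΦ : ∀ i, Φ (X.coord i) = ∑ j, minTmul (G.coord (i, j)) (X.coord j)) {i j i' j' : Fin N}
    (h : X.coord i * X.coord j = X.coord i' * X.coord j') :
    ∑ p : Fin N × Fin N, minTmul (G.coord (i, p.1) * G.coord (j, p.2) -
      G.coord (i', p.1) * G.coord (j', p.2)) (word₂ X.coord p) = 0 := by
  simp only [minTmul_sub, Finset.sum_sub_distrib]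
  rw [← coaction_mul hΦ, ← coaction_mul hΦ, h, sub_self]

theorem sum_word₃_of_mul_eq
    (hΦ : ∀ i, Φ (X.coord i) = ∑ j, minTmul (G.coord (i, j)) (X.coord j)) {i j k i' j' k' : Fin N}
    (h : X.coord i * X.coord j * X.coord k = X.coord i' * X.coord j' * X.coord k') :
    ∑ p : Fin N × Fin N × Fin N,
      minTmul (G.coord (i, p.1) * G.coord (j, p.2.1) * G.coord (k, p.2.2) -
        G.coord (i', p.1) * G.coord (j', p.2.1) * G.coord (k', p.2.2)) (word₃ X.coord p) = 0 := by
  simp only [minTmul_sub, Finset.sum_sub_distrib]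
  rw [← coaction_mul_mul hΦ, ← coaction_mul_mul hΦ, h, sub_self]

/-- In $\Phi(x_i^2)=1/N$ the diagonal terms already give $\frac1N\sum_k u_{ik}^2=\frac1N$, so the
off-diagonal ones sum to zero. -/
theorem sum_word₂_of_cubeSq
    (hΦ : ∀ i, Φ (X.coord i) = ∑ j, minTmul (G.coord (i, j)) (X.coord j)) (hG : Orth G.coord)
    (hX : CubeSq X.coord) (i : Fin N) :
    ∑ p : Fin N × Fin N, minTmul (if p.1 = p.2 then 0 else
      G.coord (i, p.1) * G.coord (i, p.2)) (word₂ X.coord p) = 0 := by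
  have h1 : ∑ p : Fin N × Fin N, minTmul (if p.1 = p.2 then
      G.coord (i, p.1) * G.coord (i, p.2) else 0) (word₂ X.coord p) =
      algebraMap ℂ _ (1 / N) := by
    rw [Fintype.sum_prod_type]
    have h2 : ∀ a, ∑ b, minTmul (if a = b then G.coord (i, a) * G.coord (i, b) else 0)
        (word₂ X.coord (a, b)) =
        tensorInl G.C X.C (G.coord (i, a) * G.coord (i, a)) * algebraMap ℂ _ (1 / N) := fun a => by
      rw [Finset.sum_eq_single a]
      · rw [if_pos rfl, word₂, hX a, minTmul_eq, AlgHomClass.commutes]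
      · intro b _ hb
        rw [if_neg hb.symm, minTmul_eq, map_zero, zero_mul]
      · simp
    simp only [h2, ← Finset.sum_mul, ← map_sum, hG.1]
    simp
  have h3 := coaction_mul hΦ i i
  rw [hX i, AlgHomClass.commutes, ← h1, ← sub_eq_zero, ← Finset.sum_sub_distrib] at h3
  rw [← neg_eq_zero, ← h3, ← Finset.sum_neg_distrib]
  refine Finset.sum_congr rfl fun p _ => ?_
  rw [← minTmul_sub]
  by_cases hp : p.1 = p.2
  · rw [if_pos hp, if_pos hp, hp, sub_self]
    simp [minTmul_eq]
  · rw [if_neg hp, if_neg hp, zero_sub]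
    simp [minTmul_eq]

end Coaction

theorem IsQuantumSubgroup.orth {N : ℕ} {G : NCSpace (Fin N × Fin N)}
    (hG : IsQuantumSubgroup G) : Orth G.coord := by
  obtain ⟨⟨φ, hφ⟩, -⟩ := hG
  have h := (isUniversal_freeOrth N).coord.1.map (φ : (freeOrth N).C →ₐ[ℂ] G.C)
  have : (fun i => (φ : (freeOrth N).C →ₐ[ℂ] G.C) ((freeOrth N).coord i)) = G.coord := funext hφ
  rwa [this] at h

/-- The antipode, as an antimultiplicative map. -/
theorem IsQuantumSubgroup.exists_antipode {N : ℕ} {G : NCSpace (Fin N × Fin N)}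
    (hG : IsQuantumSubgroup G) :
    ∃ τ : G.C →+ G.C, (∀ x y, τ (x * y) = τ y * τ x) ∧
      ∀ i j, τ (G.coord (i, j)) = G.coord (j, i) := by
  obtain ⟨-, -, -, S, hS⟩ := hG
  refine ⟨⟨⟨fun x => (S x).unop, by simp⟩, fun x y => by simp⟩, fun x y => ?_, fun i j => ?_⟩
  · exact (congrArg MulOpposite.unop (map_mul S x y)).trans (MulOpposite.unop_mul _ _)
  · exact congrArg MulOpposite.unop (hS i j)

/-! ### Relations forced on a quantum group by its action. -/

section Maximal

variable {N : ℕ} {G : NCSpace (Fin N × Fin N)}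

/-- Slicing the image of $x_ix_j=x_jx_i$ gives $[u_{ia},u_{jb}]+[u_{ib},u_{ja}]=0$. The antipode,
applied to the identity with rows and columns exchanged, gives $-[u_{ia},u_{jb}]+[u_{ib},u_{ja}]=0$.
The difference is $2[u_{ia},u_{jb}]=0$. The half-liberated and twisted cases use the same device. -/
theorem commRel_of_actsOn (hN : 1 ≤ N) (hG : IsQuantumSubgroup G)
    (hA : ActsOn G (classicalSphere N)) : CommRel G.coord := by
  obtain ⟨τ, hmul, hτ⟩ := hG.exists_antipode
  obtain ⟨Φ, hΦ⟩ := hA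
  have h1 : ∀ i j a b, (G.coord (i, a) * G.coord (j, b) - G.coord (j, a) * G.coord (i, b)) +
      (G.coord (i, b) * G.coord (j, a) - G.coord (j, b) * G.coord (i, a)) = 0 := fun i j a b =>
    add_eq_zero_of_sum_minTmul
      (sum_word₂_of_mul_eq hΦ ((isUniversal_classicalSphere N).coord.2 i j)) (a, b) (b, a)
      fun c hc => classicalSphere_word₂' hN hc a b
  rintro ⟨i, a⟩ ⟨j, b⟩
  have h2 := congrArg τ (h1 a b i j)
  simp only [map_add, map_sub, hmul, hτ, map_zero] at h2
  rw [← sub_eq_zero]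
  refine add_self_eq_zero_of_algebra ?_
  have h3 := congrArg₂ (· - ·) (h1 i j a b) h2
  simp only [sub_zero] at h3
  rw [← h3]
  abel

theorem halfRel_of_actsOn (hN : 1 ≤ N) (hG : IsQuantumSubgroup G)
    (hA : ActsOn G (halfSphere N)) : HalfRel G.coord := by
  obtain ⟨τ, hmul, hτ⟩ := hG.exists_antipode
  obtain ⟨Φ, hΦ⟩ := hA
  have h1 : ∀ i j k a b d, (G.coord (i, a) * G.coord (j, b) * G.coord (k, d) -
      G.coord (k, a) * G.coord (j, b) * G.coord (i, d)) +
      (G.coord (i, d) * G.coord (j, b) * G.coord (k, a) -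
      G.coord (k, d) * G.coord (j, b) * G.coord (i, a)) = 0 := fun i j k a b d =>
    add_eq_zero_of_sum_minTmul
      (sum_word₃_of_mul_eq hΦ ((isUniversal_halfSphere N).coord.2 i j k)) (a, b, d) (d, b, a)
      fun c hc => halfSphere_word₃ hN hc a b d
  rintro ⟨i, a⟩ ⟨j, b⟩ ⟨k, d⟩
  have h2 := congrArg τ (h1 a b d i j k)
  simp only [map_add, map_sub, hmul, hτ, map_zero, ← mul_assoc] at h2
  rw [← sub_eq_zero]
  refine add_self_eq_zero_of_algebra ?_
  have h3 := congrArg₂ (· - ·) (h1 i j k a b d) h2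
  simp only [sub_zero] at h3
  rw [← h3]
  abel

theorem twistedRel_of_actsOn (hG : IsQuantumSubgroup G)
    (hA : ActsOn G (cube (cubeGroup N))) : TwistedRel G.coord := by
  obtain ⟨τ, hmul, hτ⟩ := hG.exists_antipode
  obtain ⟨Φ, hΦ⟩ := hA
  have hX := isUniversal_cube_cubeGroup (N := N) |>.coord
  have h1 : ∀ i j a b, a ≠ b →
      (G.coord (i, a) * G.coord (j, b) - G.coord (j, a) * G.coord (i, b)) +
      (G.coord (i, b) * G.coord (j, a) - G.coord (j, b) * G.coord (i, a)) = 0 :=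
    fun i j a b hab => add_eq_zero_of_sum_minTmul
      (sum_word₂_of_mul_eq hΦ (hX.2 i j)) (a, b) (b, a)
      fun c hc => cube_cubeGroup_word₂ hc hab
  -- Anticommutation on rows comes from $x_i^2=1/N$, that on columns from the antipode.
  have hrow : ∀ i a b, a ≠ b → G.coord (i, a) * G.coord (i, b) +
      G.coord (i, b) * G.coord (i, a) = 0 := fun i a b hab => by
    have := add_eq_zero_of_sum_minTmul (sum_word₂_of_cubeSq hΦ hG.orth hX.1 i) (a, b) (b, a)
      fun c hc => cube_cubeGroup_word₂ hc hab
    simpa only [if_neg hab, if_neg hab.symm] using this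
  refine ⟨?_, ?_⟩
  · rintro ⟨i, a⟩ ⟨j, b⟩ hne (h | h)
    · obtain rfl : i = j := h
      rw [← add_eq_zero_iff_eq_neg]
      exact hrow i a b fun hab => hne (by rw [hab])
    · obtain rfl : a = b := h
      have := congrArg τ (hrow a i j fun hij => hne (by rw [hij]))
      simp only [map_add, hmul, hτ, map_zero] at this
      rw [← add_eq_zero_iff_eq_neg, add_comm]
      exact this
  · rintro ⟨i, a⟩ ⟨j, b⟩ hl
    simp only [SameLine, not_or] at hl
    have h2 := congrArg τ (h1 a b i j hl.1)
    simp only [map_add, map_sub, hmul, hτ, map_zero] at h2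
    rw [← sub_eq_zero]
    refine add_self_eq_zero_of_algebra ?_
    have h3 := congrArg₂ (· - ·) (h1 i j a b hl.2) h2
    simp only [sub_zero] at h3
    rw [← h3]
    abel

theorem cubicRel_of_rows (hG : IsQuantumSubgroup G)
    (h : ∀ i a b, a ≠ b → G.coord (i, a) * G.coord (i, b) = 0) : CubicRel G.coord := by
  obtain ⟨τ, hmul, hτ⟩ := hG.exists_antipode
  rintro ⟨i, a⟩ ⟨j, b⟩ hne (hl | hl)
  · obtain rfl : i = j := hl
    exact h i a b fun hab => hne (by rw [hab])
  · obtain rfl : a = b := hl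
    have := congrArg τ (h a j i fun hij => hne (by rw [hij]))
    simpa only [hmul, hτ, map_zero] using this

theorem cubicRel_of_actsOn_freeGroup (hG : IsQuantumSubgroup G)
    (hA : ActsOn G (cube (freeGroup N))) : CubicRel G.coord := by
  obtain ⟨Φ, hΦ⟩ := hA
  refine cubicRel_of_rows hG fun i a b hab => ?_
  have := eq_zero_of_sum_minTmul
    (sum_word₂_of_cubeSq hΦ hG.orth isUniversal_cube_freeGroup.coord i) (a, b)
    fun c hc => cube_freeGroup_word₂ hc hab
  simpa only [if_neg hab] using this

theorem cubicRel_of_actsOn_halfGroup (hG : IsQuantumSubgroup G)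
    (hA : ActsOn G (cube (halfGroup N))) : CubicRel G.coord := by
  obtain ⟨Φ, hΦ⟩ := hA
  refine cubicRel_of_rows hG fun i a b hab => ?_
  have := eq_zero_of_sum_minTmul
    (sum_word₂_of_cubeSq hΦ hG.orth isUniversal_cube_halfGroup.coord.1 i) (a, b)
    fun c hc => cube_halfGroup_word₂ hc hab
  simpa only [if_neg hab] using this

/-- On the cube only words with distinct consecutive letters can be sliced, so the antipode trick
gives $abc=cba$ only when $b$ is on no line with $a$ or $c$. If $b$ shares a line with a distinct
neighbor, both products vanish by the cubic relations. What remains is that squares of entries are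
central, which is extracted from the words $x_ax_bx_a$. -/
theorem halfRel_of_actsOn_halfGroup (hG : IsQuantumSubgroup G)
    (hA : ActsOn G (cube (halfGroup N))) : HalfRel G.coord := by
  have hcub := cubicRel_of_actsOn_halfGroup hG hA
  obtain ⟨τ, hmul, hτ⟩ := hG.exists_antipode
  obtain ⟨Φ, hΦ⟩ := hA
  have hrow : ∀ i a b, a ≠ b → G.coord (i, a) * G.coord (i, b) = 0 := fun i a b hab =>
    hcub _ _ (by simpa using hab) (Or.inl rfl)
  have hcol : ∀ i j a, i ≠ j → G.coord (i, a) * G.coord (j, a) = 0 := fun i j a hij =>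
    hcub _ _ (by simpa using hij) (Or.inr rfl)
  have h1 : ∀ i j k a b d, a ≠ b → b ≠ d →
      (G.coord (i, a) * G.coord (j, b) * G.coord (k, d) -
      G.coord (k, a) * G.coord (j, b) * G.coord (i, d)) +
      (G.coord (i, d) * G.coord (j, b) * G.coord (k, a) -
      G.coord (k, d) * G.coord (j, b) * G.coord (i, a)) = 0 := fun i j k a b d hab hbd =>
    add_eq_zero_of_sum_minTmul
      (sum_word₃_of_mul_eq hΦ (isUniversal_cube_halfGroup.coord.2 i j k)) (a, b, d) (d, b, a)
      fun c hc => cube_halfGroup_word₃ hc hab hbd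
  have h2 : ∀ i j k a b d, i ≠ j → j ≠ k → a ≠ b → b ≠ d →
      G.coord (i, a) * G.coord (j, b) * G.coord (k, d) =
        G.coord (k, d) * G.coord (j, b) * G.coord (i, a) := by
    intro i j k a b d hij hjk hab hbd
    have h2 := congrArg τ (h1 a b d i j k hij hjk)
    simp only [map_add, map_sub, hmul, hτ, map_zero, ← mul_assoc] at h2
    rw [← sub_eq_zero]
    refine add_self_eq_zero_of_algebra ?_
    have h3 := congrArg₂ (· - ·) (h1 i j k a b d hab hbd) h2
    simp only [sub_zero] at h3
    rw [← h3]
    abel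
  have h3 : ∀ i j k a b, a ≠ b → G.coord (i, a) * G.coord (j, b) * G.coord (k, a) =
      G.coord (k, a) * G.coord (j, b) * G.coord (i, a) := by
    intro i j k a b hab
    have := h1 i j k a b a hab hab.symm
    have := add_self_eq_zero_of_algebra this
    rwa [sub_eq_zero] at this
  have h4 : ∀ i j a b d, i ≠ j → G.coord (i, a) * G.coord (j, b) * G.coord (i, d) =
      G.coord (i, d) * G.coord (j, b) * G.coord (i, a) := by
    intro i j a b d hij
    have := congrArg τ (h3 a b d i j hij)
    simp only [hmul, hτ, ← mul_assoc] at this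
    exact this.symm
  -- By `h4` the outer entries of $u_{ia}u_{jb}u_{id}$ may be exchanged, which places $u_{ia}$ next
  -- to $u_{id}$.
  have h5 : ∀ i j a b d, i ≠ j → a ≠ d →
      G.coord (i, a) * G.coord (i, a) * G.coord (j, b) * (G.coord (i, d) * G.coord (i, d)) = 0 := by
    intro i j a b d hij had
    calc _ = G.coord (i, a) * (G.coord (i, a) * G.coord (j, b) * G.coord (i, d)) *
        G.coord (i, d) := by simp only [mul_assoc]
      _ = (G.coord (i, a) * G.coord (i, d)) * (G.coord (j, b) * G.coord (i, a) *
        G.coord (i, d)) := by rw [h4 i j a b d hij]; simp only [mul_assoc]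
      _ = 0 := by rw [hrow i a d had, zero_mul]
  -- Inserting $\sum_d u_{id}^2=1$ on either side, `h5` leaves $u_{ia}^2u_{jb}u_{ia}^2$ in both
  -- cases.
  have h6 : ∀ i j a b, i ≠ j → G.coord (i, a) * G.coord (i, a) * G.coord (j, b) =
      G.coord (j, b) * (G.coord (i, a) * G.coord (i, a)) := by
    intro i j a b hij
    have hr : G.coord (i, a) * G.coord (i, a) * G.coord (j, b) =
        G.coord (i, a) * G.coord (i, a) * G.coord (j, b) *
          (G.coord (i, a) * G.coord (i, a)) := by
      conv_lhs => rw [← mul_one (_ * _ * _), ← if_pos (rfl : i = i) (α := G.C) (t := 1) (e := 0),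
        ← hG.orth.1 i i, Finset.mul_sum]
      refine Finset.sum_eq_single a (fun d _ hd => h5 i j a b d hij hd.symm) (by simp)
    have hl : G.coord (j, b) * (G.coord (i, a) * G.coord (i, a)) =
        G.coord (i, a) * G.coord (i, a) * G.coord (j, b) *
          (G.coord (i, a) * G.coord (i, a)) := by
      conv_lhs => rw [← one_mul (_ * _), ← if_pos (rfl : i = i) (α := G.C) (t := 1) (e := 0),
        ← hG.orth.1 i i, Finset.sum_mul]
      refine (Finset.sum_eq_single a (fun d _ hd => ?_) (by simp)).trans (by simp only [mul_assoc])
      rw [← mul_assoc]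
      exact h5 i j d b a hij hd
    rw [hr, hl]
  have h7 : ∀ i j a b, G.coord (i, a) * G.coord (i, a) * G.coord (j, b) =
      G.coord (j, b) * G.coord (i, a) * G.coord (i, a) := by
    intro i j a b
    by_cases hij : i = j
    · subst hij
      by_cases hab : a = b
      · rw [hab]
      · rw [mul_assoc, hrow i a b hab, hrow i b a (Ne.symm hab), mul_zero, zero_mul]
    · rw [h6 i j a b hij, mul_assoc]
  have h8 : ∀ i j k a b d, (i = j ∨ a = b) →
      G.coord (i, a) * G.coord (j, b) * G.coord (k, d) =
        G.coord (k, d) * G.coord (j, b) * G.coord (i, a) := by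
    intro i j k a b d h
    by_cases hij : i = j
    · by_cases hab : a = b
      · rw [hij, hab, h7]
      · rw [hij, hrow j a b hab, mul_assoc, hrow j b a (Ne.symm hab), zero_mul, mul_zero]
    · rw [h.resolve_left hij, hcol i j b hij, mul_assoc, hcol j i b (Ne.symm hij), zero_mul,
        mul_zero]
  rintro ⟨i, a⟩ ⟨j, b⟩ ⟨k, d⟩
  by_cases hij : i = j ∨ a = b
  · exact h8 i j k a b d hij
  by_cases hjk : k = j ∨ d = b
  · exact (h8 k j i d b a hjk).symm
  rw [not_or] at hij hjk
  exact h2 i j k a b d hij.1 (Ne.symm hjk.1) hij.2 (Ne.symm hjk.2)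

theorem inftyRel_of_actsOn (hN : 1 ≤ N) (hN2 : N ≠ 2) (hG : IsQuantumSubgroup G)
    (hA : ActsOn G (sphereInfty N)) : InftyRel G.coord := by
  obtain ⟨Φ, hΦ⟩ := hA
  rcases (by omega : N = 1 ∨ 3 ≤ N) with rfl | hN3
  · intro a b c hac
    exact absurd (Subsingleton.elim a c) hac
  have hX : ∀ i j, (sphereInfty N).coord i * (sphereInfty N).coord i * (sphereInfty N).coord j =
      (sphereInfty N).coord j * (sphereInfty N).coord i * (sphereInfty N).coord i :=
    (isUniversal_sphereInfty N).coord.2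
  have h1 : ∀ i j a b d, a ≠ b → b ≠ d → G.coord (i, a) * G.coord (i, b) * G.coord (j, d) =
      G.coord (j, a) * G.coord (i, b) * G.coord (i, d) := fun i j a b d hab hbd => by
    rw [← sub_eq_zero]
    exact eq_zero_of_sum_minTmul (sum_word₃_of_mul_eq hΦ (hX i j)) (a, b, d)
      fun c hc => (sphereInfty_word₃ hN hc).1 a b d hab hbd
  have h2 : ∀ i j a b, (G.coord (i, a) * G.coord (i, a) * G.coord (j, b) -
      G.coord (j, a) * G.coord (i, a) * G.coord (i, b)) +
      (G.coord (i, b) * G.coord (i, a) * G.coord (j, a) -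
      G.coord (j, b) * G.coord (i, a) * G.coord (i, a)) = 0 := fun i j a b =>
    add_eq_zero_of_sum_minTmul (sum_word₃_of_mul_eq hΦ (hX i j)) (a, a, b) (b, a, a)
      fun c hc => (sphereInfty_word₃ hN hc).2 a b
  have h3 : ∀ i j a, G.coord (i, a) * G.coord (i, a) * G.coord (j, a) =
      G.coord (j, a) * G.coord (i, a) * G.coord (i, a) := fun i j a => by
    rw [← sub_eq_zero]
    exact add_self_eq_zero_of_algebra (h2 i j a a)
  -- Multiply `h1` by $u_{jd}$ on the right and sum over $d$. Orthogonality turns the full sum into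
  -- $u_{ia}u_{ib}$, and the terms with $d\ne b$ vanish, so only $d=b$ is left. The result is
  -- antisymmetric in $i,j$, which is `h5`.
  have h4 : ∀ i j a b, i ≠ j → a ≠ b → G.coord (i, a) * G.coord (i, b) =
      G.coord (i, a) * G.coord (i, b) * (G.coord (j, b) * G.coord (j, b)) -
        G.coord (j, a) * G.coord (j, b) * (G.coord (i, b) * G.coord (i, b)) := by
    intro i j a b hij hab
    have h5 : ∑ d, (G.coord (i, a) * G.coord (i, b) * (G.coord (j, d) * G.coord (j, d)) -
        G.coord (j, a) * G.coord (i, b) * (G.coord (i, d) * G.coord (j, d))) =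
        G.coord (i, a) * G.coord (i, b) := by
      rw [Finset.sum_sub_distrib, ← Finset.mul_sum, ← Finset.mul_sum, hG.orth.1, hG.orth.1,
        if_pos rfl, if_neg hij, mul_one, mul_zero, sub_zero]
    refine h5.symm.trans ((Finset.sum_eq_single b (fun d _ hd => ?_) (by simp)).trans ?_)
    · rw [← mul_assoc, ← mul_assoc, h1 i j a b d hab hd.symm, sub_self]
    · have h6 : G.coord (i, b) * (G.coord (i, b) * G.coord (j, b)) =
          G.coord (j, b) * (G.coord (i, b) * G.coord (i, b)) := by
        rw [← mul_assoc, h3, mul_assoc]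
      rw [mul_assoc (G.coord (j, a)), h6, ← mul_assoc (G.coord (j, a))]
  have h5 : ∀ i j a b, i ≠ j → a ≠ b → G.coord (i, a) * G.coord (i, b) +
      G.coord (j, a) * G.coord (j, b) = 0 := by
    intro i j a b hij hab
    exact (congrArg₂ (· + ·) (h4 i j a b hij hab) (h4 j i a b hij.symm hab)).trans (by abel)
  -- For three distinct rows, the elements $y_i=u_{ia}u_{ib}$ are pairwise opposite, so
  -- $2y_i=(y_i+y_j)+(y_i+y_k)-(y_j+y_k)=0$. This is where $N\ge3$ is needed.
  have hrow : ∀ i a b, a ≠ b → G.coord (i, a) * G.coord (i, b) = 0 := by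
    intro i a b hab
    obtain ⟨j, hj, k, hk, hjk⟩ : ∃ j, j ≠ i ∧ ∃ k, k ≠ i ∧ j ≠ k := by
      have : 1 < (Finset.univ.erase i).card := by
        rw [Finset.card_erase_of_mem (Finset.mem_univ i), Finset.card_univ, Fintype.card_fin]
        omega
      obtain ⟨j, hj, k, hk, hjk⟩ := Finset.one_lt_card.mp this
      exact ⟨j, Finset.ne_of_mem_erase hj, k, Finset.ne_of_mem_erase hk, hjk⟩
    refine add_self_eq_zero_of_algebra ?_
    have e1 := h5 i j a b hj.symm hab
    have e2 := h5 i k a b hk.symm hab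
    have e3 := h5 j k a b hjk hab
    have e4 : G.coord (i, a) * G.coord (i, b) + G.coord (i, a) * G.coord (i, b) =
        (G.coord (i, a) * G.coord (i, b) + G.coord (j, a) * G.coord (j, b)) +
        (G.coord (i, a) * G.coord (i, b) + G.coord (k, a) * G.coord (k, b)) -
        (G.coord (j, a) * G.coord (j, b) + G.coord (k, a) * G.coord (k, b)) := by abel
    rw [e4, e1, e2, e3, add_zero, sub_zero]
  have hcub := cubicRel_of_rows hG hrow
  have hsq : SqCentral G.coord := by
    rintro ⟨i, a⟩ ⟨j, b⟩
    by_cases hab : a = b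
    · rw [← hab]; exact h3 i j a
    · have := h2 i j a b
      rw [mul_assoc (G.coord (j, a)), hrow i a b hab, hrow i b a (Ne.symm hab), mul_zero, zero_mul,
        sub_zero, zero_sub, ← sub_eq_add_neg, sub_eq_zero] at this
      exact this
  intro a b c hac hl
  -- By the C*-identity it suffices that $abc\,cba=0$. Moving $c^2$ past $b$ makes $ac$ appear,
  -- which vanishes.
  rw [← CStarRing.mul_star_self_eq_zero_iff, star_mul, star_mul, (G.selfAdjoint a).star_eq,
    (G.selfAdjoint b).star_eq, (G.selfAdjoint c).star_eq]
  calc G.coord a * G.coord b * G.coord c * (G.coord c * (G.coord b * G.coord a))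
      = G.coord a * (G.coord b * G.coord c * G.coord c) * (G.coord b * G.coord a) := by
        simp only [mul_assoc]
    _ = G.coord a * (G.coord c * G.coord c * G.coord b) * (G.coord b * G.coord a) := by
        rw [hsq c b]
    _ = G.coord a * G.coord c * (G.coord c * G.coord b * (G.coord b * G.coord a)) := by
        simp only [mul_assoc]
    _ = 0 := by rw [hcub a c hac hl, zero_mul]

end Maximal

/-! ### The spheres associated to reflection groups -/

section Associated

variable {N : ℕ} {D : Type} [Ring D]

/-- The normalized relations of a reflection group. -/
def AssocRel (G : ReflectionGroup N) (f : Fin N → D) : Prop :=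
  ∀ v w : List (Fin N), v.Perm w → (v.map G.g).prod = (w.map G.g).prod →
    (v.map f).prod = (w.map f).prod

theorem isUniversal_associatedSphere (G : ReflectionGroup N) :
    IsUniversal (associatedSphere G) fun _ _ _ f => SumSq f ∧ AssocRel G f :=
  isUniversal_sphereSub (Q := fun _ _ _ f => AssocRel G f) fun D _ f => by
    have h1 : ∀ v : List (Fin N), FreeAlgebra.lift ℂ f (v.map letter).prod = (v.map f).prod :=
      fun v => by
        rw [map_list_prod, List.map_map]
        congr 2
        funext i
        simp
    constructor
    · rintro h r ⟨v, w, hvw, hg, rfl⟩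
      rw [map_sub, h1, h1, h v w hvw hg, sub_self]
    · intro h v w hvw hg
      have := h _ ⟨v, w, hvw, hg, rfl⟩
      rwa [map_sub, h1, h1, sub_eq_zero] at this

theorem prod_map_eq_of_perm {f : Fin N → D} (hf : CommRel f) {v w : List (Fin N)}
    (h : v.Perm w) : (v.map f).prod = (w.map f).prod := by
  refine (h.map f).prod_eq' ?_
  rw [List.pairwise_map]
  exact List.pairwise_of_forall fun i j => hf i j

theorem CommRel.assocRel (G : ReflectionGroup N) {f : Fin N → D} (hf : CommRel f) :
    AssocRel G f := fun _ _ h _ => prod_map_eq_of_perm hf h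

theorem AssocRel.commRel {f : Fin N → D} (hf : AssocRel (cubeGroup N) f) : CommRel f :=
  fun i j => by
    simpa using hf [i, j] [j, i] (List.Perm.swap _ _ _) (by simpa using cubeGroup_rel i j)

theorem perm_triple (i j k : Fin N) : [i, j, k].Perm [k, j, i] :=
  (List.reverse_perm [k, j, i])

theorem AssocRel.halfRel {f : Fin N → D} (hf : AssocRel (halfGroup N) f) : HalfRel f :=
  fun i j k => by
    simpa [mul_assoc] using hf [i, j, k] [k, j, i] (perm_triple i j k)
      (by simpa [mul_assoc] using halfGroup_rel i j k)

theorem AssocRel.sqCentral {f : Fin N → D} (hf : AssocRel (freeGroup N) f) : SqCentral f :=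
  fun i j => by
    have h1 := (freeGroup N).sq i
    simpa [mul_assoc] using hf [i, i, j] [j, i, i] (perm_triple i i j)
      (by simp only [List.map_cons, List.map_nil, List.prod_cons, List.prod_nil, mul_one]
          rw [← mul_assoc, h1, one_mul, mul_one])

/-- The letters in even and in odd position. -/
def altSplit : List (Fin N) → List (Fin N) × List (Fin N)
  | [] => ([], [])
  | a :: l => (a :: (altSplit l).2, (altSplit l).1)

theorem count_altSplit (j : Fin N) (l : List (Fin N)) :
    l.count j = (altSplit l).1.count j + (altSplit l).2.count j := by
  induction l with
  | nil => rfl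
  | cons a l ih => simp only [altSplit, List.count_cons, ih]; omega

/-- Half-commutation lets a letter jump two places, so a letter of `(altSplit w).1` can be brought
to the front. Removing it shifts the other positions by one, whence the exchange of the two halves
of the split. -/
theorem HalfRel.exists_cons {f : Fin N → D} (hf : HalfRel f) (a : Fin N) :
    ∀ w : List (Fin N), a ∈ (altSplit w).1 → ∃ w', (w.map f).prod = f a * (w'.map f).prod ∧
      (altSplit w).1.Perm (a :: (altSplit w').2) ∧ (altSplit w).2.Perm (altSplit w').1
  | [], h => by simp [altSplit] at h
  | [b], h => by
    obtain rfl : a = b := by simpa [altSplit] using h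
    exact ⟨[], by simp, List.Perm.refl _, List.Perm.refl _⟩
  | b :: c :: w, h => by
    by_cases hab : a = b
    · subst hab
      exact ⟨c :: w, by simp, List.Perm.refl _, List.Perm.refl _⟩
    · obtain ⟨w', h1, h2, h3⟩ := hf.exists_cons a w
        ((List.mem_cons.mp h).resolve_left hab)
      refine ⟨c :: b :: w', ?_, ?_, ?_⟩
      · simp only [List.map_cons, List.prod_cons, h1]
        have := congrArg (· * (w'.map f).prod) (hf b c a)
        simpa only [mul_assoc] using this
      · exact (h2.cons b).trans (List.Perm.swap _ _ _)
      · exact h3.cons c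

theorem HalfRel.prod_eq {f : Fin N → D} (hf : HalfRel f) (v : List (Fin N)) :
    ∀ w, (altSplit v).1.Perm (altSplit w).1 → (altSplit v).2.Perm (altSplit w).2 →
      (v.map f).prod = (w.map f).prod := by
  induction v with
  | nil =>
    intro w h _
    cases w with
    | nil => rfl
    | cons a w => simp [altSplit] at h
  | cons a v ih =>
    intro w h1 h2
    obtain ⟨w', h3, h4, h5⟩ := hf.exists_cons a w (h1.subset (List.mem_cons_self))
    rw [h3, List.map_cons, List.prod_cons, ih w' (h2.trans h5) ((h1.trans h4).cons_inv)]

/-- The inverse permutation is used because prepending a letter to the word then means applying its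
zigzag first, so that the induction hypothesis applies at the translated point. -/
theorem zigzag_prod_symm {A : Type} [AddCommGroup A] {θ : Fin N → A}
    {ψ : (halfGroup N).Γ →* Equiv.Perm (A × Bool)}
    (hψ : ∀ i, ψ ((halfGroup N).g i) = zigzag (θ i)) (l : List (Fin N)) : ∀ n,
    ((ψ (l.map (halfGroup N).g).prod).symm (n, true)).1 =
        n + ((altSplit l).1.map θ).sum - ((altSplit l).2.map θ).sum ∧
      ((ψ (l.map (halfGroup N).g).prod).symm (n, false)).1 =
        n - ((altSplit l).1.map θ).sum + ((altSplit l).2.map θ).sum := by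
  have hs : ∀ z : A, (zigzag z).symm = zigzag z := fun z => rfl
  induction l with
  | nil => intro n; simp [altSplit]; exact ⟨rfl, rfl⟩
  | cons a l ih =>
    intro n
    have h1 : (ψ ((a :: l).map (halfGroup N).g).prod).symm =
        (zigzag (θ a)).trans (ψ (l.map (halfGroup N).g).prod).symm := by
      rw [List.map_cons, List.prod_cons, map_mul, hψ]
      exact congrArg (fun e => Equiv.trans e _) (hs (θ a))
    rw [h1]
    simp only [Equiv.trans_apply, zigzag_true, zigzag_false, altSplit, List.map_cons,
      List.sum_cons, (ih _).1, (ih _).2]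
    constructor <;> abel

/-- With weights the basis vectors of $\mathbb Z^N$, the group element determines, for each letter,
the difference of its numbers of occurrences in the two halves of `altSplit`. The permutation
hypothesis gives their sum, so both numbers agree for the two words and `HalfRel.prod_eq` applies.
-/
theorem HalfRel.assocRel {f : Fin N → D} (hf : HalfRel f) : AssocRel (halfGroup N) f := by
  intro v w hvw hg
  let θ : Fin N → Fin N → ℤ := fun i => Pi.single i 1
  have hθ : ∀ (l : List (Fin N)) (j : Fin N), (l.map θ).sum j = l.count j := by
    intro l j
    induction l with
    | nil => simp
    | cons a l ih =>
      rw [List.map_cons, List.sum_cons, Pi.add_apply, ih, List.count_cons]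
      by_cases haj : a = j
      · subst haj; simp [θ, add_comm]
      · simp [θ, haj, Ne.symm haj]
  obtain ⟨ψ, hψ⟩ := exists_zigzag θ
  have h1 := (zigzag_prod_symm hψ v 0).1
  rw [hg, (zigzag_prod_symm hψ w 0).1] at h1
  have h2 : ∀ j, (altSplit v).1.count j = (altSplit w).1.count j ∧
      (altSplit v).2.count j = (altSplit w).2.count j := fun j => by
    have h3 := congrFun h1 j
    simp only [Pi.sub_apply, Pi.add_apply, hθ] at h3
    have h4 := hvw.count_eq j
    rw [count_altSplit j v, count_altSplit j w] at h4
    omega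
  exact hf.prod_eq v w (List.perm_iff_count.mpr fun j => (h2 j).1)
    (List.perm_iff_count.mpr fun j => (h2 j).2)

/-- Left multiplication of a reduced word by a letter. -/
def push (a : Fin N) : List (Fin N) → List (Fin N)
  | [] => [a]
  | b :: l => if a = b then l else a :: b :: l

theorem isChain_push (a : Fin N) {l : List (Fin N)} (hl : l.IsChain (· ≠ ·)) :
    (push a l).IsChain (· ≠ ·) := by
  cases l with
  | nil => simp [push]
  | cons b l =>
    simp only [push]
    split_ifs with h
    · exact hl.tail
    · exact List.isChain_cons_cons.mpr ⟨h, hl⟩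

theorem push_push (a : Fin N) {l : List (Fin N)} (hl : l.IsChain (· ≠ ·)) :
    push a (push a l) = l := by
  cases l with
  | nil => simp [push]
  | cons b l =>
    simp only [push]
    split_ifs with h
    · subst h
      cases l with
      | nil => simp
      | cons c l => simp [(List.isChain_cons_cons.mp hl).1]
    · simp

/-- The reduced form of a word. -/
def reduce (v : List (Fin N)) : List (Fin N) := v.foldr push []

/-- Van der Waerden's argument: the free product acts on the set of reduced words, and the reduced
form of a word is its image of the empty word. -/
theorem reduce_eq_of_prod_eq {v w : List (Fin N)}
    (h : (v.map (freeGroup N).g).prod = (w.map (freeGroup N).g).prod) : reduce v = reduce w := by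
  let W := {l : List (Fin N) // l.IsChain (· ≠ ·)}
  let e : Fin N → Equiv.Perm W := fun a =>
    Function.Involutive.toPerm (fun l => ⟨push a l.1, isChain_push a l.2⟩)
      fun l => Subtype.ext (push_push a l.2)
  obtain ⟨ψ, hψ⟩ := freeGroup_lift e fun a => by
    ext1 l
    exact Subtype.ext (push_push a l.2)
  have key : ∀ v : List (Fin N), (ψ (v.map (freeGroup N).g).prod ⟨[], by simp⟩).1 = reduce v := by
    intro v
    induction v with
    | nil => simp [reduce]
    | cons a v ih =>
      rw [List.map_cons, List.prod_cons, map_mul, hψ, Equiv.Perm.mul_apply]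
      change push a _ = _
      rw [ih]
      rfl
  rw [← key, ← key, h]

theorem SqCentral.commute {f : Fin N → D} (hf : SqCentral f) (i j : Fin N) :
    Commute (f j) (f i * f i) := by
  have := hf i j
  rw [mul_assoc (f j)] at this
  exact this.symm

/-- Each cancellation during reduction produces a square, which moves to the front since it is
central. The list `s` records the cancelled letters, each used twice in `v`. -/
theorem SqCentral.exists_reduce {f : Fin N → D} (hf : SqCentral f) (v : List (Fin N)) :
    ∃ s : List (Fin N), (v.map f).prod =
        (s.map fun i => f i * f i).prod * ((reduce v).map f).prod ∧
      v.Perm (s ++ s ++ reduce v) := by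
  induction v with
  | nil => exact ⟨[], by simp [reduce], by simp [reduce]⟩
  | cons a v ih =>
    obtain ⟨s, h1, h2⟩ := ih
    have hc : Commute (f a) (s.map fun i => f i * f i).prod := by
      refine Commute.list_prod_right _ _ fun x hx => ?_
      obtain ⟨i, -, rfl⟩ := List.mem_map.mp hx
      exact hf.commute i a
    have hr : reduce (a :: v) = push a (reduce v) := rfl
    have h3 : ((a :: v).map f).prod =
        (s.map fun i => f i * f i).prod * (f a * ((reduce v).map f).prod) := by
      rw [List.map_cons, List.prod_cons, h1, ← mul_assoc, hc.eq, mul_assoc]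
    have h4 : (a :: v).Perm (s ++ s ++ a :: reduce v) :=
      (h2.cons a).trans List.perm_middle.symm
    rw [hr, h3]
    rcases hv : reduce v with _ | ⟨b, l⟩
    · exact ⟨s, by simp [push], by rw [hv] at h4; exact h4⟩
    · by_cases hab : a = b
      · subst hab
        refine ⟨a :: s, ?_, ?_⟩
        · simp only [push, if_true, List.map_cons, List.prod_cons]
          rw [← mul_assoc (f a) (f a), ← mul_assoc,
            ((hc.mul_left hc).eq : f a * f a * _ = _ * (f a * f a))]
        · rw [hv] at h4
          refine h4.trans (List.perm_iff_count.mpr fun j => ?_)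
          simp only [push, if_true, List.count_append, List.count_cons]
          omega
      · refine ⟨s, by simp [push, hab], ?_⟩
        rw [hv] at h4
        simpa only [push, if_neg hab] using h4

theorem SqCentral.assocRel {f : Fin N → D} (hf : SqCentral f) : AssocRel (freeGroup N) f := by
  intro v w hvw hg
  obtain ⟨s, h1, h2⟩ := hf.exists_reduce v
  obtain ⟨t, h3, h4⟩ := hf.exists_reduce w
  rw [reduce_eq_of_prod_eq hg] at h1 h2
  -- Both words have the same letters and the same reduced form, so twice the count of each letter
  -- in `s` and in `t` agree.
  have hst : s.Perm t := List.perm_iff_count.mpr fun j => by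
    have := (h2.symm.trans (hvw.trans h4)).count_eq j
    simp only [List.count_append] at this
    omega
  rw [h1, h3]
  congr 1
  refine prod_map_eq_of_perm (f := fun i => f i * f i) (fun i j => ?_) hst
  exact (((hf.commute j i).mul_left (hf.commute j i)).eq)

end Associated

section SameSpace

theorem IsUniversal.sameSpace {ι : Type} {X Y : NCSpace ι}
    {P Q : ∀ (D : Type) [Ring D] [Algebra ℂ D], (ι → D) → Prop} (hX : IsUniversal X P)
    (hY : IsUniversal Y Q) (h1 : Q X.C X.coord) (h2 : P Y.C Y.coord) : SameSpace X Y :=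
  ⟨hY.le h1, hX.le h2⟩

variable (N : ℕ)

theorem associatedSphere_cubeGroup :
    SameSpace (associatedSphere (cubeGroup N)) (classicalSphere N) :=
  have h1 := (isUniversal_associatedSphere (cubeGroup N)).coord
  have h2 := (isUniversal_classicalSphere N).coord
  (isUniversal_associatedSphere _).sameSpace (isUniversal_classicalSphere N)
    ⟨h1.1, h1.2.commRel⟩ ⟨h2.1, h2.2.assocRel _⟩

theorem associatedSphere_halfGroup :
    SameSpace (associatedSphere (halfGroup N)) (halfSphere N) :=
  have h1 := (isUniversal_associatedSphere (halfGroup N)).coord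
  have h2 := (isUniversal_halfSphere N).coord
  (isUniversal_associatedSphere _).sameSpace (isUniversal_halfSphere N)
    ⟨h1.1, h1.2.halfRel⟩ ⟨h2.1, h2.2.assocRel⟩

theorem associatedSphere_freeGroup :
    SameSpace (associatedSphere (freeGroup N)) (sphereInfty N) :=
  have h1 := (isUniversal_associatedSphere (freeGroup N)).coord
  have h2 := (isUniversal_sphereInfty N).coord
  (isUniversal_associatedSphere _).sameSpace (isUniversal_sphereInfty N)
    ⟨h1.1, h1.2.sqCentral⟩ ⟨h2.1, h2.2.assocRel⟩

/-! ### Algebraicity -/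

variable {N}

/-- The relations `x_i² = 1 / N`. -/
def cubeSqRel (N : ℕ) : Set (FreeAlgebra ℂ (Fin N)) :=
  {r | ∃ i, r = letter i * letter i - algebraMap ℂ _ (1 / N)}

theorem lift_cubeSqRel {D : Type} [CStarAlgebra D] (f : Fin N → D) :
    CubeSq f ↔ ∀ r ∈ cubeSqRel N, FreeAlgebra.lift ℂ f r = 0 := by
  have h1 : ∀ i, FreeAlgebra.lift ℂ f (letter i * letter i - algebraMap ℂ _ (1 / N)) = 0 ↔
      f i * f i = algebraMap ℂ D (1 / N) := fun i => by
    rw [map_sub, map_mul, AlgHom.commutes, FreeAlgebra.lift_ι_apply, sub_eq_zero]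
  constructor
  · rintro h r ⟨i, rfl⟩
    exact (h1 i).mpr (h i)
  · exact fun h i => (h1 i).mp (h _ ⟨i, rfl⟩)

/-- The relations `x_i x_j = x_j x_i`. -/
def commRelSet (N : ℕ) : Set (FreeAlgebra ℂ (Fin N)) :=
  {r | ∃ i j, r = letter i * letter j - letter j * letter i}

theorem lift_commRelSet {D : Type} [CStarAlgebra D] (f : Fin N → D) :
    CommRel f ↔ ∀ r ∈ commRelSet N, FreeAlgebra.lift ℂ f r = 0 := by
  constructor
  · rintro h r ⟨i, j, rfl⟩
    simpa [sub_eq_zero] using h i j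
  · intro h i j
    simpa [sub_eq_zero] using h _ ⟨i, j, rfl⟩

/-- The relations `x_i x_j x_k = x_k x_j x_i`. -/
def halfRelSet (N : ℕ) : Set (FreeAlgebra ℂ (Fin N)) :=
  {r | ∃ i j k, r = letter i * letter j * letter k - letter k * letter j * letter i}

theorem lift_halfRelSet {D : Type} [CStarAlgebra D] (f : Fin N → D) :
    HalfRel f ↔ ∀ r ∈ halfRelSet N, FreeAlgebra.lift ℂ f r = 0 := by
  constructor
  · rintro h r ⟨i, j, k, rfl⟩
    simpa [sub_eq_zero] using h i j k
  · intro h i j k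
    simpa [sub_eq_zero] using h _ ⟨i, j, k, rfl⟩

theorem forall_union {α : Type} {R S : Set α} {p : α → Prop} :
    ((∀ r ∈ R, p r) ∧ ∀ r ∈ S, p r) ↔ ∀ r ∈ R ∪ S, p r :=
  ⟨fun h r hr => hr.elim (h.1 r) (h.2 r),
    fun h => ⟨fun r hr => h r (Or.inl hr), fun r hr => h r (Or.inr hr)⟩⟩

theorem classicalSphere_algebraic : SameSpace (classicalSphere N) (sphereSub N (commRelSet N)) :=
  have hu := isUniversal_sphereSub (R := commRelSet N) (Q := fun _ _ _ f => CommRel f)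
    fun _ _ f => lift_commRelSet f
  (isUniversal_classicalSphere N).sameSpace hu (isUniversal_classicalSphere N).coord hu.coord

theorem cube_cubeGroup_algebraic (hN : 1 ≤ N) :
    SameSpace (cube (cubeGroup N)) (sphereSub N (cubeSqRel N ∪ commRelSet N)) :=
  have hu := isUniversal_sphereSub (R := cubeSqRel N ∪ commRelSet N)
    (Q := fun _ _ _ f => CubeSq f ∧ CommRel f) fun _ _ f => by
      rw [lift_cubeSqRel, lift_commRelSet, forall_union]
  have h := isUniversal_cube_cubeGroup (N := N)
  h.sameSpace hu ⟨h.coord.1.sumSq hN, h.coord⟩ hu.coord.2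

theorem cube_halfGroup_algebraic (hN : 1 ≤ N) :
    SameSpace (cube (halfGroup N)) (sphereSub N (cubeSqRel N ∪ halfRelSet N)) :=
  have hu := isUniversal_sphereSub (R := cubeSqRel N ∪ halfRelSet N)
    (Q := fun _ _ _ f => CubeSq f ∧ HalfRel f) fun _ _ f => by
      rw [lift_cubeSqRel, lift_halfRelSet, forall_union]
  have h := isUniversal_cube_halfGroup (N := N)
  h.sameSpace hu ⟨h.coord.1.sumSq hN, h.coord⟩ hu.coord.2

theorem cube_freeGroup_algebraic (hN : 1 ≤ N) :
    SameSpace (cube (freeGroup N)) (sphereSub N (cubeSqRel N)) :=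
  have hu := isUniversal_sphereSub (R := cubeSqRel N) (Q := fun _ _ _ f => CubeSq f)
    fun _ _ f => lift_cubeSqRel f
  have h := isUniversal_cube_freeGroup (N := N)
  h.sameSpace hu ⟨h.coord.sumSq hN, h.coord⟩ hu.coord.2

end SameSpace

/-! ### The quantum isometry groups -/

section Isometry

variable {N : ℕ}

/-- Non-degeneracy is inherited from the smallest cube, which is contained in all six spaces. The
last hypothesis is the maximality: any group acting satisfies the relations that define `G`. -/
theorem isQuantumIsometryGroup_of_universal {X : NCSpace (Fin N)} {G : NCSpace (Fin N × Fin N)}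
    {P : ∀ (D : Type) [Ring D] [Algebra ℂ D], (Fin N × Fin N → D) → Prop}
    {R : Set (FreeAlgebra ℂ (Fin N))} (hR : SameSpace X (sphereSub N R))
    (hX : cube (cubeGroup N) ≤ X) (hG : IsUniversal G fun D _ _ f => Orth f ∧ P D f)
    (hP : IsGroupRel N P) (hA : ActsOn G X)
    (h : ∀ G' : NCSpace (Fin N × Fin N), IsQuantumSubgroup G' → ActsOn G' X → P G'.C G'.coord) :
    IsQuantumIsometryGroup X G where
  algebraic := ⟨R, hR⟩
  nondegenerate := linearIndependent_of_le hX cube_cubeGroup_linearIndependent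
  isGreatest := ⟨⟨isQuantumSubgroup_of_universal hG hP, hA⟩,
    fun G' hG' => hG.le ⟨hG'.1.orth, h G' hG'.1 hG'.2⟩⟩

end Isometry

/-! ### Lack of inclusions -/

/-- The test for non-inclusion: if $X\subset Y$, every model of the relations of `X` must satisfy
those of `Y`. -/
theorem IsUniversal.exists_hom_of_le {ι D : Type} [CStarAlgebra D] {X Y : NCSpace ι}
    {Q : ∀ (D : Type) [Ring D] [Algebra ℂ D], (ι → D) → Prop} (hX : IsUniversal X Q)
    (h : X ≤ Y) {f : ι → D} (hsa : ∀ i, IsSelfAdjoint (f i)) (hf : Q D f) :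
    ∃ φ : Y.C →⋆ₐ[ℂ] D, ∀ i, φ (Y.coord i) = f i := by
  obtain ⟨φ, hφ⟩ := hX.hom hsa hf
  obtain ⟨ψ, hψ⟩ := h
  exact ⟨φ.comp ψ, fun i => by rw [StarAlgHom.comp_apply, hψ, hφ]⟩

open scoped Matrix.Norms.L2Operator in
-- Two Pauli matrices.
theorem exists_anticommuting_reflections : ∃ (D : Type) (_ : CStarAlgebra D) (x z : D),
    IsSelfAdjoint x ∧ IsSelfAdjoint z ∧ x * x = 1 ∧ z * z = 1 ∧ x * z = -(z * x) ∧
      x * z ≠ -(x * z) := by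
  refine ⟨Matrix (Fin 2) (Fin 2) ℂ, {}, !![0, 1; 1, 0], !![1, 0; 0, -1], ?_, ?_, ?_, ?_, ?_, ?_⟩
  · ext i j; fin_cases i <;> fin_cases j <;> simp
  · ext i j; fin_cases i <;> fin_cases j <;> simp
  · ext i j; fin_cases i <;> fin_cases j <;> simp
  · ext i j; fin_cases i <;> fin_cases j <;> simp
  · ext i j; fin_cases i <;> fin_cases j <;> simp
  · intro h
    have := congrFun (congrFun h 0) 1
    simp at this
    norm_num [self_eq_neg] at this

/-! ### Test matrices: diagonal matrices and a symmetric $2\times2$ block. -/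

section Diagonal

variable {N : ℕ} {D : Type} [Ring D]

/-- The diagonal matrix with given entries. -/
def diagTuple (d : Fin N → D) (a : Fin N × Fin N) : D := if a.1 = a.2 then d a.1 else 0

theorem diagTuple_self (d : Fin N → D) (i : Fin N) : diagTuple d (i, i) = d i := if_pos rfl

theorem isSelfAdjoint_diagTuple [StarRing D] {d : Fin N → D} (h : ∀ i, IsSelfAdjoint (d i))
    (a : Fin N × Fin N) : IsSelfAdjoint (diagTuple d a) := by
  unfold diagTuple
  split_ifs
  · exact h _
  · exact IsSelfAdjoint.zero D

theorem orth_diagTuple {d : Fin N → D} (h : ∀ i, d i * d i = 1) : Orth (diagTuple d) := by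
  constructor <;> intro i j <;> rcases eq_or_ne i j with rfl | hij
  · simp [diagTuple, h]
  · simp [diagTuple, hij]
  · simp [diagTuple, h]
  · simp [diagTuple, hij, hij.symm]

theorem diagTuple_eq_zero_or {a b : Fin N × Fin N} (hab : a ≠ b) (hl : SameLine a b)
    (d : Fin N → D) : diagTuple d a = 0 ∨ diagTuple d b = 0 := by
  unfold diagTuple
  by_cases h1 : a.1 = a.2
  · by_cases h2 : b.1 = b.2
    · refine absurd (Prod.ext ?_ ?_) hab <;> rcases hl with h | h <;> simp_all
    · exact Or.inr (if_neg h2)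
  · exact Or.inl (if_neg h1)

theorem cubicRel_diagTuple (d : Fin N → D) : CubicRel (diagTuple d) := fun a b hab hl => by
  rcases diagTuple_eq_zero_or hab hl d with h | h <;> simp [h]

theorem inftyRel_diagTuple (d : Fin N → D) : InftyRel (diagTuple d) := fun a b c hac hl => by
  rcases diagTuple_eq_zero_or hac hl d with h | h <;> simp [h]

end Diagonal

section Block

variable {N : ℕ} {D : Type} [Ring D]

/-- The symmetric matrix with a `2 × 2` block having entries `p, q, q, s` on the rows and columns
`i₀, i₁`, completed by the identity. -/
def blockTuple (i₀ i₁ : Fin N) (p q s : D) (a : Fin N × Fin N) : D :=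
  if a = (i₀, i₀) then p else if a = (i₁, i₁) then s
  else if a = (i₀, i₁) ∨ a = (i₁, i₀) then q else if a.1 = a.2 then 1 else 0

variable {i₀ i₁ : Fin N} {p q s : D}

theorem blockTuple_swap (i j : Fin N) :
    blockTuple i₀ i₁ p q s (i, j) = blockTuple i₀ i₁ p q s (j, i) := by
  simp only [blockTuple, Prod.mk.injEq]
  simp only [and_comm, or_comm, eq_comm]

theorem blockTuple_cases (i₀ i₁ : Fin N) (p q s : D) (a : Fin N × Fin N) :
    (a = (i₀, i₀) ∧ blockTuple i₀ i₁ p q s a = p) ∨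
    (a = (i₁, i₁) ∧ blockTuple i₀ i₁ p q s a = s) ∨
    ((a = (i₀, i₁) ∨ a = (i₁, i₀)) ∧ blockTuple i₀ i₁ p q s a = q) ∨
    (a.1 = a.2 ∧ a.1 ≠ i₀ ∧ a.1 ≠ i₁ ∧ blockTuple i₀ i₁ p q s a = 1) ∨
    blockTuple i₀ i₁ p q s a = 0 := by
  obtain ⟨i, j⟩ := a
  simp only [blockTuple, Prod.mk.injEq]
  split_ifs <;> simp_all

theorem isSelfAdjoint_blockTuple [StarRing D] (hp : IsSelfAdjoint p) (hq : IsSelfAdjoint q)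
    (hs : IsSelfAdjoint s) (a : Fin N × Fin N) : IsSelfAdjoint (blockTuple i₀ i₁ p q s a) := by
  unfold blockTuple
  split_ifs
  exacts [hp, hs, hq, IsSelfAdjoint.one D, IsSelfAdjoint.zero D]

theorem blockTuple_left (h : i₀ ≠ i₁) : blockTuple i₀ i₁ p q s (i₀, i₀) = p ∧
    blockTuple i₀ i₁ p q s (i₀, i₁) = q := by
  simp [blockTuple, h, h.symm]

theorem orth_blockTuple (h : i₀ ≠ i₁) (hpq : p * p + q * q = 1) (hqs : q * q + s * s = 1)
    (h₁ : p * q + q * s = 0) (h₂ : q * p + s * q = 0) : Orth (blockTuple i₀ i₁ p q s) := by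
  have hrow : ∀ i j, ∑ k, blockTuple i₀ i₁ p q s (i, k) * blockTuple i₀ i₁ p q s (j, k) =
      if i = j then 1 else 0 := by
    intro i j
    rcases eq_or_ne i i₀ with rfl | hi₀
    · rw [Fintype.sum_eq_add i i₁ h fun k hk => by simp [blockTuple, hk.1, hk.2, hk.1.symm]]
      rcases eq_or_ne j i with rfl | hj₀
      · simp [blockTuple, h, h.symm, hpq]
      · rcases eq_or_ne j i₁ with rfl | hj₁
        · simp [blockTuple, h, h.symm, h₁]
        · simp [blockTuple, h, h.symm, hj₀, hj₁, hj₀.symm]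
    rcases eq_or_ne i i₁ with rfl | hi₁
    · rw [Fintype.sum_eq_add i₀ i h fun k hk => by simp [blockTuple, hk.1, hk.2, hk.2.symm]]
      rcases eq_or_ne j i₀ with rfl | hj₀
      · simp [blockTuple, h, h.symm, h₂]
      · rcases eq_or_ne j i with rfl | hj₁
        · simp [blockTuple, h, h.symm, hqs]
        · simp [blockTuple, h, h.symm, hj₀, hj₁, hj₁.symm]
    · rw [Fintype.sum_eq_single i fun k hk => by simp [blockTuple, hi₀, hi₁, hk.symm]]
      rcases eq_or_ne i j with rfl | hj
      · simp [blockTuple, hi₀, hi₁]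
      · simp [blockTuple, hi₀, hi₁, hj, hj.symm]
  exact ⟨hrow, fun i j => by simp only [blockTuple_swap _ i, blockTuple_swap _ j, hrow]⟩

theorem twistedRel_blockTuple (h : i₀ ≠ i₁) (hps : p * s = s * p) (hpq : p * q = -(q * p))
    (hsq : s * q = -(q * s)) : TwistedRel (blockTuple i₀ i₁ p q s) := by
  have hqp : q * p = -(p * q) := by rw [hpq, neg_neg]
  have hqs : q * s = -(s * q) := by rw [hsq, neg_neg]
  refine ⟨fun a b hab hl => ?_, fun a b hl => ?_⟩
  · have key : a.1 = b.1 ∧ a.2 ≠ b.2 ∨ a.2 = b.2 ∧ a.1 ≠ b.1 := by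
      rcases hl with hl | hl
      · exact Or.inl ⟨hl, fun e => hab (Prod.ext hl e)⟩
      · exact Or.inr ⟨hl, fun e => hab (Prod.ext e hl)⟩
    rcases blockTuple_cases i₀ i₁ p q s a with ⟨rfl, ha⟩ | ⟨rfl, ha⟩ | ⟨rfl | rfl, ha⟩ |
        ⟨ha₁, ha₂, ha₃, ha⟩ | ha <;>
      rcases blockTuple_cases i₀ i₁ p q s b with ⟨rfl, hb⟩ | ⟨rfl, hb⟩ | ⟨rfl | rfl, hb⟩ |
        ⟨hb₁, hb₂, hb₃, hb⟩ | hb <;>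
      simp only [ha, hb] <;> first | assumption | grind
  · have key : a.1 ≠ b.1 ∧ a.2 ≠ b.2 := not_or.mp hl
    rcases blockTuple_cases i₀ i₁ p q s a with ⟨rfl, ha⟩ | ⟨rfl, ha⟩ | ⟨rfl | rfl, ha⟩ |
        ⟨ha₁, ha₂, ha₃, ha⟩ | ha <;>
      rcases blockTuple_cases i₀ i₁ p q s b with ⟨rfl, hb⟩ | ⟨rfl, hb⟩ | ⟨rfl | rfl, hb⟩ |
        ⟨hb₁, hb₂, hb₃, hb⟩ | hb <;>
      simp only [ha, hb] <;> first | assumption | exact hps.symm | grind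

end Block

theorem exists_sq_add_sq_eq_one : ∃ r : ℝ, r ≠ 0 ∧ (r : ℂ) * r + r * r = 1 := by
  refine ⟨√(1 / 2), by positivity, ?_⟩
  have : √(1 / 2) * √(1 / 2) = 1 / 2 := Real.mul_self_sqrt (by norm_num)
  rw [← Complex.ofReal_mul, this]
  norm_num

/-! ### Non-inclusions detected by the test matrices. -/

section NotLe

variable {N : ℕ}

/-- The block with rows $(rx,rz)$ and $(rz,rx)$, where $2r^2=1$ and $x,z$ are anticommuting
reflections, is a model of $\bar O_N$. Its entries $rx$ and $rz$ on a row neither commute nor have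
product zero. -/
theorem twistedOrth_not_le (hN : 2 ≤ N) :
    ¬ twistedOrth N ≤ classicalOrth N ∧ ¬ twistedOrth N ≤ halfHyper N := by
  obtain ⟨D, _, x, z, hx, hz, hxx, hzz, hxz, hne⟩ := exists_anticommuting_reflections
  obtain ⟨r, hr0, hr⟩ := exists_sq_add_sq_eq_one
  let i₀ : Fin N := ⟨0, by lia⟩
  let i₁ : Fin N := ⟨1, by lia⟩
  have h01 : i₀ ≠ i₁ := by simp [i₀, i₁]
  have hc : (r : ℂ) * r ≠ 0 := by exact_mod_cast mul_ne_zero hr0 hr0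
  have hsa : ∀ y : D, IsSelfAdjoint y → IsSelfAdjoint ((r : ℂ) • y) := fun y hy => by
    rw [IsSelfAdjoint, star_smul, hy.star_eq]; simp
  have hT : TwistedRel (blockTuple i₀ i₁ ((r : ℂ) • x) ((r : ℂ) • z) ((r : ℂ) • x)) :=
    twistedRel_blockTuple h01 rfl
      (by rw [smul_mul_smul_comm, smul_mul_smul_comm, hxz, smul_neg])
      (by rw [smul_mul_smul_comm, smul_mul_smul_comm, hxz, smul_neg])
  have hO : Orth (blockTuple i₀ i₁ ((r : ℂ) • x) ((r : ℂ) • z) ((r : ℂ) • x)) := by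
    refine orth_blockTuple h01 ?_ ?_ ?_ ?_ <;>
      simp only [smul_mul_smul_comm, hxx, hzz, hxz, ← add_smul, hr, one_smul, smul_neg,
        neg_add_cancel, add_neg_cancel]
  obtain ⟨hp, hq⟩ := blockTuple_left (p := (r : ℂ) • x) (q := (r : ℂ) • z) (s := (r : ℂ) • x) h01
  have hne0 : x * z ≠ 0 := fun h => hne (by rw [h, neg_zero])
  constructor <;> intro hle
  · obtain ⟨φ, hφ⟩ := (isUniversal_twistedOrth N).exists_hom_of_le hle
      (isSelfAdjoint_blockTuple (hsa x hx) (hsa z hz) (hsa x hx)) ⟨hO, hT⟩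
    have h := congrArg φ ((isUniversal_classicalOrth N).coord.2 (i₀, i₀) (i₀, i₁))
    rw [map_mul, map_mul, hφ, hφ, hp, hq, smul_mul_smul_comm, smul_mul_smul_comm,
      smul_right_inj hc] at h
    exact hne (hxz.trans (congrArg _ h.symm))
  · obtain ⟨φ, hφ⟩ := (isUniversal_twistedOrth N).exists_hom_of_le hle
      (isSelfAdjoint_blockTuple (hsa x hx) (hsa z hz) (hsa x hx)) ⟨hO, hT⟩
    have h := congrArg φ ((isUniversal_halfHyper N).coord.2.1 (i₀, i₀) (i₀, i₁)
      (by simp [h01]) (Or.inl rfl))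
    rw [map_mul, map_zero, hφ, hφ, hp, hq, smul_mul_smul_comm, smul_eq_zero] at h
    exact h.elim hc hne0

theorem exists_orthogonal_block (hN : 2 ≤ N) : ∃ (f : Fin N × Fin N → ℂ) (a b : Fin N × Fin N),
    a ≠ b ∧ SameLine a b ∧ f a ≠ 0 ∧ f b ≠ 0 ∧ (∀ i, IsSelfAdjoint (f i)) ∧ Orth f := by
  obtain ⟨r, hr0, hr⟩ := exists_sq_add_sq_eq_one
  let i₀ : Fin N := ⟨0, by lia⟩
  let i₁ : Fin N := ⟨1, by lia⟩
  have h01 : i₀ ≠ i₁ := by simp [i₀, i₁]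
  have hr0' : (r : ℂ) ≠ 0 := by exact_mod_cast hr0
  have hsa : IsSelfAdjoint (r : ℂ) := Complex.conj_ofReal r
  obtain ⟨hp, hq⟩ := blockTuple_left (p := (r : ℂ)) (q := (r : ℂ)) (s := -(r : ℂ)) h01
  refine ⟨blockTuple i₀ i₁ (r : ℂ) r (-r), (i₀, i₀), (i₀, i₁), by simp [h01], Or.inl rfl, ?_, ?_,
    isSelfAdjoint_blockTuple hsa hsa hsa.neg,
    orth_blockTuple h01 hr (by rw [neg_mul_neg, hr]) (by ring) (by ring)⟩
  · rwa [hp]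
  · rwa [hq]

theorem classicalOrth_not_le_twistedOrth (hN : 2 ≤ N) : ¬ classicalOrth N ≤ twistedOrth N := by
  intro hle
  obtain ⟨f, a, b, hab, hl, ha, hb, hsa, hO⟩ := exists_orthogonal_block hN
  obtain ⟨φ, hφ⟩ := (isUniversal_classicalOrth N).exists_hom_of_le hle hsa
    ⟨hO, fun i j => mul_comm _ _⟩
  have h := congrArg φ ((isUniversal_twistedOrth N).coord.2.1 a b hab hl)
  rw [map_neg, map_mul, map_mul, hφ, hφ, mul_comm (f b), self_eq_neg] at h
  exact mul_ne_zero ha hb h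

theorem halfOrth_not_le_hyperInfty (hN : 2 ≤ N) : ¬ halfOrth N ≤ hyperInfty N := by
  intro hle
  obtain ⟨f, a, b, hab, hl, ha, hb, hsa, hO⟩ := exists_orthogonal_block hN
  obtain ⟨φ, hφ⟩ := (isUniversal_halfOrth N).exists_hom_of_le hle hsa
    ⟨hO, CommRel.halfRel fun i j => mul_comm _ _⟩
  have h := congrArg φ ((isUniversal_hyperInfty N).coord.2 a a b hab hl)
  rw [map_zero, map_mul, map_mul, hφ, hφ] at h
  exact mul_ne_zero (mul_ne_zero ha ha) hb h

theorem halfHyper_not_le_twistedOrth (hN : 2 ≤ N) : ¬ halfHyper N ≤ twistedOrth N := by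
  intro hle
  obtain ⟨D, _, x, z, hx, hz, hxx, hzz, hxz, hne⟩ := exists_anticommuting_reflections
  let i₀ : Fin N := ⟨0, by lia⟩
  let i₁ : Fin N := ⟨1, by lia⟩
  have h01 : i₀ ≠ i₁ := by simp [i₀, i₁]
  -- Among three letters taken from $x,z$, either the outer two coincide or two neighbors do and
  -- multiply to $1$, so the diagonal matrix half-commutes. Yet $x$ and $z$ sit on different lines,
  -- where $\bar O_N$ would require them to commute.
  let d : Fin N → D := fun i => if i = i₀ then x else z
  have hd : ∀ i, d i = x ∨ d i = z := fun i => by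
    by_cases h : i = i₀
    · exact Or.inl (if_pos h)
    · exact Or.inr (if_neg h)
  have hzx : z * x = -(x * z) := by rw [hxz, neg_neg]
  have hH : HalfRel (diagTuple d) := by
    have hf : ∀ a, diagTuple d a = x ∨ diagTuple d a = z ∨ diagTuple d a = 0 := fun a => by
      unfold diagTuple
      split_ifs
      · exact (hd _).imp_right Or.inl
      · exact Or.inr (Or.inr rfl)
    intro a b c
    rcases hf a with ha | ha | ha <;> rcases hf b with hb | hb | hb <;>
      rcases hf c with hc | hc | hc <;>
      simp [ha, hb, hc, mul_assoc, hxx, hzz, hzx]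
    all_goals simp [← mul_assoc, hxx]
  obtain ⟨φ, hφ⟩ := (isUniversal_halfHyper N).exists_hom_of_le hle
    (isSelfAdjoint_diagTuple fun i => by rcases hd i with h | h <;> rw [h] <;> assumption)
    ⟨orth_diagTuple fun i => by rcases hd i with h | h <;> rw [h] <;> assumption,
      cubicRel_diagTuple d, hH⟩
  have h := congrArg φ ((isUniversal_twistedOrth N).coord.2.2 (i₀, i₀) (i₁, i₁)
    (by simp [SameLine, h01]))
  rw [map_mul, map_mul, hφ, hφ, diagTuple_self, diagTuple_self, show d i₀ = x from if_pos rfl,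
    show d i₁ = z from if_neg h01.symm, hzx] at h
  exact hne h

theorem hyperInfty_not_le_halfOrth (hN : 3 ≤ N) : ¬ hyperInfty N ≤ halfOrth N := by
  intro hle
  obtain ⟨D, _, x, z, hx, hz, hxx, hzz, hxz, hne⟩ := exists_anticommuting_reflections
  let i₀ : Fin N := ⟨0, by lia⟩
  let i₁ : Fin N := ⟨1, by lia⟩
  let i₂ : Fin N := ⟨2, by lia⟩
  -- Three diagonal places are needed: half-commutation of $x,1,z$ would give $xz=zx$.
  let d : Fin N → D := fun i => if i = i₀ then x else if i = i₁ then 1 else z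
  have hd₀ : d i₀ = x := if_pos rfl
  have hd₁ : d i₁ = 1 := by simp [d, i₀, i₁]
  have hd₂ : d i₂ = z := by simp [d, i₀, i₁, i₂]
  have hzx : z * x = -(x * z) := by rw [hxz, neg_neg]
  obtain ⟨φ, hφ⟩ := (isUniversal_hyperInfty N).exists_hom_of_le hle (f := diagTuple d)
    (isSelfAdjoint_diagTuple fun i => by
      simp only [d]
      split_ifs
      exacts [hx, IsSelfAdjoint.one D, hz])
    ⟨orth_diagTuple fun i => by
      simp only [d]
      split_ifs
      exacts [hxx, mul_one 1, hzz], inftyRel_diagTuple d⟩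
  have h := congrArg φ ((isUniversal_halfOrth N).coord.2 (i₀, i₀) (i₁, i₁) (i₂, i₂))
  simp only [map_mul, hφ, diagTuple_self, hd₀, hd₁, hd₂, mul_one, hzx] at h
  exact hne h

end NotLe

end QIso

end

open QIso

theorem theorem5p3 (N : ℕ) (hN : 1 ≤ N) :
    -- the spheres associated to the three basic reflection groups
    (SameSpace (associatedSphere (cubeGroup N)) (classicalSphere N) ∧
      SameSpace (associatedSphere (halfGroup N)) (halfSphere N) ∧
      SameSpace (associatedSphere (freeGroup N)) (sphereInfty N)) ∧
    -- the inclusions between the cubes and the spheres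
    (classicalSphere N ≤ halfSphere N ∧ halfSphere N ≤ sphereInfty N ∧
      cube (cubeGroup N) ≤ cube (halfGroup N) ∧ cube (halfGroup N) ≤ cube (freeGroup N) ∧
      cube (cubeGroup N) ≤ classicalSphere N ∧ cube (halfGroup N) ≤ halfSphere N ∧
      cube (freeGroup N) ≤ sphereInfty N) ∧
    -- the quantum isometry groups
    (IsQuantumIsometryGroup (classicalSphere N) (classicalOrth N) ∧
      IsQuantumIsometryGroup (halfSphere N) (halfOrth N) ∧
      (N ≠ 2 → IsQuantumIsometryGroup (sphereInfty N) (hyperInfty N)) ∧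
      IsQuantumIsometryGroup (cube (cubeGroup N)) (twistedOrth N) ∧
      IsQuantumIsometryGroup (cube (halfGroup N)) (halfHyper N) ∧
      IsQuantumIsometryGroup (cube (freeGroup N)) (freeHyper N)) ∧
    -- the inclusions between the quantum isometry groups
    (classicalOrth N ≤ halfOrth N ∧ halfHyper N ≤ freeHyper N ∧ halfHyper N ≤ halfOrth N ∧
      hyperInfty N ≤ freeHyper N) ∧
    -- the lack of inclusions, in both directions, for the remaining pairs of neighbors
    (2 ≤ N →
      (¬ twistedOrth N ≤ classicalOrth N ∧ ¬ classicalOrth N ≤ twistedOrth N) ∧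
      (¬ twistedOrth N ≤ halfHyper N ∧ ¬ halfHyper N ≤ twistedOrth N) ∧
      ¬ halfOrth N ≤ hyperInfty N ∧ (N ≠ 2 → ¬ hyperInfty N ≤ halfOrth N)) := by
  have hc₁ := cube_cubeGroup_le_halfGroup N
  have hc₂ := cube_halfGroup_le_freeGroup N
  have hs₀ := cube_cubeGroup_le_classicalSphere hN
  have hs₁ := classicalSphere_le_halfSphere N
  have hs₂ := halfSphere_le_sphereInfty N
  have hcO := isUniversal_classicalOrth N
  have hhO := isUniversal_halfOrth N
  have hfH := isUniversal_freeHyper N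
  have hhH := isUniversal_halfHyper N
  have hiH := isUniversal_hyperInfty N
  refine ⟨⟨associatedSphere_cubeGroup N, associatedSphere_halfGroup N, associatedSphere_freeGroup N⟩,
    ⟨hs₁, hs₂, hc₁, hc₂, hs₀, cube_halfGroup_le_halfSphere hN, cube_freeGroup_le_sphereInfty hN⟩,
    ⟨?_, ?_, fun hN2 => ?_, ?_, ?_, ?_⟩, ⟨?_, ?_, ?_, ?_⟩, fun hN2 => ⟨?_, ?_, ?_, fun h => ?_⟩⟩
  · exact isQuantumIsometryGroup_of_universal classicalSphere_algebraic hs₀ hcO (isGroupRel_comm N)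
      (classicalOrth_actsOn N) fun G hG hA => commRel_of_actsOn hN hG hA
  -- This sphere is defined by polynomial relations inside the free sphere, so its algebraicity is
  -- reflexivity; likewise for `sphereInfty N`.
  · exact isQuantumIsometryGroup_of_universal ⟨le_refl _, le_refl _⟩ (hs₀.trans hs₁) hhO
      (isGroupRel_half N) (halfOrth_actsOn N) fun G hG hA => halfRel_of_actsOn hN hG hA
  · exact isQuantumIsometryGroup_of_universal ⟨le_refl _, le_refl _⟩ (hs₀.trans (hs₁.trans hs₂))
      hiH (isGroupRel_infty N) (hyperInfty_actsOn N) fun G hG hA => inftyRel_of_actsOn hN hN2 hG hA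
  · exact isQuantumIsometryGroup_of_universal (cube_cubeGroup_algebraic hN) le_rfl
      (isUniversal_twistedOrth N) (isGroupRel_twisted N) (twistedOrth_actsOn N)
      fun G hG hA => twistedRel_of_actsOn hG hA
  · exact isQuantumIsometryGroup_of_universal (cube_halfGroup_algebraic hN) hc₁ hhH
      ((isGroupRel_cubic N).and (isGroupRel_half N)) (halfHyper_actsOn N) fun G hG hA =>
        ⟨cubicRel_of_actsOn_halfGroup hG hA, halfRel_of_actsOn_halfGroup hG hA⟩
  · exact isQuantumIsometryGroup_of_universal (cube_freeGroup_algebraic hN) (hc₁.trans hc₂) hfH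
      (isGroupRel_cubic N) (freeHyper_actsOn N) fun G hG hA => cubicRel_of_actsOn_freeGroup hG hA
  · exact hhO.le ⟨hcO.coord.1, hcO.coord.2.halfRel⟩
  · exact hfH.le ⟨hhH.coord.1, hhH.coord.2.1⟩
  · exact hhO.le ⟨hhH.coord.1, hhH.coord.2.2⟩
  · exact hfH.le ⟨hiH.coord.1, hiH.coord.2.cubicRel hiH.coord.1⟩
  · exact ⟨(twistedOrth_not_le hN2).1, classicalOrth_not_le_twistedOrth hN2⟩
  · exact ⟨(twistedOrth_not_le hN2).2, halfHyper_not_le_twistedOrth hN2⟩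
  · exact halfOrth_not_le_hyperInfty hN2
  · exact hyperInfty_not_le_halfOrth (by lia)
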